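/- A group $G$ of affine transformations $z\mapsto az+b$ ($a\in\mathbb C^*$, $b\in\mathbb C$) of the complex line is called discrete if it acts properly discontinuously on $\mathbb C$, i.e. for all compact $K,L\subset\mathbb C$ only finitely many $g\in G$ satisfy $g(K)\cap L\neq\emptyset$. Let $S=\mathbb C\cup\{\infty\}$ be the Riemann sphere. A holomorphic map $\pi:\mathbb C\to S$ is a covering with signature $(A,B,R)$ if $A,B\subset S$ are finite and disjoint, $\pi(\mathbb C)=S\setminus B$, $\pi$ is a branched covering over $S\setminus B$, unbranched over $S\setminus(A\cup B)$, and the local monodromy operator at each $a\in A$ has finite order $r_a>1$; the set of orders $R$ (with repetitions) consists of the $r_a$, $a\in A$, and of one entry $\infty$ for each point of $B$. It is the universal covering with this signature if moreover $\pi$ has multiplicity $r_a$ at every point of $\pi^{-1}(a)$ for every $a\in A$. A signature of $G$ is a signature of a covering $\pi:\mathbb C\to S$ whose fibres are exactly the $G$-orbits, so that $\pi$ realizes the quotient map $\mathbb C\to\mathbb C/G\cong S\setminus B$. Let $S_k\subset\mathbb C^*$ be the subgroup of order $k$, let $(1,c)=\mathbb Z+\mathbb Zc$, and let $\tau_6=e^{2\pi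 i/6}$. **Theorem 8.** A group $G$ of affine transformations of $\mathbb C$ is discrete if and only if, up to an affine change of coordinate, it is one of the following groups of transformations $z\mapsto az+b$: 1. $a\in S_k$, $b=0$, where $k\ge1$; 2. $a=1$, $b\in\mathbb Z$; 3. $a\in S_2$, $b\in\mathbb Z$; 4. $a=1$, $b\in(1,c)$, where $c\in\mathbb C\setminus\mathbb R$; 5. $a\in S_2$, $b\in(1,c)$, where $c\in\mathbb C\setminus\mathbb R$; 6. $a\in S_4$, $b\in(1,i)$; 7. $a\in S_3$, $b\in(1,\tau_6)$; 8. $a\in S_6$, $b\in(1,\tau_6)$. In types 4 and 5, the groups with parameters $c$ and $c'$ differ by an affine change of coordinate if and only if $c'=\frac{pc+q}{rc+s}$ for some integers $p,q,r,s$ with $ps-qr=\pm1$. If $G$ is of type 4, then $\mathbb C\to\mathbb C/G$ is a holomorphic covering of a curve of genus one (a Riemann surface homeomorphic to the torus). If $G$ is of another type, then $G$ has a signature, every covering $\pi:\mathbb C\to S$ realizing the quotient by $G$ and having a signature is the universal covering with this signature, and the signature is determined up to an automorphism of the sphere as follows. In types 1, 2, 3, 6, 7, 8 the signatures of $G$ are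 exactly the signatures with the set of orders, respectively, $$(k,\infty),\quad(\infty,\infty),\quad(2,2,\infty),\quad(4,4,2),\quad(3,3,3),\quad(6,3,2)$$ (for the trivial group, $k=1$, the entry $1$ is omitted and $R=(\infty)$), and any two of them differ by an automorphism of the sphere. In type 5 there is $\lambda\in\mathbb C\setminus\{0,1\}$ such that the signatures of $G$ are exactly the images under automorphisms of the sphere of the signature $A=\{0,1,\infty,\lambda\}$, $B=\emptyset$, $R=(2,2,2,2)$; and $\{0,1,\infty,\lambda'\}$ with $\lambda'\in\mathbb C\setminus\{0,1\}$ and orders $(2,2,2,2)$ is a signature of $G$ if and only if $\lambda'\in\{\lambda,\,1-\lambda,\,\lambda^{-1},\,(1-\lambda)^{-1},\,\lambda(\lambda-1)^{-1},\,\lambda^{-1}(\lambda-1)\}$. -/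

import Mathlib

open scoped Manifold ContDiff Topology

noncomputable section

namespace AffineDiscrete

/-- The group of affine transformations `z ↦ a z + b`, `a ≠ 0`, of the complex line. -/
abbrev Aff : Type := ℂ ≃ᵃ[ℂ] ℂ

/-- A discrete group of affine transformations: it acts properly discontinuously on `ℂ`. -/
def IsDiscreteGroup (G : Subgroup Aff) : Prop :=
  ∀ K L : Set ℂ, IsCompact K → IsCompact L →
    {g : Aff | g ∈ G ∧ ((fun z => g z) '' K ∩ L).Nonempty}.Finite

/-- `G` becomes `H` after an affine change of the coordinate. -/
def AffConj (G H : Subgroup Aff) : Prop :=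
  ∃ φ : Aff, H = G.map (MulAut.conj φ).toMonoidHom

/-! ### The groups of the list -/

/-- The group of all transformations `z ↦ a z + b` with `a ^ k = 1` and `b ∈ Λ`, where `Λ` is
stable under multiplication by `k`-th roots of unity. -/
def affineGroup (k : ℕ) (Λ : AddSubgroup ℂ) (hk : 0 < k)
    (hΛ : ∀ a b : ℂ, a ^ k = 1 → b ∈ Λ → a * b ∈ Λ) : Subgroup Aff where
  carrier := {g | ∃ a b : ℂ, a ^ k = 1 ∧ b ∈ Λ ∧ ∀ z, g z = a * z + b}
  one_mem' := ⟨1, 0, one_pow k, Λ.zero_mem, fun z => by simp⟩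
  mul_mem' := by
    rintro g h ⟨a, b, ha, hb, hg⟩ ⟨a', b', ha', hb', hh⟩
    refine ⟨a * a', a * b' + b, by rw [mul_pow, ha, ha', one_mul],
      Λ.add_mem (hΛ a b' ha hb') hb, fun z => ?_⟩
    rw [AffineEquiv.mul_def, AffineEquiv.trans_apply, hh, hg]
    ring
  inv_mem' := by
    rintro g ⟨a, b, ha, hb, hg⟩
    have ha0 : a ≠ 0 := by
      rintro rfl
      rw [zero_pow hk.ne'] at ha
      exact zero_ne_one ha
    have hai : a⁻¹ ^ k = 1 := by rw [inv_pow, ha, inv_one]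
    refine ⟨a⁻¹, -(a⁻¹ * b), hai, Λ.neg_mem (hΛ _ _ hai hb), fun z => ?_⟩
    rw [AffineEquiv.inv_def, AffineEquiv.symm_apply_eq, hg]
    field_simp
    ring

/-- The additive group `(1, c)` generated by `1` and `c`. -/
def lattice (c : ℂ) : AddSubgroup ℂ := AddSubgroup.closure {1, c}

/-- The additive group of the integers inside `ℂ`. -/
def integers : AddSubgroup ℂ := AddSubgroup.closure {1}

/-- A primitive sixth root of unity. -/
def tau6 : ℂ := Complex.exp (2 * Real.pi * Complex.I / 6)

theorem tau6_primitive : IsPrimitiveRoot tau6 6 := by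
  have h := Complex.isPrimitiveRoot_exp 6 (by norm_num)
  simpa [tau6] using h

theorem tau6_sq : tau6 * tau6 = tau6 - 1 := by
  have h6 := tau6_primitive.pow_eq_one
  have h3 : tau6 ^ 3 ≠ 1 := tau6_primitive.pow_ne_one_of_pos_of_lt (by norm_num) (by norm_num)
  have h2 : tau6 ^ 2 ≠ 1 := tau6_primitive.pow_ne_one_of_pos_of_lt (by norm_num) (by norm_num)
  have e1 : tau6 ^ 3 + 1 = 0 := by
    have : (tau6 ^ 3 - 1) * (tau6 ^ 3 + 1) = 0 := by linear_combination h6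
    exact (mul_eq_zero.1 this).resolve_left (sub_ne_zero.2 h3)
  have hne : tau6 + 1 ≠ 0 := fun h => h2 (by linear_combination (tau6 - 1) * h)
  have e2 : (tau6 + 1) * (tau6 ^ 2 - tau6 + 1) = 0 := by linear_combination e1
  have e3 := (mul_eq_zero.1 e2).resolve_left hne
  linear_combination e3

theorem mul_mem_lattice {c : ℂ} (hc : c * c ∈ lattice c) {b : ℂ} (hb : b ∈ lattice c) :
    c * b ∈ lattice c := by
  unfold lattice at *
  induction hb using AddSubgroup.closure_induction with
  | mem x hx =>
    rcases hx with rfl | hx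
    · rw [mul_one]; exact AddSubgroup.subset_closure (by simp)
    · rw [Set.mem_singleton_iff] at hx
      subst hx
      exact hc
  | zero => simp
  | add x y _ _ hx hy => rw [mul_add]; exact AddSubgroup.add_mem _ hx hy
  | neg x _ hx => rw [mul_neg]; exact AddSubgroup.neg_mem _ hx

theorem pow_mul_mem_lattice {c : ℂ} (hc : c * c ∈ lattice c) (n : ℕ) {b : ℂ}
    (hb : b ∈ lattice c) : c ^ n * b ∈ lattice c := by
  induction n with
  | zero => simpa using hb
  | succ n ih => rw [pow_succ', mul_assoc]; exact mul_mem_lattice hc ih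

theorem roots_stable {c : ℂ} {k : ℕ} (hk : 0 < k) (hp : IsPrimitiveRoot c k)
    (hc : c * c ∈ lattice c) (a b : ℂ) (ha : a ^ k = 1) (hb : b ∈ lattice c) :
    a * b ∈ lattice c := by
  have : NeZero k := ⟨hk.ne'⟩
  obtain ⟨i, -, rfl⟩ := hp.eq_pow_of_pow_eq_one ha
  exact pow_mul_mem_lattice hc i hb

theorem stable_one (Λ : AddSubgroup ℂ) (a b : ℂ) (ha : a ^ 1 = 1) (hb : b ∈ Λ) : a * b ∈ Λ := by
  rw [pow_one] at ha
  simpa [ha] using hb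

theorem stable_two (Λ : AddSubgroup ℂ) (a b : ℂ) (ha : a ^ 2 = 1) (hb : b ∈ Λ) : a * b ∈ Λ := by
  rw [sq, mul_self_eq_one_iff] at ha
  rcases ha with rfl | rfl
  · simpa using hb
  · simpa using hb

theorem stable_four (a b : ℂ) (ha : a ^ 4 = 1) (hb : b ∈ lattice Complex.I) :
    a * b ∈ lattice Complex.I := by
  refine roots_stable (by norm_num) ?_ ?_ a b ha hb
  · exact Complex.isPrimitiveRoot_I
  · rw [Complex.I_mul_I]
    exact AddSubgroup.neg_mem _ (AddSubgroup.subset_closure (by simp))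

theorem stable_six (a b : ℂ) (ha : a ^ 6 = 1) (hb : b ∈ lattice tau6) :
    a * b ∈ lattice tau6 := by
  refine roots_stable (by norm_num) tau6_primitive ?_ a b ha hb
  rw [tau6_sq]
  exact AddSubgroup.sub_mem _ (AddSubgroup.subset_closure (by simp))
    (AddSubgroup.subset_closure (by simp))

theorem stable_three (a b : ℂ) (ha : a ^ 3 = 1) (hb : b ∈ lattice tau6) :
    a * b ∈ lattice tau6 :=
  stable_six a b (by linear_combination (a ^ 3 + 1) * ha) hb

/-- `a ∈ S_k`, `b = 0`. -/
def rotations (k : ℕ) (hk : 0 < k) : Subgroup Aff :=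
  affineGroup k ⊥ hk (fun a b _ hb => by
    rw [AddSubgroup.mem_bot] at hb ⊢; rw [hb, mul_zero])

/-- `a = 1`, `b ∈ ℤ`. -/
def integerTranslations : Subgroup Aff := affineGroup 1 integers one_pos (stable_one _)

/-- `a ∈ S_2`, `b ∈ ℤ`. -/
def integerDihedral : Subgroup Aff := affineGroup 2 integers two_pos (stable_two _)

/-- `a = 1`, `b ∈ (1, c)`. -/
def latticeTranslations (c : ℂ) : Subgroup Aff :=
  affineGroup 1 (lattice c) one_pos (stable_one _)

/-- `a ∈ S_2`, `b ∈ (1, c)`. -/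
def latticeTwo (c : ℂ) : Subgroup Aff := affineGroup 2 (lattice c) two_pos (stable_two _)

/-- `a ∈ S_4`, `b ∈ (1, i)`. -/
def latticeFour : Subgroup Aff := affineGroup 4 (lattice Complex.I) four_pos stable_four

/-- `a ∈ S_3`, `b ∈ (1, τ₆)`. -/
def latticeThree : Subgroup Aff := affineGroup 3 (lattice tau6) three_pos stable_three

/-- `a ∈ S_6`, `b ∈ (1, τ₆)`. -/
def latticeSix : Subgroup Aff := affineGroup 6 (lattice tau6) (by norm_num) stable_six

/-- `c` and `c'` are related by an integral fractional linear transformation of determinant `±1`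
(the determinant `-1` occurs because `c` may lie in either half-plane). -/
def ModularEquiv (c c' : ℂ) : Prop :=
  ∃ p q r s : ℤ, (p * s - q * r = 1 ∨ p * s - q * r = -1) ∧ c' = (p * c + q) / (r * c + s)

/-! ### Coverings of the Riemann sphere with a given signature -/

/-- The Riemann sphere. -/
abbrev Sphere : Type := OnePoint ℂ

/-- The standard local coordinate of the sphere near `a`, vanishing at `a`: `x ↦ x - a` if `a` is
finite, `x ↦ 1 / x` if `a = ∞` (with an irrelevant value at the one point where it is infinite). -/
def coord : Sphere → Sphere → ℂ
  | none, none => 0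
  | none, some x => x⁻¹
  | some _, none => 0
  | some a, some x => x - a

/-- The point of the sphere whose local coordinate near `a` is `w ≠ 0`. -/
def coordInv : Sphere → ℂ → Sphere
  | none, w => ((w⁻¹ : ℂ) : OnePoint ℂ)
  | some a, w => ((a + w : ℂ) : OnePoint ℂ)

/-- Holomorphic maps from the complex line to the Riemann sphere. -/
def IsHolomorphic (π : ℂ → Sphere) : Prop :=
  ∀ z, ContinuousAt π z ∧ AnalyticAt ℂ (fun w => coord (π z) (π w)) z

/-- The multiplicity of a holomorphic map at a point. -/
def multiplicity (π : ℂ → Sphere) (z : ℂ) : ℕ∞ :=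
  analyticOrderAt (fun w => coord (π z) (π w)) z

/-- `π` is a branched covering over `X`: each `x ∈ X` has an open neighbourhood `U`, a disc centred
at `x`, such that on each connected component of the preimage of `U` the map `π` is equivalent to
the map `w ↦ w ^ m` of the unit disc to itself, for some `m ≥ 1`. -/
def IsBranchedCoveringOn (π : ℂ → Sphere) (X : Set Sphere) : Prop :=
  ∀ x ∈ X, ∃ (U : Set Sphere) (hx : x ∈ U), IsOpen U ∧ U ⊆ X ∧
    ∃ κ : U ≃ₜ Metric.ball (0 : ℂ) 1, (κ ⟨x, hx⟩ : ℂ) = 0 ∧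
      ∀ y, π y ∈ U → ∃ m : ℕ, 1 ≤ m ∧
        ∃ h : connectedComponentIn (π ⁻¹' U) y ≃ₜ Metric.ball (0 : ℂ) 1,
          ∀ (v : connectedComponentIn (π ⁻¹' U) y) (hv : π v ∈ U),
            (κ ⟨π v, hv⟩ : ℂ) = (h v : ℂ) ^ m

/-- The periodic path going around `a` along the circle of radius `ε` in the local coordinate,
once in each unit of time. -/
def loopAround (a : Sphere) (ε t : ℝ) : Sphere :=
  coordInv a (ε * Complex.exp (2 * Real.pi * t * Complex.I))

/-- The local monodromy operator of `π` at `a` has order `r`. The operator sends the starting point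
`γ 0` of a lift `γ` of a small loop around `a` to `γ 1`, so its `m`-th power sends `γ 0` to
`γ m`; it is the identity if and only if `r` divides `m`. -/
def LocalMonodromyOrder (π : ℂ → Sphere) (a : Sphere) (r : ℕ) : Prop :=
  ∀ᶠ ε : ℝ in 𝓝[>] 0, ∀ m : ℕ,
    (∀ γ : ℝ → ℂ, Continuous γ → (∀ t, π (γ t) = loopAround a ε t) → γ m = γ 0) ↔ r ∣ m

/-- A signature: a finite set `A` of branching points with finite orders `> 1`, and a finite set
`B` of exceptional points, disjoint from `A`. Only the values of `ord` on `A` matter. -/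
structure Signature where
  A : Finset Sphere
  B : Finset Sphere
  ord : Sphere → ℕ
  disj : Disjoint A B
  one_lt_ord : ∀ a ∈ A, 1 < ord a

/-- The set (with repetitions) of orders `{r₁, …, rₙ, ∞, …, ∞}` of a signature. -/
def Signature.orders (σ : Signature) : Multiset ℕ∞ :=
  σ.A.val.map (fun a => (σ.ord a : ℕ∞)) + Multiset.replicate σ.B.card ⊤

/-- Two signatures differ by an automorphism of the sphere, i.e. a Möbius transformation. -/
def Signature.Equivalent (σ σ' : Signature) : Prop :=
  ∃ T : GL (Fin 2) ℂ, (∀ x : Sphere, T • x ∈ σ'.A ↔ x ∈ σ.A) ∧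
    (∀ x : Sphere, T • x ∈ σ'.B ↔ x ∈ σ.B) ∧ ∀ a ∈ σ.A, σ'.ord (T • a) = σ.ord a

/-- `π : ℂ → S` is a covering with signature `σ = (A, B, R)`. -/
structure IsCoveringWithSignature (π : ℂ → Sphere) (σ : Signature) : Prop where
  holomorphic : IsHolomorphic π
  range_eq : Set.range π = {x | x ∉ σ.B}
  branched : IsBranchedCoveringOn π {x | x ∉ σ.B}
  unbranched : IsCoveringMapOn π {x | x ∉ σ.A ∧ x ∉ σ.B}
  monodromy : ∀ a ∈ σ.A, LocalMonodromyOrder π a (σ.ord a)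

/-- `π : ℂ → S` is the universal covering with signature `σ` (its total space `ℂ` is simply
connected, so the multiplicities are what has to be required). -/
def IsUniversalCovering (π : ℂ → Sphere) (σ : Signature) : Prop :=
  IsCoveringWithSignature π σ ∧ ∀ z, π z ∈ σ.A → multiplicity π z = (σ.ord (π z) : ℕ∞)

/-- The map `π` realizes the quotient of `ℂ` by `G`, as a covering with signature `σ`: its fibres
are the orbits of `G`. -/
def IsQuotientCovering (G : Subgroup Aff) (π : ℂ → Sphere) (σ : Signature) : Prop :=
  IsCoveringWithSignature π σ ∧ ∀ z w : ℂ, π z = π w ↔ ∃ g ∈ G, g z = w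

/-- `σ` is a signature of a covering given by the action of `G`. -/
def IsSignatureOf (G : Subgroup Aff) (σ : Signature) : Prop :=
  ∃ π : ℂ → Sphere, IsQuotientCovering G π σ

/-- The covering `ℂ → ℂ / G` is the universal covering with a (hence parabolic) signature, and this
signature is defined, up to an automorphism of the sphere, by its set of orders `R`. -/
def HasOrders (G : Subgroup Aff) (R : Multiset ℕ∞) : Prop :=
  (∀ σ, IsSignatureOf G σ ↔ σ.orders = R) ∧
  (∃ σ, IsSignatureOf G σ) ∧
  (∀ σ σ', IsSignatureOf G σ → IsSignatureOf G σ' → σ.Equivalent σ') ∧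
  ∀ π σ, IsQuotientCovering G π σ → IsUniversalCovering π σ

open Classical in
/-- The signature with `A = {0, 1, ∞, l}`, `B = ∅`, and all orders equal to `2`. -/
def fourPointSignature (l : ℂ) : Signature where
  A := {((0 : ℂ) : OnePoint ℂ), ((1 : ℂ) : OnePoint ℂ), OnePoint.infty, (l : OnePoint ℂ)}
  B := ∅
  ord := fun _ => 2
  disj := Finset.disjoint_empty_right _
  one_lt_ord := fun _ _ => one_lt_two

/-- The six values that a cross-ratio takes under permutations of four points. -/
def CrossRatioEquiv (l l' : ℂ) : Prop :=
  l' = l ∨ l' = 1 - l ∨ l' = l⁻¹ ∨ l' = (1 - l)⁻¹ ∨ l' = l * (l - 1)⁻¹ ∨ l' = l⁻¹ * (l - 1)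

/-- The covering `ℂ → ℂ / G` is the universal covering with a signature `A = {0, 1, ∞, l}`,
`R = (2, 2, 2, 2)`, defined up to an automorphism of the sphere; here `l` is defined up to the
six cross-ratio transformations. -/
def HasFourPointSignature (G : Subgroup Aff) : Prop :=
  (∃ l : ℂ, l ≠ 0 ∧ l ≠ 1 ∧
    (∀ σ, IsSignatureOf G σ ↔ (fourPointSignature l).Equivalent σ) ∧
    ∀ l' : ℂ, l' ≠ 0 → l' ≠ 1 →
      (IsSignatureOf G (fourPointSignature l') ↔ CrossRatioEquiv l l')) ∧
  ∀ π σ, IsQuotientCovering G π σ → IsUniversalCovering π σ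

/-- The orbit equivalence relation of `G`. -/
def orbitSetoid (G : Subgroup Aff) : Setoid ℂ where
  r z w := ∃ g ∈ G, g z = w
  iseqv :=
    { refl := fun z => ⟨1, G.one_mem, rfl⟩
      symm := by
        rintro z w ⟨g, hg, rfl⟩
        exact ⟨g⁻¹, G.inv_mem hg, by rw [AffineEquiv.inv_def, AffineEquiv.symm_apply_apply]⟩
      trans := by
        rintro x y z ⟨g, hg, rfl⟩ ⟨h, hh, rfl⟩
        exact ⟨h * g, G.mul_mem hh hg, rfl⟩ }

/-- The quotient `ℂ / G`, with the quotient topology. -/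
abbrev OrbitSpace (G : Subgroup Aff) : Type := Quotient (orbitSetoid G)

/-- `ℂ / G` is a curve of genus one: a Riemann surface, with the complex structure for which
`ℂ → ℂ / G` is a holomorphic covering, homeomorphic to the torus. -/
def QuotientIsGenusOneCurve (G : Subgroup Aff) : Prop :=
  (∃ _cs : ChartedSpace ℂ (OrbitSpace G), IsManifold 𝓘(ℂ) ω (OrbitSpace G) ∧
    ContMDiff 𝓘(ℂ) 𝓘(ℂ) ω (Quotient.mk (orbitSetoid G))) ∧
  IsCoveringMap (Quotient.mk (orbitSetoid G)) ∧
  Nonempty (OrbitSpace G ≃ₜ Circle × Circle)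

/-! ### The list -/

/-- The eight types of groups, with their parameters. -/
inductive GroupType where
  | type1 (k : ℕ) (hk : 0 < k)
  | type2
  | type3
  | type4 (c : ℂ) (hc : c.im ≠ 0)
  | type5 (c : ℂ) (hc : c.im ≠ 0)
  | type6
  | type7
  | type8

/-- The group of the list with the given type. -/
def GroupType.group : GroupType → Subgroup Aff
  | .type1 k hk => rotations k hk
  | .type2 => integerTranslations
  | .type3 => integerDihedral
  | .type4 c _ => latticeTranslations c
  | .type5 c _ => latticeTwo c
  | .type6 => latticeFour
  | .type7 => latticeThree
  | .type8 => latticeSix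

/-- What the list says about the quotient of `ℂ` by a group `G` of the given type. For the trivial
group (type 1 with `k = 1`) there is no branching point, and the entry `1` is dropped. -/
def GroupType.QuotientData (G : Subgroup Aff) : GroupType → Prop
  | .type1 k _ => HasOrders G (if k = 1 then {⊤} else {(k : ℕ∞), ⊤})
  | .type2 => HasOrders G {⊤, ⊤}
  | .type3 => HasOrders G {2, 2, ⊤}
  | .type4 _ _ => QuotientIsGenusOneCurve G
  | .type5 _ _ => HasFourPointSignature G
  | .type6 => HasOrders G {4, 4, 2}
  | .type7 => HasOrders G {3, 3, 3}
  | .type8 => HasOrders G {6, 3, 2}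

end AffineDiscrete

end

/-!
The proof has two halves, one about groups and one about quotient maps.

*Groups.* In a discrete group the rotational parts are roots of unity, because an element with a
fixed point has finite order. The translations form a discrete additive group `Λ`, stable under the
rotational parts; these form a finite group, because they act on the translations of least length
(or fix a point, if `Λ` is zero), so they are all the `k`-th roots of unity for some `k`
(`IsDiscreteGroup.exists_slopes_eq`). With the fixed point of a generating rotation as origin, the
group consists of all `z ↦ a z + b` with `a ^ k = 1` and `b ∈ Λ` (`exists_origin`). If `Λ` is not
zero, let `1` be its shortest vector; a rotation of order `5` or at least `7` would give a shorter
one (`IsNormalized.order_mem`), and reduction modulo `1` and a suitable second vector determines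
`Λ`. Two groups with the same rotations are conjugate if and only if their groups of translations
are similar (`affConj_affineGroup_iff`), which for lattices is a matter of changing a basis.

*Quotient maps.* Call a holomorphic map `π` from the line to the sphere a uniformizer of `G` if its
fibres are the orbits of `G`. Near each point it is, in suitable coordinates, the power `w ↦ w ^ m`
with `m` the order of the stabilizer (`exists_adaptedChart`, `IsUniformizer.multiplicity_eq`).
Hence `π` is a branched covering over its image whose local monodromy at `π y` has the order of the
stabilizer of `y`, so that its signature is read off from `G`
(`IsUniformizer.isCoveringWithSignature_iff`), and it is automatically universal. Two uniformizers
of `G` differ by a Möbius transformation: if both send a point with trivial stabilizer to `∞`, the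
map of the sphere which takes one to the other is `x ↦ α x + O(1)` near `∞`, and `O(1)` is bounded
and holomorphic outside a finite set, hence constant (`IsUniformizer.exists_smul_eq`). So all
signatures of `G` are equivalent, and signatures with at most three points are classified by their
orders, those with four points by the cross-ratio.

It remains to exhibit one uniformizer for each group of the list. These are `z ^ k`, the
exponential function, the cosine, and the elliptic functions `℘`, `℘ ^ 2`, `℘'` and `℘ ^ 3`. For
the elliptic functions the fibre over `∞` is a single orbit with the right multiplicity; by
compactness of the quotient and connectedness of the sphere this property spreads to all fibres
(`isUniformizer_of_single_orbit`). For a lattice of translations the projection is a covering,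
local sections are the charts of the quotient, and the two real coordinates identify it with the
torus.
-/

namespace AffineDiscrete

/-! ### Affine transformations of the line -/

/-- The coefficient `a` of the affine transformation `z ↦ a z + b`. -/
noncomputable def slope (g : Aff) : ℂ := g 1 - g 0

theorem apply_eq (g : Aff) (z : ℂ) : g z = slope g * z + g 0 := by
  have h (w : ℂ) : g w = g.linear w + g 0 := by
    have := g.map_vadd 0 w
    simpa using this
  have h1 : g.linear z = z * g.linear 1 := by
    have := g.linear.map_smul z 1
    simpa using this
  have h2 := h 1
  rw [h z, h1, slope, h2]
  ring

theorem aff_ext {g h : Aff} (hs : slope g = slope h) (h0 : g 0 = h 0) : g = h := by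
  ext z
  rw [apply_eq g, apply_eq h, hs, h0]

theorem slope_eq_of_apply {g : Aff} {a b : ℂ} (h : ∀ z, g z = a * z + b) : slope g = a := by
  rw [slope, h, h]; ring

theorem apply_sub (g : Aff) (z w : ℂ) : g z - g w = slope g * (z - w) := by
  rw [apply_eq g z, apply_eq g w]; ring

theorem slope_ne_zero (g : Aff) : slope g ≠ 0 := by
  intro h
  have := g.injective (show g 1 = g 0 from sub_eq_zero.1 h)
  exact one_ne_zero this

theorem mul_apply (g h : Aff) (z : ℂ) : (g * h) z = g (h z) := rfl

theorem one_apply (z : ℂ) : (1 : Aff) z = z := rfl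

theorem inv_apply_apply (g : Aff) (z : ℂ) : g⁻¹ (g z) = z := by
  rw [← mul_apply, inv_mul_cancel, one_apply]

theorem apply_inv_apply (g : Aff) (z : ℂ) : g (g⁻¹ z) = z := by
  rw [← mul_apply, mul_inv_cancel, one_apply]

theorem slope_mul (g h : Aff) : slope (g * h) = slope g * slope h := by
  rw [slope, mul_apply, mul_apply, apply_sub]; rfl

theorem slope_one : slope 1 = 1 := by simp [slope, one_apply]

theorem slope_inv (g : Aff) : slope g⁻¹ = (slope g)⁻¹ := by
  have := slope_mul g⁻¹ g
  rw [inv_mul_cancel, slope_one] at this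
  exact eq_inv_of_mul_eq_one_left this.symm

theorem slope_pow (g : Aff) (n : ℕ) : slope (g ^ n) = slope g ^ n := by
  induction n with
  | zero => simp [slope_one]
  | succ n ih => rw [pow_succ, slope_mul, ih, pow_succ]

theorem continuous_aff (g : Aff) : Continuous g := by
  have : (g : ℂ → ℂ) = fun z => slope g * z + g 0 := funext (apply_eq g)
  rw [this]; fun_prop

/-- The affine transformation `z ↦ a z + b`. -/
noncomputable def mkAff (a b : ℂ) (ha : a ≠ 0) : Aff :=
  AffineEquiv.mk' (fun z => a * z + b) (LinearEquiv.smulOfNeZero ℂ ℂ a ha) 0 (fun z => by simp)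

@[simp] theorem mkAff_apply (a b : ℂ) (ha : a ≠ 0) (z : ℂ) : mkAff a b ha z = a * z + b := rfl

theorem eq_one_of_fixes_two {g : Aff} {y z : ℂ} (hyz : z ≠ y) (hy : g y = y) (hz : g z = z) :
    g = 1 := by
  have h1 := apply_sub g z y
  rw [hy, hz] at h1
  have hs : slope g = 1 := by
    have : (slope g - 1) * (z - y) = 0 := by linear_combination -h1
    rcases mul_eq_zero.1 this with h | h
    · exact sub_eq_zero.1 h
    · exact absurd (sub_eq_zero.1 h) hyz
  refine aff_ext (by rw [hs, slope_one]) ?_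
  have := apply_eq g y
  rw [hs, hy] at this
  rw [one_apply]
  linear_combination -this

/-! ### Discrete groups -/

/-- The set of elements of `G` fixing `y`. -/
def stab (G : Subgroup Aff) (y : ℂ) : Set Aff := {g | g ∈ G ∧ g y = y}

variable {G : Subgroup Aff}

theorem IsDiscreteGroup.finite_stab (hG : IsDiscreteGroup G) (y : ℂ) : (stab G y).Finite := by
  refine (hG {y} {y} isCompact_singleton isCompact_singleton).subset ?_
  rintro g ⟨hg, hy⟩
  exact ⟨hg, y, ⟨y, rfl, hy⟩, rfl⟩

theorem IsDiscreteGroup.exists_slope_pow (hG : IsDiscreteGroup G) {g : Aff} (hg : g ∈ G) :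
    ∃ n : ℕ, 0 < n ∧ slope g ^ n = 1 := by
  by_cases h1 : slope g = 1
  · exact ⟨1, one_pos, by simp [h1]⟩
  · have hne : 1 - slope g ≠ 0 := sub_ne_zero.2 (Ne.symm h1)
    set p := g 0 / (1 - slope g) with hp
    have hfix : g p = p := by
      rw [apply_eq g p, hp]; field_simp; ring
    have hpow : ∀ n : ℕ, (g ^ n) p = p := by
      intro n
      induction n with
      | zero => rfl
      | succ n ih => rw [pow_succ, mul_apply, hfix, ih]
    have hfin : ((Submonoid.powers g : Submonoid Aff) : Set Aff).Finite := by
      refine (hG.finite_stab p).subset ?_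
      rintro _ ⟨n, rfl⟩
      exact ⟨G.pow_mem hg n, hpow n⟩
    obtain ⟨n, hn, h⟩ := isOfFinOrder_iff_pow_eq_one.1 (finite_powers.1 hfin)
    exact ⟨n, hn, by rw [← slope_pow, h, slope_one]⟩

theorem IsDiscreteGroup.norm_slope (hG : IsDiscreteGroup G) {g : Aff} (hg : g ∈ G) :
    ‖slope g‖ = 1 := by
  obtain ⟨n, hn, h⟩ := hG.exists_slope_pow hg
  have : ‖slope g‖ ^ n = 1 := by rw [← norm_pow, h, norm_one]
  exact (pow_eq_one_iff_of_nonneg (norm_nonneg _) hn.ne').1 this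

theorem IsDiscreteGroup.dist_apply (hG : IsDiscreteGroup G) {g : Aff} (hg : g ∈ G) (z w : ℂ) :
    dist (g z) (g w) = dist z w := by
  rw [dist_eq_norm, apply_sub, norm_mul, hG.norm_slope hg, one_mul, dist_eq_norm]

/-- Small discs around `y` and `y'` meet under `g ∈ G` only if `g` maps `y` to `y'`. -/
theorem IsDiscreteGroup.exists_radius (hG : IsDiscreteGroup G) (y y' : ℂ) :
    ∃ r > 0, ∀ g ∈ G, ∀ z ∈ Metric.ball y r, g z ∈ Metric.ball y' r → g y = y' := by
  set F := {g : Aff | g ∈ G ∧ ((fun z => g z) '' Metric.closedBall y 1 ∩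
    Metric.closedBall y' 1).Nonempty}
  have hF : F.Finite := hG _ _ (isCompact_closedBall _ _) (isCompact_closedBall _ _)
  have h1 : ∀ᶠ r in 𝓝[>] (0 : ℝ), ∀ g ∈ F, g y ≠ y' → 2 * r < dist (g y) y' := by
    rw [Filter.eventually_all_finite hF]
    intro g _
    by_cases h : g y = y'
    · exact Filter.Eventually.of_forall fun r h' => absurd h h'
    · have hd : 0 < dist (g y) y' / 2 := by have := dist_pos.2 h; linarith
      filter_upwards [Ioo_mem_nhdsGT hd] with r hr _
      linarith [hr.2]
  obtain ⟨r, h, hr⟩ := (h1.and (Ioo_mem_nhdsGT (zero_lt_one' ℝ))).exists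
  refine ⟨r, hr.1, fun g hg z hz hgz => ?_⟩
  by_contra hne
  have hgF : g ∈ F := ⟨hg, g z, ⟨z, Metric.mem_closedBall.2 (by
    have := Metric.mem_ball.1 hz; linarith [hr.2]), rfl⟩, Metric.mem_closedBall.2 (by
    have := Metric.mem_ball.1 hgz; linarith [hr.2])⟩
  have h2 := h g hgF hne
  have h3 := dist_triangle (g y) (g z) y'
  rw [hG.dist_apply hg, dist_comm y z] at h3
  have := Metric.mem_ball.1 hz
  have := Metric.mem_ball.1 hgz
  linarith

/-- Membership in the group obtained by the change of coordinate `φ`. -/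
theorem mem_of_conj {G H : Subgroup Aff} {φ : Aff}
    (h : H = G.map (MulAut.conj φ).toMonoidHom) (g : Aff) : g ∈ G ↔ φ * g * φ⁻¹ ∈ H := by
  subst h
  simp only [Subgroup.mem_map]
  constructor
  · exact fun hg => ⟨g, hg, rfl⟩
  · rintro ⟨g', hg', he⟩
    have : φ * g' * φ⁻¹ = φ * g * φ⁻¹ := he
    rw [mul_left_inj, mul_right_inj] at this
    exact this ▸ hg'

theorem IsDiscreteGroup.of_affConj {G H : Subgroup Aff} (h : AffConj G H)
    (hH : IsDiscreteGroup H) : IsDiscreteGroup G := by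
  obtain ⟨φ, hφ⟩ := h
  intro K L hK hL
  have hfin := hH (φ '' K) (φ '' L) (hK.image (continuous_aff φ)) (hL.image (continuous_aff φ))
  refine (hfin.preimage (f := fun g => φ * g * φ⁻¹) ?_).subset ?_
  · intro g _ g' _ h
    simpa using h
  · rintro g ⟨hg, _, ⟨z, hz, rfl⟩, hL⟩
    refine ⟨(mem_of_conj hφ g).1 hg, φ (g z), ⟨φ z, ⟨z, hz, rfl⟩, ?_⟩, ⟨g z, hL, rfl⟩⟩
    simp [inv_apply_apply]

theorem mem_affineGroup {k : ℕ} {Λ : AddSubgroup ℂ} {hk : 0 < k}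
    {hΛ : ∀ a b : ℂ, a ^ k = 1 → b ∈ Λ → a * b ∈ Λ} {g : Aff} :
    g ∈ affineGroup k Λ hk hΛ ↔ slope g ^ k = 1 ∧ g 0 ∈ Λ := by
  constructor
  · rintro ⟨a, b, ha, hb, hg⟩
    rw [slope_eq_of_apply hg, hg]
    exact ⟨ha, by simpa using hb⟩
  · rintro ⟨ha, hb⟩
    exact ⟨_, _, ha, hb, apply_eq g⟩

theorem mkAff_mem_affineGroup {k : ℕ} {Λ : AddSubgroup ℂ} {hk : 0 < k}
    {hΛ : ∀ a b : ℂ, a ^ k = 1 → b ∈ Λ → a * b ∈ Λ} {a b : ℂ} (ha0 : a ≠ 0) (ha : a ^ k = 1)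
    (hb : b ∈ Λ) : mkAff a b ha0 ∈ affineGroup k Λ hk hΛ :=
  ⟨a, b, ha, hb, fun _ => rfl⟩

theorem ne_zero_of_pow_eq_one {a : ℂ} {k : ℕ} (hk : 0 < k) (ha : a ^ k = 1) : a ≠ 0 := by
  rintro rfl
  rw [zero_pow hk.ne'] at ha
  exact zero_ne_one ha

/-- Orbits of the groups of the list. -/
theorem exists_mem_affineGroup {k : ℕ} {Λ : AddSubgroup ℂ} {hk : 0 < k}
    {hΛ : ∀ a b : ℂ, a ^ k = 1 → b ∈ Λ → a * b ∈ Λ} {z w : ℂ} :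
    (∃ g ∈ affineGroup k Λ hk hΛ, g z = w) ↔ ∃ a : ℂ, a ^ k = 1 ∧ w - a * z ∈ Λ := by
  constructor
  · rintro ⟨g, ⟨a, b, ha, hb, hg⟩, rfl⟩
    exact ⟨a, ha, by rw [hg]; simpa using hb⟩
  · rintro ⟨a, ha, hb⟩
    exact ⟨mkAff a (w - a * z) (ne_zero_of_pow_eq_one hk ha), mkAff_mem_affineGroup _ ha hb,
      by simp⟩

theorem finite_roots {k : ℕ} (hk : 0 < k) : {a : ℂ | a ^ k = 1}.Finite := by
  refine (Polynomial.nthRoots k (1 : ℂ)).toFinset.finite_toSet.subset fun a ha => ?_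
  simpa [Polynomial.mem_nthRoots hk] using ha

theorem isDiscreteGroup_affineGroup {k : ℕ} {Λ : AddSubgroup ℂ} {hk : 0 < k}
    {hΛ : ∀ a b : ℂ, a ^ k = 1 → b ∈ Λ → a * b ∈ Λ}
    (hfin : ∀ r : ℝ, {b | b ∈ Λ ∧ ‖b‖ ≤ r}.Finite) : IsDiscreteGroup (affineGroup k Λ hk hΛ) := by
  intro K L hK hL
  obtain ⟨r, hr⟩ := hK.isBounded.exists_norm_le
  obtain ⟨s, hs⟩ := hL.isBounded.exists_norm_le
  have hf := ((finite_roots hk).prod (hfin (s + r)))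
  refine (hf.preimage (f := fun g : Aff => (slope g, g 0)) ?_).subset ?_
  · intro g _ g' _ h
    simp only [Prod.mk.injEq] at h
    exact aff_ext h.1 h.2
  · rintro g ⟨hg, _, ⟨z, hz, rfl⟩, hgz⟩
    rw [mem_affineGroup] at hg
    refine ⟨hg.1, hg.2, ?_⟩
    have h1 : ‖slope g‖ = 1 := by
      have : ‖slope g‖ ^ k = 1 := by rw [← norm_pow, hg.1, norm_one]
      exact (pow_eq_one_iff_of_nonneg (norm_nonneg _) hk.ne').1 this
    have h2 : g 0 = g z - slope g * z := by rw [apply_eq g z]; ring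
    calc ‖g 0‖ ≤ ‖g z‖ + ‖slope g * z‖ := by rw [h2]; exact norm_sub_le _ _
      _ ≤ s + r := by rw [norm_mul, h1, one_mul]; exact add_le_add (hs _ hgz) (hr _ hz)

end AffineDiscrete

namespace AffineDiscrete

/-! ### Local coordinates of the sphere -/

/-- The point at which the local coordinate at `a` is infinite. -/
def pole : Sphere → Sphere
  | none => ((0 : ℂ) : OnePoint ℂ)
  | some _ => OnePoint.infty

/-- The point with local coordinate `w` near `a`. -/
noncomputable def param (a : Sphere) (w : ℂ) : Sphere := if w = 0 then a else coordInv a w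

@[simp] theorem coord_infty_coe (x : ℂ) : coord OnePoint.infty (x : OnePoint ℂ) = x⁻¹ := rfl
@[simp] theorem coord_infty_infty : coord OnePoint.infty OnePoint.infty = 0 := rfl
@[simp] theorem coord_coe_coe (a x : ℂ) : coord (a : OnePoint ℂ) (x : OnePoint ℂ) = x - a := rfl
@[simp] theorem pole_infty : pole OnePoint.infty = ((0 : ℂ) : OnePoint ℂ) := rfl
@[simp] theorem pole_coe (a : ℂ) : pole (a : OnePoint ℂ) = OnePoint.infty := rfl
@[simp] theorem coordInv_infty (w : ℂ) :
    coordInv OnePoint.infty w = ((w⁻¹ : ℂ) : OnePoint ℂ) := rfl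
@[simp] theorem coordInv_coe (a w : ℂ) :
    coordInv (a : OnePoint ℂ) w = ((a + w : ℂ) : OnePoint ℂ) := rfl

@[simp] theorem coord_self (a : Sphere) : coord a a = 0 := by
  induction a using OnePoint.rec <;> simp

theorem ne_pole (a : Sphere) : a ≠ pole a := by
  induction a using OnePoint.rec <;> simp

@[simp] theorem param_zero (a : Sphere) : param a 0 = a := if_pos rfl

theorem param_of_ne {w : ℂ} (a : Sphere) (hw : w ≠ 0) : param a w = coordInv a w := if_neg hw

theorem param_coe (a w : ℂ) : param (a : OnePoint ℂ) w = ((a + w : ℂ) : OnePoint ℂ) := by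
  by_cases h : w = 0
  · simp [h]
  · simp [param_of_ne _ h]

theorem param_ne_pole (a : Sphere) (w : ℂ) : param a w ≠ pole a := by
  induction a using OnePoint.rec with
  | infty =>
    by_cases h : w = 0
    · simp [h]
    · rw [param_of_ne _ h, coordInv_infty, pole_infty]
      simpa [OnePoint.coe_eq_coe] using h
  | coe a => simp [param_coe]

theorem coord_param (a : Sphere) (w : ℂ) : coord a (param a w) = w := by
  induction a using OnePoint.rec with
  | infty =>
    by_cases h : w = 0
    · simp [h]
    · simp [param_of_ne _ h]
  | coe a => simp [param_coe]

theorem param_coord (a x : Sphere) (h : x ≠ pole a) : param a (coord a x) = x := by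
  induction a using OnePoint.rec with
  | infty =>
    induction x using OnePoint.rec with
    | infty => simp
    | coe x =>
      have hx : x ≠ 0 := by rintro rfl; exact h rfl
      rw [coord_infty_coe, param_of_ne _ (inv_ne_zero hx), coordInv_infty, inv_inv]
  | coe a =>
    induction x using OnePoint.rec with
    | infty => exact absurd rfl h
    | coe x => simp [param_coe]

theorem coord_injOn (a : Sphere) : Set.InjOn (coord a) {x | x ≠ pole a} := by
  intro x hx y hy h
  rw [← param_coord a x hx, h, param_coord a y hy]

theorem coord_eq_zero {a x : Sphere} (h : x ≠ pole a) : coord a x = 0 ↔ x = a :=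
  ⟨fun h0 => coord_injOn a h (ne_pole a) (by rw [h0, coord_self]), by rintro rfl; simp⟩

theorem continuousAt_coord (a : Sphere) {x : Sphere} (h : x ≠ pole a) :
    ContinuousAt (coord a) x := by
  induction a using OnePoint.rec with
  | infty =>
    induction x using OnePoint.rec with
    | infty =>
      rw [OnePoint.continuousAt_infty']
      simp only [Filter.coclosedCompact_eq_cocompact, ← Metric.cobounded_eq_cocompact]
      exact Filter.tendsto_inv₀_cobounded
    | coe x =>
      rw [OnePoint.continuousAt_coe]
      have hx : x ≠ 0 := by rintro rfl; exact h rfl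
      exact continuousAt_inv₀ hx
  | coe a =>
    induction x using OnePoint.rec with
    | infty => exact absurd rfl h
    | coe x =>
      rw [OnePoint.continuousAt_coe]
      exact (continuous_id.sub continuous_const).continuousAt

theorem continuous_param (a : Sphere) : Continuous (param a) := by
  induction a using OnePoint.rec with
  | infty =>
    rw [continuous_iff_continuousAt]
    intro w
    by_cases h : w = 0
    · subst h
      rw [continuousAt_iff_punctured_nhds, param_zero]
      have h1 : Filter.Tendsto (fun w : ℂ => ((w⁻¹ : ℂ) : OnePoint ℂ)) (𝓝[≠] 0)
          (𝓝 OnePoint.infty) := by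
        refine OnePoint.tendsto_coe_infty.comp ?_
        rw [Filter.coclosedCompact_eq_cocompact, ← Metric.cobounded_eq_cocompact]
        exact Filter.tendsto_inv₀_nhdsNE_zero
      refine h1.congr' ?_
      filter_upwards [self_mem_nhdsWithin] with w hw
      rw [param_of_ne _ hw, coordInv_infty]
    · have h1 : ContinuousAt (fun w : ℂ => ((w⁻¹ : ℂ) : OnePoint ℂ)) w :=
        OnePoint.continuous_coe.continuousAt.comp (continuousAt_inv₀ h)
      refine h1.congr ?_
      filter_upwards [isOpen_ne.mem_nhds h] with w hw
      rw [param_of_ne _ hw, coordInv_infty]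
  | coe a =>
    have : param (a : OnePoint ℂ) = fun w => ((a + w : ℂ) : OnePoint ℂ) := funext (param_coe a)
    rw [this]
    exact OnePoint.continuous_coe.comp (by fun_prop)

/-- The disc of radius `ρ` around `a` in the local coordinate. -/
def disc (a : Sphere) (ρ : ℝ) : Set Sphere := {x | x ≠ pole a ∧ ‖coord a x‖ < ρ}

theorem isOpen_disc (a : Sphere) (ρ : ℝ) : IsOpen (disc a ρ) := by
  have h : ContinuousOn (coord a) {x | x ≠ pole a} := fun x hx =>
    (continuousAt_coord a hx).continuousWithinAt
  have := h.isOpen_inter_preimage (isOpen_ne) (Metric.isOpen_ball (x := (0 : ℂ)) (ε := ρ))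
  convert this using 1
  ext x
  simp [disc]

theorem mem_disc_self (a : Sphere) {ρ : ℝ} (h : 0 < ρ) : a ∈ disc a ρ :=
  ⟨ne_pole a, by simpa⟩

theorem param_mem_disc (a : Sphere) {w : ℂ} {ρ : ℝ} (h : ‖w‖ < ρ) : param a w ∈ disc a ρ :=
  ⟨param_ne_pole a w, by rwa [coord_param]⟩

theorem eventually_disc (a : Sphere) {s : Set Sphere} (hs : s ∈ 𝓝 a) :
    ∃ ρ > 0, disc a ρ ⊆ s := by
  have h1 : param a ⁻¹' s ∈ 𝓝 0 := by
    refine (continuous_param a).continuousAt.preimage_mem_nhds ?_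
    rwa [param_zero]
  obtain ⟨ρ, hρ, h⟩ := Metric.mem_nhds_iff.1 h1
  refine ⟨ρ, hρ, fun x hx => ?_⟩
  have : coord a x ∈ Metric.ball (0 : ℂ) ρ := by simpa using hx.2
  simpa [param_coord a x hx.1] using h this

/-! ### Local normal form of a holomorphic map -/

/-- An analytic function with a zero of order `m` is the `m`-th power of a local coordinate. -/
theorem exists_eq_pow {F : ℂ → ℂ} {y : ℂ} {m : ℕ} (hm : m ≠ 0) (hF : AnalyticAt ℂ F y)
    (hord : analyticOrderAt F y = m) :
    ∃ ψ : ℂ → ℂ, AnalyticAt ℂ ψ y ∧ ψ y = 0 ∧ deriv ψ y ≠ 0 ∧ ∀ᶠ z in 𝓝 y, F z = ψ z ^ m := by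
  obtain ⟨u, hu, hu0, hFu⟩ := hF.analyticOrderAt_eq_natCast.1 hord
  obtain ⟨c, hc⟩ := IsAlgClosed.exists_pow_nat_eq (u y) (Nat.pos_of_ne_zero hm)
  have hc0 : c ≠ 0 := by rintro rfl; rw [zero_pow hm] at hc; exact hu0 hc.symm
  set v : ℂ → ℂ := fun z => c * (u z / u y) ^ ((m : ℂ)⁻¹) with hv
  have hva : AnalyticAt ℂ v y := by
    refine analyticAt_const.mul (AnalyticAt.cpow (hu.div analyticAt_const hu0) analyticAt_const ?_)
    rw [div_self hu0]; exact Complex.one_mem_slitPlane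
  have hvy : v y = c := by simp [hv, div_self hu0]
  refine ⟨fun z => (z - y) * v z, by fun_prop, by simp, ?_, ?_⟩
  · have h1 : HasDerivAt (fun z => (z - y) * v z) (1 * v y + (y - y) * deriv v y) y :=
      ((hasDerivAt_id y).sub_const y).mul hva.differentiableAt.hasDerivAt
    rw [h1.deriv, hvy]
    simpa using hc0
  · filter_upwards [hFu] with z hz
    rw [hz, smul_eq_mul, mul_pow, hv]
    simp only
    rw [mul_pow, ← Complex.cpow_nat_mul, mul_inv_cancel₀ (by exact_mod_cast hm), Complex.cpow_one,
      hc]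
    field_simp

theorem multiplicity_ne_zero {π : ℂ → Sphere} (hπ : IsHolomorphic π) (y : ℂ) :
    multiplicity π y ≠ 0 := by
  rw [multiplicity, (hπ y).2.analyticOrderAt_ne_zero]
  simp

theorem IsHolomorphic.continuous {π : ℂ → Sphere} (hπ : IsHolomorphic π) : Continuous π :=
  continuous_iff_continuousAt.2 fun z => (hπ z).1

/-- Near a point of multiplicity `m` a holomorphic map is, in suitable coordinates, `w ↦ w ^ m`. -/
theorem exists_local_chart {π : ℂ → Sphere} (hπ : IsHolomorphic π) {y : ℂ} {m : ℕ}
    (hm : multiplicity π y = m) :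
    ∃ e : OpenPartialHomeomorph ℂ ℂ, y ∈ e.source ∧ e y = 0 ∧
      (∀ z ∈ e.source, π z ≠ pole (π y) ∧ coord (π y) (π z) = e z ^ m) := by
  have hm0 : m ≠ 0 := by
    rintro rfl
    exact multiplicity_ne_zero hπ y (by simpa using hm)
  obtain ⟨ψ, hψ, hψ0, hψd, hev⟩ := exists_eq_pow hm0 (hπ y).2 hm
  have hpole : ∀ᶠ z in 𝓝 y, π z ≠ pole (π y) :=
    (hπ y).1.eventually (isOpen_ne.mem_nhds (ne_pole (π y)))
  obtain ⟨s, hs, hso, hys⟩ := eventually_nhds_iff.1 (hev.and hpole)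
  have hd := hψ.hasStrictDerivAt.hasStrictFDerivAt_equiv hψd
  refine ⟨(hd.toOpenPartialHomeomorph ψ).restrOpen s hso, ?_, ?_, ?_⟩
  · rw [OpenPartialHomeomorph.restrOpen_source]
    exact ⟨hd.mem_toOpenPartialHomeomorph_source, hys⟩
  · exact hψ0
  · intro z hz
    rw [OpenPartialHomeomorph.restrOpen_source] at hz
    exact ⟨(hs z hz.2).2, (hs z hz.2).1⟩

/-- A local coordinate `e` at `y`, with values in the disc of radius `ρ`, in which `π` is
`w ↦ w ^ m`, and whose domain is mapped by each element of `G` to itself (if the element fixes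
`y`) or to a disjoint set. -/
structure IsAdaptedChart (G : Subgroup Aff) (π : ℂ → Sphere) (y : ℂ) (m : ℕ)
    (e : OpenPartialHomeomorph ℂ ℂ) (ρ : ℝ) : Prop where
  pos : 0 < ρ
  mem : y ∈ e.source
  apply_eq_zero : e y = 0
  target : e.target = Metric.ball 0 ρ
  ne_pole : ∀ z ∈ e.source, π z ≠ pole (π y)
  coord_eq : ∀ z ∈ e.source, coord (π y) (π z) = e z ^ m
  fixes : ∀ g ∈ G, ∀ z ∈ e.source, g z ∈ e.source → g y = y
  stable : ∀ g ∈ G, g y = y → ∀ z ∈ e.source, g z ∈ e.source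

theorem exists_adaptedChart {G : Subgroup Aff} (hG : IsDiscreteGroup G) {π : ℂ → Sphere}
    (hπ : IsHolomorphic π) (hinv : ∀ g ∈ G, ∀ z, π (g z) = π z) {y : ℂ} {m : ℕ}
    (hm : multiplicity π y = m) {s : Set ℂ} (hs : s ∈ 𝓝 y) :
    ∃ (e : OpenPartialHomeomorph ℂ ℂ) (ρ : ℝ), IsAdaptedChart G π y m e ρ ∧ e.source ⊆ s := by
  have hm0 : m ≠ 0 := by
    rintro rfl
    exact multiplicity_ne_zero hπ y (by simpa using hm)
  obtain ⟨e, hy, hey, he⟩ := exists_local_chart hπ hm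
  obtain ⟨r₁, hr₁, h₁⟩ := hG.exists_radius y y
  obtain ⟨r₂, hr₂, h₂⟩ := Metric.mem_nhds_iff.1 (Filter.inter_mem hs (e.open_source.mem_nhds hy))
  set r := min r₁ r₂
  have hr : 0 < r := lt_min hr₁ hr₂
  set e₁ := e.restrOpen (Metric.ball y r) Metric.isOpen_ball with he₁
  have hs₁ : e₁.source = e.source ∩ Metric.ball y r := rfl
  have hy₁ : y ∈ e₁.source := ⟨hy, Metric.mem_ball_self hr⟩
  obtain ⟨ρ, hρ, hρt⟩ := Metric.mem_nhds_iff.1 (e₁.open_target.mem_nhds (e₁.map_source hy₁))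
  have h0 : e₁ y = 0 := hey
  rw [h0] at hρt
  set e₂ := (e₁.symm.restrOpen (Metric.ball 0 ρ) Metric.isOpen_ball).symm with he₂
  have hcoe : ∀ z, e₂ z = e z := fun z => rfl
  have ht₂ : e₂.target = Metric.ball 0 ρ := by
    have : e₂.target = e₁.target ∩ Metric.ball 0 ρ := rfl
    rw [this]; exact Set.inter_eq_right.2 hρt
  have hs₂ : ∀ z, z ∈ e₂.source ↔ z ∈ e.source ∧ z ∈ Metric.ball y r ∧ ‖e z‖ < ρ := by
    intro z
    have : e₂.source = e₁.source ∩ e₁ ⁻¹' Metric.ball 0 ρ := rfl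
    rw [this, hs₁]
    constructor
    · rintro ⟨⟨h1, h2⟩, h3⟩
      exact ⟨h1, h2, mem_ball_zero_iff.1 h3⟩
    · rintro ⟨h1, h2, h3⟩
      exact ⟨⟨h1, h2⟩, mem_ball_zero_iff.2 h3⟩
  refine ⟨e₂, ρ, ⟨hρ, ?_, hey, ht₂, ?_, ?_, ?_, ?_⟩, ?_⟩
  · rw [hs₂, hey]; exact ⟨hy, Metric.mem_ball_self hr, by simpa⟩
  · exact fun z hz => (he z ((hs₂ z).1 hz).1).1
  · exact fun z hz => (he z ((hs₂ z).1 hz).1).2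
  · intro g hg z hz hgz
    exact h₁ g hg z (Metric.ball_subset_ball (min_le_left _ _) ((hs₂ _).1 hz).2.1)
      (Metric.ball_subset_ball (min_le_left _ _) ((hs₂ _).1 hgz).2.1)
  · intro g hg hgy z hz
    obtain ⟨hz1, hz2, hz3⟩ := (hs₂ z).1 hz
    have hb : g z ∈ Metric.ball y r := by
      rw [Metric.mem_ball] at hz2 ⊢
      rw [← hgy, hG.dist_apply hg, ]
      exact hz2
    have hsrc : g z ∈ e.source := (h₂ (Metric.ball_subset_ball (min_le_right _ _) hb)).2
    refine (hs₂ _).2 ⟨hsrc, hb, ?_⟩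
    have h3 := (he _ hsrc).2
    rw [hinv g hg, (he z hz1).2] at h3
    have h4 : ‖e (g z)‖ ^ m = ‖e z‖ ^ m := by rw [← norm_pow, ← norm_pow, h3]
    rw [(pow_left_inj₀ (norm_nonneg _) (norm_nonneg _) hm0).1 h4]
    exact hz3
  · intro z hz
    exact (h₂ (Metric.ball_subset_ball (min_le_right _ _) ((hs₂ z).1 hz).2.1)).1

namespace IsAdaptedChart

variable {G : Subgroup Aff} {π : ℂ → Sphere} {y : ℂ} {m : ℕ} {e : OpenPartialHomeomorph ℂ ℂ}
  {ρ : ℝ}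

theorem norm_lt (h : IsAdaptedChart G π y m e ρ) {z : ℂ} (hz : z ∈ e.source) : ‖e z‖ < ρ := by
  have := e.map_source hz
  rw [h.target] at this
  simpa using this

theorem symm_mem (h : IsAdaptedChart G π y m e ρ) {w : ℂ} (hw : ‖w‖ < ρ) :
    e.symm w ∈ e.source := e.map_target (by rw [h.target]; simpa using hw)

theorem apply_symm (h : IsAdaptedChart G π y m e ρ) {w : ℂ} (hw : ‖w‖ < ρ) :
    e (e.symm w) = w := e.right_inv (by rw [h.target]; simpa using hw)

theorem eq_iff (h : IsAdaptedChart G π y m e ρ) {u v : ℂ} (hu : u ∈ e.source) (hv : v ∈ e.source) :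
    π u = π v ↔ e u ^ m = e v ^ m := by
  rw [← h.coord_eq u hu, ← h.coord_eq v hv]
  exact ((coord_injOn _).eq_iff (h.ne_pole u hu) (h.ne_pole v hv)).symm

theorem map_mem_disc (h : IsAdaptedChart G π y m e ρ) (hm : m ≠ 0) {z : ℂ} (hz : z ∈ e.source) :
    π z ∈ disc (π y) (ρ ^ m) :=
  ⟨h.ne_pole z hz, by
    rw [h.coord_eq z hz, norm_pow]
    exact pow_lt_pow_left₀ (h.norm_lt hz) (norm_nonneg _) hm⟩

theorem exists_of_mem_disc (h : IsAdaptedChart G π y m e ρ) (hm : m ≠ 0) {x : Sphere}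
    (hx : x ∈ disc (π y) (ρ ^ m)) : ∃ v ∈ e.source, π v = x := by
  obtain ⟨w, hw⟩ := IsAlgClosed.exists_pow_nat_eq (coord (π y) x) (Nat.pos_of_ne_zero hm)
  have hlt : ‖w‖ < ρ := by
    have := hx.2
    rw [← hw, norm_pow] at this
    exact lt_of_pow_lt_pow_left₀ m h.pos.le this
  refine ⟨e.symm w, h.symm_mem hlt, coord_injOn (π y) (h.ne_pole _ (h.symm_mem hlt)) hx.1 ?_⟩
  rw [h.coord_eq _ (h.symm_mem hlt), h.apply_symm hlt, hw]

theorem apply_ne_zero (h : IsAdaptedChart G π y m e ρ) {v : ℂ} (hv : v ∈ e.source) (hvy : v ≠ y) :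
    e v ≠ 0 := by
  intro h0
  exact hvy (e.injOn hv h.mem (by rw [h0, h.apply_eq_zero]))

end IsAdaptedChart

theorem ncard_roots {m : ℕ} (hm : m ≠ 0) : {a : ℂ | a ^ m = 1}.ncard = m := by
  have h := (Complex.isPrimitiveRoot_exp m hm).card_nthRootsFinset
  have h2 : {a : ℂ | a ^ m = 1} = ↑(Polynomial.nthRootsFinset m (1 : ℂ)) := by
    ext a
    simp [Polynomial.mem_nthRootsFinset (Nat.pos_of_ne_zero hm)]
  rw [h2, Set.ncard_coe_finset, h]

/-- The stabilizer of `y` embeds into the group of roots of unity of order the multiplicity. -/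
theorem IsAdaptedChart.injOn_stab {G : Subgroup Aff} {π : ℂ → Sphere} {y : ℂ} {m : ℕ}
    {e : OpenPartialHomeomorph ℂ ℂ} {ρ : ℝ} (h : IsAdaptedChart G π y m e ρ) {v : ℂ}
    (hv : v ∈ e.source) (hvy : v ≠ y) :
    Set.InjOn (fun g : Aff => e (g v) / e v) (stab G y) := by
  intro g hg g' hg' heq
  have h1 : e (g v) = e (g' v) := by
    have := h.apply_ne_zero hv hvy
    simp only at heq
    field_simp at heq
    exact heq
  have h2 : g v = g' v := e.injOn (h.stable g hg.1 hg.2 v hv) (h.stable g' hg'.1 hg'.2 v hv) h1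
  have h3 : g'⁻¹ * g = 1 := by
    refine eq_one_of_fixes_two hvy ?_ ?_
    · rw [mul_apply, hg.2]; conv_lhs => rw [← hg'.2]
      exact inv_apply_apply _ _
    · rw [mul_apply, h2, inv_apply_apply]
  rw [inv_mul_eq_one] at h3
  exact h3.symm

theorem IsAdaptedChart.mapsTo_stab {G : Subgroup Aff} {π : ℂ → Sphere} {y : ℂ} {m : ℕ}
    {e : OpenPartialHomeomorph ℂ ℂ} {ρ : ℝ} (h : IsAdaptedChart G π y m e ρ)
    (hinv : ∀ g ∈ G, ∀ z, π (g z) = π z) {v : ℂ}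
    (hv : v ∈ e.source) (hvy : v ≠ y) :
    Set.MapsTo (fun g : Aff => e (g v) / e v) (stab G y) {a : ℂ | a ^ m = 1} := by
  intro g hg
  have h1 := (h.eq_iff (h.stable g hg.1 hg.2 v hv) hv).1 (hinv g hg.1 v)
  have h2 := h.apply_ne_zero hv hvy
  simp only [Set.mem_ofPred_eq]
  rw [div_pow, h1, div_self (pow_ne_zero _ h2)]

/-- If near `y` the fibres of `π` lie in orbits, the multiplicity is the order of the stabilizer. -/
theorem IsAdaptedChart.ncard_stab {G : Subgroup Aff} {π : ℂ → Sphere} {y : ℂ} {m : ℕ}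
    {e : OpenPartialHomeomorph ℂ ℂ} {ρ : ℝ} (h : IsAdaptedChart G π y m e ρ) (hm : m ≠ 0)
    (hinv : ∀ g ∈ G, ∀ z, π (g z) = π z) {v : ℂ} (hv : v ∈ e.source) (hvy : v ≠ y)
    (hfib : ∀ u ∈ e.source, π u = π v → ∃ g ∈ G, g v = u) : (stab G y).ncard = m := by
  have hb : Set.BijOn (fun g : Aff => e (g v) / e v) (stab G y) {a : ℂ | a ^ m = 1} := by
    refine ⟨h.mapsTo_stab hinv hv hvy, h.injOn_stab hv hvy, fun a ha => ?_⟩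
    have h1 : ‖a‖ = 1 := by
      have : ‖a‖ ^ m = 1 := by rw [← norm_pow, ha, norm_one]
      exact (pow_eq_one_iff_of_nonneg (norm_nonneg _) hm).1 this
    have h2 : ‖a * e v‖ < ρ := by rw [norm_mul, h1, one_mul]; exact h.norm_lt hv
    obtain ⟨g, hg, hgv⟩ := hfib (e.symm (a * e v)) (h.symm_mem h2) (by
      rw [h.eq_iff (h.symm_mem h2) hv, h.apply_symm h2, mul_pow, ha, one_mul])
    have hsrc : g v ∈ e.source := hgv ▸ h.symm_mem h2
    refine ⟨g, ⟨hg, h.fixes g hg v hv hsrc⟩, ?_⟩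
    simp only
    rw [hgv, h.apply_symm h2, mul_div_cancel_right₀ _ (h.apply_ne_zero hv hvy)]
  rw [← ncard_roots hm, ← hb.image_eq, hb.injOn.ncard_image]

/-- If the stabilizer of `y` has the order of the multiplicity, then near `y` the fibres of `π`
lie in orbits. -/
theorem IsAdaptedChart.exists_of_eq {G : Subgroup Aff} {π : ℂ → Sphere} {y : ℂ} {m : ℕ}
    {e : OpenPartialHomeomorph ℂ ℂ} {ρ : ℝ} (h : IsAdaptedChart G π y m e ρ) (hm : m ≠ 0)
    (hinv : ∀ g ∈ G, ∀ z, π (g z) = π z) (hcard : (stab G y).ncard = m) {u v : ℂ}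
    (hu : u ∈ e.source) (hv : v ∈ e.source) (heq : π u = π v) : ∃ g ∈ G, g v = u := by
  have hpow := (h.eq_iff hu hv).1 heq
  by_cases hvy : v = y
  · subst hvy
    rw [h.apply_eq_zero, zero_pow hm, pow_eq_zero_iff hm] at hpow
    exact ⟨1, G.one_mem, e.injOn hv hu (by rw [hpow, h.apply_eq_zero])⟩
  · have hs : Set.SurjOn (fun g : Aff => e (g v) / e v) (stab G y) {a : ℂ | a ^ m = 1} := by
      have hfin := finite_roots (Nat.pos_of_ne_zero hm)
      have := Set.eq_of_subset_of_ncard_le (h.mapsTo_stab hinv hv hvy).image_subset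
        (by rw [ncard_roots hm, (h.injOn_stab hv hvy).ncard_image, hcard]) hfin
      exact this.symm.subset
    have hne := h.apply_ne_zero hv hvy
    obtain ⟨g, hg, hgv⟩ := hs (show e u / e v ∈ {a : ℂ | a ^ m = 1} by
      simp only [Set.mem_ofPred_eq]
      rw [div_pow, hpow, div_self (pow_ne_zero _ hne)])
    simp only at hgv
    rw [div_left_inj' hne] at hgv
    exact ⟨g, hg.1, e.injOn (h.stable g hg.1 hg.2 v hv) hu hgv⟩

theorem isDiscreteGroup_bot : IsDiscreteGroup ⊥ := fun _ _ _ _ =>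
  (Set.finite_singleton (1 : Aff)).subset fun _ hg => Subgroup.mem_bot.1 hg.1

/-- A holomorphic map is open near a point of finite multiplicity. -/
theorem IsHolomorphic.image_mem_nhds {π : ℂ → Sphere} (hπ : IsHolomorphic π) {y : ℂ}
    (hy : multiplicity π y ≠ ⊤) {s : Set ℂ} (hs : s ∈ 𝓝 y) : π '' s ∈ 𝓝 (π y) := by
  obtain ⟨m, hm⟩ := ENat.ne_top_iff_exists.1 hy
  have hm0 : m ≠ 0 := by
    rintro rfl
    exact multiplicity_ne_zero hπ y (by simpa using hm.symm)
  obtain ⟨e, ρ, h, hsub⟩ := exists_adaptedChart isDiscreteGroup_bot hπ (fun g hg z => by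
    rw [Subgroup.mem_bot.1 hg, one_apply]) hm.symm hs
  refine Filter.mem_of_superset ((isOpen_disc _ _).mem_nhds
    (mem_disc_self (π y) (pow_pos h.pos m))) fun x hx => ?_
  obtain ⟨v, hv, rfl⟩ := h.exists_of_mem_disc hm0 hx
  exact ⟨v, hsub hv, rfl⟩

end AffineDiscrete

namespace AffineDiscrete

/-! ### Maps realizing the quotient by a discrete group -/

/-- A holomorphic map to the sphere whose fibres are exactly the orbits of `G`. -/
structure IsUniformizer (G : Subgroup Aff) (π : ℂ → Sphere) : Prop where
  holomorphic : IsHolomorphic π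
  fibre : ∀ z w : ℂ, π z = π w ↔ ∃ g ∈ G, g z = w

namespace IsUniformizer

variable {G : Subgroup Aff} {π : ℂ → Sphere}

theorem map_apply (h : IsUniformizer G π) : ∀ g ∈ G, ∀ z, π (g z) = π z := fun g hg z =>
  ((h.fibre z (g z)).2 ⟨g, hg, rfl⟩).symm

theorem multiplicity_ne_top (h : IsUniformizer G π) (hG : IsDiscreteGroup G) (y : ℂ) :
    multiplicity π y ≠ ⊤ := by
  intro htop
  rw [multiplicity, analyticOrderAt_eq_top] at htop
  have hpole : ∀ᶠ z in 𝓝 y, π z ≠ pole (π y) :=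
    (h.holomorphic y).1.eventually (isOpen_ne.mem_nhds (ne_pole (π y)))
  obtain ⟨r, hr, hball⟩ := hG.exists_radius y y
  have h1 : ∀ᶠ z in 𝓝 y, z = y := by
    filter_upwards [htop, hpole, Metric.ball_mem_nhds y hr] with z hz hz' hzb
    obtain ⟨g, hg, hgz⟩ := (h.fibre y z).1 ((coord_eq_zero hz').1 hz).symm
    rw [← hgz]
    exact hball g hg y (Metric.mem_ball_self hr) (hgz ▸ hzb)
  have h2 : ∀ᶠ z in 𝓝[≠] y, False := by
    filter_upwards [nhdsWithin_le_nhds h1, self_mem_nhdsWithin] with z hz hz'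
    exact hz' hz
  exact (Filter.NeBot.ne inferInstance : (𝓝[≠] y) ≠ ⊥) (Filter.eventually_false_iff_eq_bot.1 h2)

/-- The multiplicity of the quotient map is the order of the stabilizer. -/
theorem multiplicity_eq (h : IsUniformizer G π) (hG : IsDiscreteGroup G) (y : ℂ) :
    multiplicity π y = ((stab G y).ncard : ℕ∞) := by
  obtain ⟨m, hm⟩ := ENat.ne_top_iff_exists.1 (h.multiplicity_ne_top hG y)
  have hm0 : m ≠ 0 := by
    rintro rfl
    exact multiplicity_ne_zero h.holomorphic y (by simpa using hm.symm)
  obtain ⟨e, ρ, hc, -⟩ := exists_adaptedChart hG h.holomorphic h.map_apply hm.symm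
    Filter.univ_mem
  have hw : ‖((ρ / 2 : ℝ) : ℂ)‖ < ρ := by
    rw [Complex.norm_real, Real.norm_eq_abs, abs_of_pos (by linarith [hc.pos])]
    linarith [hc.pos]
  have hne : e.symm ((ρ / 2 : ℝ) : ℂ) ≠ y := by
    intro heq
    have := hc.apply_symm hw
    rw [heq, hc.apply_eq_zero] at this
    have h2 : ρ / 2 = 0 := by exact_mod_cast this.symm
    linarith [hc.pos]
  rw [hc.ncard_stab hm0 h.map_apply (hc.symm_mem hw) hne
    fun u _ heq => (h.fibre _ _).1 heq.symm, hm]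

end IsUniformizer

theorem IsDiscreteGroup.ncard_stab_pos {G : Subgroup Aff} (hG : IsDiscreteGroup G) (y : ℂ) :
    0 < (stab G y).ncard :=
  (Set.ncard_pos (hG.finite_stab y)).2 ⟨1, G.one_mem, rfl⟩

namespace IsUniformizer

variable {G : Subgroup Aff} {π : ℂ → Sphere}

theorem exists_chart (h : IsUniformizer G π) (hG : IsDiscreteGroup G) (y : ℂ) :
    ∃ (e : OpenPartialHomeomorph ℂ ℂ) (ρ : ℝ), IsAdaptedChart G π y (stab G y).ncard e ρ := by
  obtain ⟨e, ρ, hc, -⟩ := exists_adaptedChart hG h.holomorphic h.map_apply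
    (h.multiplicity_eq hG y) Filter.univ_mem
  exact ⟨e, ρ, hc⟩

theorem isOpenMap (h : IsUniformizer G π) (hG : IsDiscreteGroup G) : IsOpenMap π :=
  isOpenMap_iff_nhds_le.2 fun y => by
    intro s hs
    have := h.holomorphic.image_mem_nhds (h.multiplicity_ne_top hG y) (Filter.mem_map.1 hs)
    exact Filter.mem_of_superset this (Set.image_preimage_subset _ _)

end IsUniformizer

namespace IsAdaptedChart

variable {G : Subgroup Aff} {π : ℂ → Sphere} {y : ℂ} {m : ℕ} {e : OpenPartialHomeomorph ℂ ℂ}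
  {ρ : ℝ}

theorem mem_disc_iff (hc : IsAdaptedChart G π y m e ρ) (h : IsUniformizer G π) (hm : m ≠ 0)
    (z : ℂ) : π z ∈ disc (π y) (ρ ^ m) ↔ ∃ g ∈ G, g z ∈ e.source := by
  constructor
  · intro hz
    obtain ⟨v, hv, hvz⟩ := hc.exists_of_mem_disc hm hz
    obtain ⟨g, hg, rfl⟩ := (h.fibre z v).1 hvz.symm
    exact ⟨g, hg, hv⟩
  · rintro ⟨g, hg, hgz⟩
    rw [← h.map_apply g hg z]
    exact hc.map_mem_disc hm hgz

/-- A connected set over a small disc lies in a single translate of the domain of the chart. -/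
theorem forall_mem_of_isPreconnected (hc : IsAdaptedChart G π y m e ρ) (h : IsUniformizer G π)
    (hm : m ≠ 0) {C : Set ℂ} (hC : IsPreconnected C) (hsub : ∀ z ∈ C, π z ∈ disc (π y) (ρ ^ m))
    {g : Aff} (hg : g ∈ G) {z₀ : ℂ} (hz₀ : z₀ ∈ C) (hgz₀ : g z₀ ∈ e.source) :
    ∀ z ∈ C, g z ∈ e.source := by
  have key : ∀ g' ∈ G, ∀ z, g z ∈ e.source → g' z ∈ e.source →
      ∀ w, g' w ∈ e.source → g w ∈ e.source := by
    intro g' hg' z hz hz' w hw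
    have h1 : (g * g'⁻¹) y = y := by
      refine hc.fixes _ (G.mul_mem hg (G.inv_mem hg')) _ hz' ?_
      rw [mul_apply, inv_apply_apply]
      exact hz
    have := hc.stable _ (G.mul_mem hg (G.inv_mem hg')) h1 _ hw
    rwa [mul_apply, inv_apply_apply] at this
  have hopen : ∀ g' : Aff, IsOpen {z | g' z ∈ e.source} := fun g' =>
    e.open_source.preimage (continuous_aff g')
  have := hC.subset_left_of_subset_union (u := {z | g z ∈ e.source})
    (v := ⋃ g' ∈ {g' | g' ∈ G ∧ ∃ w, g' w ∈ e.source ∧ g w ∉ e.source}, {z | g' z ∈ e.source})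
    (hopen g) (isOpen_biUnion fun g' _ => hopen g') ?_ ?_ ⟨z₀, hz₀, hgz₀⟩
  · exact this
  · rw [Set.disjoint_left]
    intro z hz hz'
    simp only [Set.mem_iUnion] at hz'
    obtain ⟨g', ⟨hg', w, hw, hw'⟩, hz'⟩ := hz'
    exact hw' (key g' hg' z hz hz' w hw)
  · intro z hz
    by_cases hgz : g z ∈ e.source
    · exact Or.inl hgz
    · obtain ⟨g', hg', hg'z⟩ := (hc.mem_disc_iff h hm z).1 (hsub z hz)
      refine Or.inr ?_
      simp only [Set.mem_iUnion]
      exact ⟨g', ⟨hg', z, hg'z, hgz⟩, hg'z⟩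

theorem isPreconnected_source (hc : IsAdaptedChart G π y m e ρ) : IsPreconnected e.source := by
  rw [← e.symm_image_target_eq_source, hc.target]
  refine (convex_ball (0 : ℂ) ρ).isPreconnected.image _ ?_
  rw [← hc.target]
  exact e.continuousOn_symm

/-- The components of the preimage of a small disc are translates of the domain of the chart. -/
theorem connectedComponentIn_eq (hc : IsAdaptedChart G π y m e ρ) (h : IsUniformizer G π)
    (hm : m ≠ 0) {g : Aff} (hg : g ∈ G) {z₀ : ℂ} (hgz₀ : g z₀ ∈ e.source) :
    connectedComponentIn (π ⁻¹' disc (π y) (ρ ^ m)) z₀ = {z | g z ∈ e.source} := by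
  have hz₀ : z₀ ∈ π ⁻¹' disc (π y) (ρ ^ m) := (hc.mem_disc_iff h hm z₀).2 ⟨g, hg, hgz₀⟩
  refine Set.Subset.antisymm ?_ ?_
  · exact hc.forall_mem_of_isPreconnected h hm isPreconnected_connectedComponentIn
      (fun z hz => connectedComponentIn_subset (π ⁻¹' disc (π y) (ρ ^ m)) z₀ hz) hg
        (mem_connectedComponentIn hz₀) hgz₀
  · refine IsPreconnected.subset_connectedComponentIn ?_ hgz₀ ?_
    · have : {z | g z ∈ e.source} = (fun z => g⁻¹ z) '' e.source := by
        ext z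
        constructor
        · intro hz
          exact ⟨g z, hz, inv_apply_apply g z⟩
        · rintro ⟨w, hw, rfl⟩
          change g (g⁻¹ w) ∈ e.source
          rwa [apply_inv_apply]
      rw [this]
      exact hc.isPreconnected_source.image _ (continuous_aff _).continuousOn
    · intro z hz
      exact (hc.mem_disc_iff h hm z).2 ⟨g, hg, hz⟩

/-- A translate of the domain of the chart, identified with the unit disc. -/
noncomputable def translateHomeo (hc : IsAdaptedChart G π y m e ρ) (g : Aff) :
    {z | g z ∈ e.source} ≃ₜ Metric.ball (0 : ℂ) 1 where
  toFun z := ⟨e (g z) / ρ, by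
    rw [mem_ball_zero_iff, norm_div, Complex.norm_real, Real.norm_eq_abs, abs_of_pos hc.pos,
      div_lt_one hc.pos]
    exact hc.norm_lt z.2⟩
  invFun w := ⟨g⁻¹ (e.symm (ρ * w)), by
    change g (g⁻¹ _) ∈ e.source
    rw [apply_inv_apply]
    refine hc.symm_mem ?_
    rw [norm_mul, Complex.norm_real, Real.norm_eq_abs, abs_of_pos hc.pos]
    have := mem_ball_zero_iff.1 w.2
    nlinarith [hc.pos]⟩
  left_inv z := by
    have : (ρ : ℂ) ≠ 0 := by exact_mod_cast hc.pos.ne'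
    refine Subtype.ext ?_
    simp only
    rw [mul_div_cancel₀ _ this, e.left_inv z.2, inv_apply_apply]
  right_inv w := by
    have hρ : (ρ : ℂ) ≠ 0 := by exact_mod_cast hc.pos.ne'
    have : ‖(ρ : ℂ) * w‖ < ρ := by
      rw [norm_mul, Complex.norm_real, Real.norm_eq_abs, abs_of_pos hc.pos]
      have := mem_ball_zero_iff.1 w.2
      nlinarith [hc.pos]
    refine Subtype.ext ?_
    simp only
    rw [apply_inv_apply, hc.apply_symm this, mul_div_cancel_left₀ _ hρ]
  continuous_toFun := by
    refine Continuous.subtype_mk ?_ _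
    refine Continuous.div_const ?_ _
    exact e.continuousOn.comp_continuous ((continuous_aff g).comp continuous_subtype_val)
      fun z => z.2
  continuous_invFun := by
    refine Continuous.subtype_mk ?_ _
    refine (continuous_aff _).comp ?_
    refine e.continuousOn_symm.comp_continuous (by fun_prop) fun w => ?_
    rw [hc.target, mem_ball_zero_iff, norm_mul, Complex.norm_real, Real.norm_eq_abs,
      abs_of_pos hc.pos]
    have := mem_ball_zero_iff.1 w.2
    nlinarith [hc.pos]

end IsAdaptedChart

/-- A coordinate disc of the sphere, identified with the unit disc. -/
noncomputable def discHomeo (a : Sphere) {r : ℝ} (hr : 0 < r) :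
    disc a r ≃ₜ Metric.ball (0 : ℂ) 1 where
  toFun x := ⟨coord a x / r, by
    rw [mem_ball_zero_iff, norm_div, Complex.norm_real, Real.norm_eq_abs, abs_of_pos hr,
      div_lt_one hr]
    exact x.2.2⟩
  invFun w := ⟨param a (r * w), by
    refine param_mem_disc _ ?_
    rw [norm_mul, Complex.norm_real, Real.norm_eq_abs, abs_of_pos hr]
    have := mem_ball_zero_iff.1 w.2
    nlinarith⟩
  left_inv x := by
    have : (r : ℂ) ≠ 0 := by exact_mod_cast hr.ne'
    refine Subtype.ext ?_
    simp only
    rw [mul_div_cancel₀ _ this, param_coord a x x.2.1]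
  right_inv w := by
    have : (r : ℂ) ≠ 0 := by exact_mod_cast hr.ne'
    refine Subtype.ext ?_
    simp only
    rw [coord_param, mul_div_cancel_left₀ _ this]
  continuous_toFun := by
    refine Continuous.subtype_mk ?_ _
    refine Continuous.div_const ?_ _
    have h : ContinuousOn (coord a) {x | x ≠ pole a} := fun x hx =>
      (continuousAt_coord a hx).continuousWithinAt
    exact h.comp_continuous continuous_subtype_val fun x => x.2.1
  continuous_invFun := by
    refine Continuous.subtype_mk ?_ _
    exact (continuous_param a).comp (by fun_prop)

namespace IsUniformizer

variable {G : Subgroup Aff} {π : ℂ → Sphere}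

theorem isBranchedCoveringOn (h : IsUniformizer G π) (hG : IsDiscreteGroup G) :
    IsBranchedCoveringOn π (Set.range π) := by
  rintro _ ⟨y, rfl⟩
  obtain ⟨e, ρ, hc⟩ := h.exists_chart hG y
  have hm := hG.ncard_stab_pos y
  set m := (stab G y).ncard
  have hr : 0 < ρ ^ m := pow_pos hc.pos m
  refine ⟨disc (π y) (ρ ^ m), mem_disc_self _ hr, isOpen_disc _ _, ?_, discHomeo _ hr, ?_, ?_⟩
  · intro x hx
    obtain ⟨v, -, rfl⟩ := hc.exists_of_mem_disc hm.ne' hx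
    exact ⟨v, rfl⟩
  · change coord (π y) (π y) / _ = 0
    simp
  · intro z₀ hz₀
    obtain ⟨g, hg, hgz₀⟩ := (hc.mem_disc_iff h hm.ne' z₀).1 hz₀
    have heq := hc.connectedComponentIn_eq h hm.ne' hg hgz₀
    refine ⟨m, hm, (Homeomorph.setCongr heq).trans (hc.translateHomeo g), fun v hv => ?_⟩
    have hgv : g v ∈ e.source := by
      have : (v : ℂ) ∈ {z | g z ∈ e.source} := heq.subset v.2
      exact this
    change coord (π y) (π v) / _ = (e (g v) / ρ) ^ m
    rw [div_pow, ← hc.coord_eq _ hgv, h.map_apply g hg]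
    push_cast
    rfl

theorem isCoveringMapOn (h : IsUniformizer G π) (hG : IsDiscreteGroup G) :
    IsCoveringMapOn π (π '' {y | (stab G y).ncard = 1}) := by
  let _ : MulAction G ℂ :=
    { smul := fun g z => (g : Aff) z
      one_smul := fun z => rfl
      mul_smul := fun g g' z => rfl }
  have hsmul (g : G) (z : ℂ) : g • z = (g : Aff) z := rfl
  have : ContinuousConstSMul G ℂ := ⟨fun g => continuous_aff g⟩
  have hop := h.isOpenMap hG
  have hro : IsOpen (Set.range π) := hop.isOpen_range
  have hq : Topology.IsQuotientMap (Set.rangeFactorization π) := by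
    refine IsOpenMap.isQuotientMap ?_ (h.holomorphic.continuous.subtype_mk _)
      Set.rangeFactorization_surjective
    intro s hs
    have h1 := (hop s hs).preimage (continuous_subtype_val (p := fun x => x ∈ Set.range π))
    convert h1 using 1
    ext x
    simp only [Set.mem_image, Set.mem_preimage]
    constructor
    · rintro ⟨z, hz, rfl⟩
      exact ⟨z, hz, rfl⟩
    · rintro ⟨z, hz, hzx⟩
      exact ⟨z, hz, Subtype.ext hzx⟩
  have hcov := hq.isCoveringMapOn_of_smul_disjoint (G := G) (fun {e₁ e₂} => by
      rw [Set.rangeFactorization, Set.rangeFactorization, Subtype.mk.injEq, eq_comm, h.fibre]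
      constructor
      · rintro ⟨g, hg, rfl⟩
        exact ⟨⟨g, hg⟩, rfl⟩
      · rintro ⟨g, rfl⟩
        exact ⟨g, g.2, rfl⟩) (fun y => by
      obtain ⟨r, hr, hb⟩ := hG.exists_radius y y
      refine ⟨_, Metric.ball_mem_nhds y hr, ?_⟩
      rintro g ⟨_, ⟨z, hz, rfl⟩, hgz⟩
      exact hb g g.2 z hz hgz)
  rintro _ ⟨y, hy, rfl⟩
  have h1 := hcov ⟨π y, y, rfl⟩ ⟨y, by
    rw [Set.mem_ofPred_eq, Subgroup.eq_bot_iff_forall]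
    intro g hg
    obtain ⟨g₀, hg₀⟩ := Set.ncard_eq_one.1 hy
    have h1 : (1 : Aff) ∈ stab G y := ⟨G.one_mem, rfl⟩
    have h2 : (g : Aff) ∈ stab G y := ⟨g.2, hg⟩
    rw [hg₀] at h1 h2
    exact Subtype.ext (h2.trans h1.symm), rfl⟩
  exact (h1.subtypeVal_comp _ hro).to_isEvenlyCovered_preimage

end IsUniformizer

theorem coord_loopAround (a : Sphere) {ε : ℝ} (hε : 0 < ε) (t : ℝ) :
    loopAround a ε t ≠ pole a ∧
      coord a (loopAround a ε t) = ε * Complex.exp (2 * Real.pi * t * Complex.I) := by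
  have h : (ε : ℂ) * Complex.exp (2 * Real.pi * t * Complex.I) ≠ 0 :=
    mul_ne_zero (by exact_mod_cast hε.ne') (Complex.exp_ne_zero _)
  rw [loopAround, ← param_of_ne a h]
  exact ⟨param_ne_pole _ _, coord_param _ _⟩

theorem norm_exp_two_pi (t : ℝ) : ‖Complex.exp (2 * Real.pi * t * Complex.I)‖ = 1 := by
  have : (2 * Real.pi * t * Complex.I : ℂ) = ((2 * Real.pi * t : ℝ) : ℂ) * Complex.I := by
    push_cast; ring
  rw [this, Complex.norm_exp_ofReal_mul_I]

/-- A continuous function on the line, a positive power of which is constant, is constant. -/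
theorem eq_of_pow_eq {q : ℝ → ℂ} (hq : Continuous q) {m : ℕ} (hm : m ≠ 0) {c : ℂ}
    (h : ∀ t, q t ^ m = c) (s t : ℝ) : q s = q t := by
  have hfin : {w : ℂ | w ^ m = c}.Finite := by
    refine (Polynomial.nthRoots m c).toFinset.finite_toSet.subset fun a ha => ?_
    simpa [Polynomial.mem_nthRoots (Nat.pos_of_ne_zero hm)] using ha
  have h1 : (Set.range q).Subsingleton := by
    by_contra hns
    exact (isPreconnected_range hq).infinite_of_nontrivial (Set.not_subsingleton_iff.1 hns)
      (hfin.subset (by rintro _ ⟨t, rfl⟩; exact h t))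
  exact h1 ⟨s, rfl⟩ ⟨t, rfl⟩

theorem exp_div_eq_one_iff {m : ℕ} (hm : m ≠ 0) (k : ℕ) :
    Complex.exp (2 * Real.pi * ((k : ℝ) : ℂ) * Complex.I / m) = 1 ↔ m ∣ k := by
  rw [← (Complex.isPrimitiveRoot_exp m hm).pow_eq_one_iff_dvd, ← Complex.exp_nat_mul]
  have : (2 * Real.pi * ((k : ℝ) : ℂ) * Complex.I / m : ℂ) = k * (2 * Real.pi * Complex.I / m) := by
    push_cast; ring
  rw [this]

/-- The local monodromy has the order of the stabilizer. -/
theorem IsUniformizer.localMonodromyOrder {G : Subgroup Aff} {π : ℂ → Sphere}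
    (h : IsUniformizer G π) (hG : IsDiscreteGroup G) (y : ℂ) :
    LocalMonodromyOrder π (π y) (stab G y).ncard := by
  obtain ⟨e, ρ, hc⟩ := h.exists_chart hG y
  have hm := (hG.ncard_stab_pos y).ne'
  set m := (stab G y).ncard
  have hmC : (m : ℂ) ≠ 0 := by exact_mod_cast hm
  filter_upwards [Ioo_mem_nhdsGT (pow_pos hc.pos m)] with ε hε
  have hdisc : ∀ t, loopAround (π y) ε t ∈ disc (π y) (ρ ^ m) := by
    intro t
    obtain ⟨h1, h2⟩ := coord_loopAround (π y) hε.1 t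
    refine ⟨h1, ?_⟩
    rw [h2, norm_mul, norm_exp_two_pi, mul_one, Complex.norm_real, Real.norm_eq_abs,
      abs_of_pos hε.1]
    exact hε.2
  have hexp : ∀ t : ℝ, Complex.exp (2 * Real.pi * t * Complex.I / m) ^ m =
      Complex.exp (2 * Real.pi * t * Complex.I) := by
    intro t
    rw [← Complex.exp_nat_mul, mul_div_cancel₀ _ hmC]
  -- in the coordinate of the chart, a lift rotates by `1 / m` of a turn in each unit of time
  have hlift : ∀ γ : ℝ → ℂ, Continuous γ → (∀ t, π (γ t) = loopAround (π y) ε t) →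
      ∀ k : ℕ, γ k = γ 0 ↔ m ∣ k := by
    intro γ hγ hγl k
    obtain ⟨g, hg, hgz⟩ := (hc.mem_disc_iff h hm (γ 0)).1 (by rw [hγl]; exact hdisc 0)
    have hsrc : ∀ t, g (γ t) ∈ e.source := by
      intro t
      refine hc.forall_mem_of_isPreconnected h hm (isPreconnected_range hγ) ?_ hg ⟨0, rfl⟩ hgz _
        ⟨t, rfl⟩
      rintro _ ⟨t, rfl⟩
      rw [hγl]; exact hdisc t
    have hpow : ∀ t, e (g (γ t)) ^ m = ε * Complex.exp (2 * Real.pi * t * Complex.I) := by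
      intro t
      rw [← hc.coord_eq _ (hsrc t), h.map_apply g hg, hγl, (coord_loopAround _ hε.1 t).2]
    set q : ℝ → ℂ := fun t => e (g (γ t)) / Complex.exp (2 * Real.pi * t * Complex.I / m) with hq
    have hqc : Continuous q := by
      refine Continuous.div₀ ?_ (by fun_prop) fun t => Complex.exp_ne_zero _
      exact e.continuousOn.comp_continuous ((continuous_aff g).comp hγ) hsrc
    have hqp : ∀ t, q t ^ m = ε := by
      intro t
      simp only [hq]
      rw [div_pow, hpow, hexp, mul_div_cancel_right₀ _ (Complex.exp_ne_zero _)]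
    have hconst := eq_of_pow_eq hqc hm hqp k 0
    have hq0 : q 0 ≠ 0 := by
      intro h0
      have := hqp 0
      rw [h0, zero_pow hm] at this
      have h3 : ε = 0 := by exact_mod_cast this.symm
      exact hε.1.ne' h3
    have he : ∀ t, e (g (γ t)) = q t * Complex.exp (2 * Real.pi * t * Complex.I / m) := by
      intro t
      simp only [hq]
      rw [div_mul_cancel₀ _ (Complex.exp_ne_zero _)]
    have h0 : e (g (γ 0)) = q 0 := by rw [he 0]; simp
    rw [← exp_div_eq_one_iff hm k]
    constructor
    · intro heq
      have h1 := he k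
      rw [heq, h0, hconst] at h1
      exact (mul_left_cancel₀ hq0 (by rw [mul_one]; exact h1)).symm
    · intro heq
      refine g.injective (e.injOn (hsrc _) (hsrc _) ?_)
      rw [he k, hconst, heq, mul_one, h0]
  intro k
  constructor
  · intro hall
    set r : ℝ := ε ^ ((m : ℝ)⁻¹) with hr
    have hrm : r ^ m = ε := Real.rpow_inv_natCast_pow hε.1.le hm
    have hrpos : 0 < r := Real.rpow_pos_of_pos hε.1 _
    have hrlt : r < ρ := lt_of_pow_lt_pow_left₀ m hc.pos.le (by rw [hrm]; exact hε.2)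
    have hnorm : ∀ t : ℝ, ‖(r : ℂ) * Complex.exp (2 * Real.pi * t * Complex.I / m)‖ < ρ := by
      intro t
      have : ‖Complex.exp (2 * Real.pi * t * Complex.I / m)‖ = 1 := by
        have h1 : ‖Complex.exp (2 * Real.pi * t * Complex.I / m)‖ ^ m = 1 := by
          rw [← norm_pow, hexp, norm_exp_two_pi]
        exact (pow_eq_one_iff_of_nonneg (norm_nonneg _) hm).1 h1
      rw [norm_mul, this, mul_one, Complex.norm_real, Real.norm_eq_abs, abs_of_pos hrpos]
      exact hrlt
    set γ : ℝ → ℂ := fun t => e.symm (r * Complex.exp (2 * Real.pi * t * Complex.I / m)) with hγ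
    have hγc : Continuous γ := by
      refine e.continuousOn_symm.comp_continuous (by fun_prop) fun t => ?_
      rw [hc.target, mem_ball_zero_iff]
      exact hnorm t
    have hγl : ∀ t, π (γ t) = loopAround (π y) ε t := by
      intro t
      refine coord_injOn (π y) (hc.ne_pole _ (hc.symm_mem (hnorm t)))
        (coord_loopAround (π y) hε.1 t).1 ?_
      rw [hc.coord_eq _ (hc.symm_mem (hnorm t)), hc.apply_symm (hnorm t),
        (coord_loopAround (π y) hε.1 t).2, mul_pow, hexp]
      norm_cast
      rw [hrm]
    exact (hlift γ hγc hγl k).1 (hall γ hγc hγl)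
  · intro hdvd γ hγc hγl
    exact (hlift γ hγc hγl k).2 hdvd

theorem LocalMonodromyOrder.unique {π : ℂ → Sphere} {a : Sphere} {r s : ℕ}
    (hr : LocalMonodromyOrder π a r) (hs : LocalMonodromyOrder π a s) : r = s := by
  obtain ⟨ε, h1, h2⟩ := (hr.and hs).exists
  have h : ∀ m, r ∣ m ↔ s ∣ m := fun m => (h1 m).symm.trans (h2 m)
  exact Nat.dvd_antisymm ((h s).2 dvd_rfl) ((h r).1 dvd_rfl)

/-- The signatures of a quotient map, in terms of stabilizers. -/
theorem IsUniformizer.isCoveringWithSignature_iff {G : Subgroup Aff} {π : ℂ → Sphere}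
    (h : IsUniformizer G π) (hG : IsDiscreteGroup G) (σ : Signature) :
    IsCoveringWithSignature π σ ↔ Set.range π = {x | x ∉ σ.B} ∧
      (∀ y, π y ∈ σ.A ↔ (stab G y).ncard ≠ 1) ∧
      ∀ y, π y ∈ σ.A → σ.ord (π y) = (stab G y).ncard := by
  constructor
  · intro hσ
    have hord : ∀ y, π y ∈ σ.A → σ.ord (π y) = (stab G y).ncard := fun y hy =>
      (hσ.monodromy _ hy).unique (h.localMonodromyOrder hG y)
    refine ⟨hσ.range_eq, fun y => ⟨fun hy => ?_, fun hy => ?_⟩, hord⟩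
    · rw [← hord y hy]
      exact (σ.one_lt_ord _ hy).ne'
    · by_contra hA
      have hB : π y ∉ σ.B := by
        have : π y ∈ {x | x ∉ σ.B} := hσ.range_eq ▸ ⟨y, rfl⟩
        exact this
      obtain ⟨φ, hφ, hφe⟩ := hσ.unbranched.isLocalHomeomorphOn y ⟨hA, hB⟩
      obtain ⟨r, hr, hball⟩ := Metric.mem_nhds_iff.1 (φ.open_source.mem_nhds hφ)
      refine hy (Set.ncard_eq_one.2 ⟨1, ?_⟩)
      refine Set.eq_singleton_iff_unique_mem.2 ⟨⟨G.one_mem, rfl⟩, fun g hg => ?_⟩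
      set v : ℂ := y + (r / 2 : ℝ) with hv
      have hvy : v ≠ y := by
        simp [hv, hr.ne']
      have hd : dist v y < r := by
        rw [hv, dist_eq_norm, add_sub_cancel_left, Complex.norm_real, Real.norm_eq_abs,
          abs_of_pos (by linarith)]
        linarith
      have hd' : dist (g v) y < r := by
        conv_lhs => rw [← hg.2]
        rwa [hG.dist_apply hg.1]
      refine eq_one_of_fixes_two hvy hg.2 (φ.injOn (hball hd') (hball hd) ?_)
      rw [← hφe]
      exact h.map_apply g hg.1 v
  · rintro ⟨hr, hA, hord⟩
    refine ⟨h.holomorphic, hr, hr ▸ h.isBranchedCoveringOn hG, ?_, ?_⟩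
    · refine (h.isCoveringMapOn hG).mono ?_
      rintro x ⟨hxA, hxB⟩
      have : x ∈ Set.range π := by rw [hr]; exact hxB
      obtain ⟨y, rfl⟩ := this
      refine ⟨y, ?_, rfl⟩
      by_contra hne
      exact hxA ((hA y).2 hne)
    · intro a ha
      have : a ∈ Set.range π := by rw [hr]; exact Finset.disjoint_left.1 σ.disj ha
      obtain ⟨y, rfl⟩ := this
      rw [hord y ha]
      exact h.localMonodromyOrder hG y

theorem IsUniformizer.isUniversalCovering {G : Subgroup Aff} {π : ℂ → Sphere}
    (h : IsUniformizer G π) (hG : IsDiscreteGroup G) {σ : Signature}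
    (hσ : IsCoveringWithSignature π σ) : IsUniversalCovering π σ := by
  refine ⟨hσ, fun z hz => ?_⟩
  rw [h.multiplicity_eq hG, ((h.isCoveringWithSignature_iff hG σ).1 hσ).2.2 z hz]

end AffineDiscrete

namespace AffineDiscrete

/-! ### Automorphisms of the sphere -/

theorem det_ne_zero (T : GL (Fin 2) ℂ) : T 0 0 * T 1 1 - T 0 1 * T 1 0 ≠ 0 := by
  have := T.det_ne_zero
  rwa [Matrix.det_fin_two] at this

/-- In local coordinates vanishing at `x` and at `T x`, an automorphism `T` of the sphere is
fractional linear and vanishes at `0`. -/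
theorem smul_param (T : GL (Fin 2) ℂ) (x : Sphere) : ∃ p q s : ℂ, q ≠ 0 ∧ ∀ w, q + s * w ≠ 0 →
    T • param x w = param (T • x) (p * w / (q + s * w)) := by
  have hdet := det_ne_zero T
  induction x using OnePoint.rec with
  | infty =>
    have h0 (w : ℂ) (hw : w ≠ 0) : T • param OnePoint.infty w =
        if T 1 0 + T 1 1 * w = 0 then OnePoint.infty else
          (((T 0 0 + T 0 1 * w) / (T 1 0 + T 1 1 * w) : ℂ) : OnePoint ℂ) := by
      rw [param_of_ne _ hw, coordInv_infty, OnePoint.smul_some_eq_ite]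
      have e1 : T 1 0 * w⁻¹ + T 1 1 = (T 1 0 + T 1 1 * w) / w := by field_simp
      have e2 : T 0 0 * w⁻¹ + T 0 1 = (T 0 0 + T 0 1 * w) / w := by field_simp
      rw [e1, e2, div_div_div_cancel_right₀ hw]
      simp [div_eq_zero_iff, hw]
    by_cases hc : T 1 0 = 0
    · have hd : T 1 1 ≠ 0 := by rintro h; rw [hc, h] at hdet; simp at hdet
      have ha : T 0 0 ≠ 0 := by rintro h; rw [hc, h] at hdet; simp at hdet
      refine ⟨T 1 1, T 0 0, T 0 1, ha, fun w hw => ?_⟩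
      have hT : T • (OnePoint.infty : OnePoint ℂ) = OnePoint.infty := by
        rw [OnePoint.smul_infty_eq_ite, if_pos hc]
      rw [hT]
      by_cases hw0 : w = 0
      · simp [hw0, hT]
      · rw [h0 w hw0, hc, zero_add, if_neg (mul_ne_zero hd hw0),
          param_of_ne _ (div_ne_zero (mul_ne_zero hd hw0) hw), coordInv_infty, inv_div]
    · refine ⟨-(T 0 0 * T 1 1 - T 0 1 * T 1 0), T 1 0 * T 1 0, T 1 0 * T 1 1,
        mul_ne_zero hc hc, fun w hw => ?_⟩
      have hT : T • (OnePoint.infty : OnePoint ℂ) = ((T 0 0 / T 1 0 : ℂ) : OnePoint ℂ) := by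
        rw [OnePoint.smul_infty_eq_ite, if_neg hc]
      rw [hT]
      have hw' : T 1 0 + T 1 1 * w ≠ 0 := by
        intro h; apply hw; linear_combination T 1 0 * h
      by_cases hw0 : w = 0
      · simp [hw0, hT]
      · rw [h0 w hw0, if_neg hw', param_coe]
        congr 1
        rw [div_add_div _ _ hc hw, div_eq_div_iff hw' (mul_ne_zero hc hw)]
        ring
  | coe x =>
    have h0 (w : ℂ) : T • param (x : OnePoint ℂ) w =
        if (T 1 0 * x + T 1 1) + T 1 0 * w = 0 then OnePoint.infty else
          (((T 0 0 * x + T 0 1 + T 0 0 * w) / ((T 1 0 * x + T 1 1) + T 1 0 * w) : ℂ) :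
            OnePoint ℂ) := by
      rw [param_coe, OnePoint.smul_some_eq_ite]
      have e1 : T 1 0 * (x + w) + T 1 1 = (T 1 0 * x + T 1 1) + T 1 0 * w := by ring
      have e2 : T 0 0 * (x + w) + T 0 1 = T 0 0 * x + T 0 1 + T 0 0 * w := by ring
      rw [e1, e2]
    by_cases hc : T 1 0 * x + T 1 1 = 0
    · have hc0 : T 1 0 ≠ 0 := by
        intro h
        have : T 1 1 = 0 := by rw [h] at hc; simpa using hc
        rw [h, this] at hdet; simp at hdet
      have ha : T 0 0 * x + T 0 1 ≠ 0 := by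
        intro h
        apply hdet
        have : T 1 0 * (T 0 0 * T 1 1 - T 0 1 * T 1 0) = 0 := by
          linear_combination (T 0 0 * T 1 0) * hc - T 1 0 * T 1 0 * h
        exact (mul_eq_zero.1 this).resolve_left hc0
      refine ⟨T 1 0, T 0 0 * x + T 0 1, T 0 0, ha, fun w hw => ?_⟩
      have hT : T • (x : OnePoint ℂ) = OnePoint.infty := by
        rw [OnePoint.smul_some_eq_ite, if_pos hc]
      rw [hT]
      by_cases hw0 : w = 0
      · simp [hw0, hT]
      · rw [h0 w, hc, zero_add, if_neg (mul_ne_zero hc0 hw0),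
          param_of_ne _ (div_ne_zero (mul_ne_zero hc0 hw0) hw), coordInv_infty, inv_div]
    · refine ⟨T 0 0 * T 1 1 - T 0 1 * T 1 0, (T 1 0 * x + T 1 1) * (T 1 0 * x + T 1 1),
        (T 1 0 * x + T 1 1) * T 1 0, mul_ne_zero hc hc, fun w hw => ?_⟩
      have hT : T • (x : OnePoint ℂ) =
          (((T 0 0 * x + T 0 1) / (T 1 0 * x + T 1 1) : ℂ) : OnePoint ℂ) := by
        rw [OnePoint.smul_some_eq_ite, if_neg hc]
      rw [hT]
      have hw' : (T 1 0 * x + T 1 1) + T 1 0 * w ≠ 0 := by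
        intro h; apply hw; linear_combination (T 1 0 * x + T 1 1) * h
      rw [h0 w, if_neg hw', param_coe]
      congr 1
      rw [div_add_div _ _ hc hw, div_eq_div_iff hw' (mul_ne_zero hc hw)]
      ring

theorem eventually_smul_eq (T : GL (Fin 2) ℂ) (a : Sphere) : ∃ M : ℂ → ℂ, AnalyticAt ℂ M 0 ∧
    ∀ᶠ x in 𝓝 a, T • x = param (T • a) (M (coord a x)) := by
  obtain ⟨p, q, s, hq, h⟩ := smul_param T a
  refine ⟨fun w => p * w / (q + s * w), ?_, ?_⟩
  · refine AnalyticAt.div (by fun_prop) (by fun_prop) (by simpa using hq)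
  · have hc := continuousAt_coord a (ne_pole a)
    have h1 : ∀ᶠ x in 𝓝 a, q + s * coord a x ≠ 0 := by
      have h2 : ContinuousAt (fun x => q + s * coord a x) a := by fun_prop
      exact h2.eventually (isOpen_ne.mem_nhds (by simpa using hq))
    filter_upwards [h1, isOpen_ne.mem_nhds (ne_pole a)] with x hx hx'
    rw [← h _ hx, param_coord a x hx']

theorem continuous_smul_sphere (T : GL (Fin 2) ℂ) : Continuous fun x : Sphere => T • x := by
  rw [continuous_iff_continuousAt]
  intro a
  obtain ⟨M, hM, h⟩ := eventually_smul_eq T a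
  refine ContinuousAt.congr ?_ (h.mono fun x hx => hx.symm)
  refine (continuous_param _).continuousAt.comp ?_
  have h0 : coord a a = 0 := coord_self a
  refine ContinuousAt.comp ?_ (continuousAt_coord a (ne_pole a))
  rw [h0]
  exact hM.continuousAt

theorem IsHolomorphic.smul {π : ℂ → Sphere} (hπ : IsHolomorphic π) (T : GL (Fin 2) ℂ) :
    IsHolomorphic fun z => T • π z := by
  intro z
  refine ⟨(continuous_smul_sphere T).continuousAt.comp (hπ z).1, ?_⟩
  obtain ⟨M, hM, h⟩ := eventually_smul_eq T (π z)
  have h1 : AnalyticAt ℂ (fun w => M (coord (π z) (π w))) z := by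
    refine AnalyticAt.fun_comp ?_ (hπ z).2
    rwa [coord_self]
  refine h1.congr ?_
  filter_upwards [(hπ z).1.eventually h] with w hw
  rw [hw, coord_param]

theorem IsUniformizer.smul {G : Subgroup Aff} {π : ℂ → Sphere} (h : IsUniformizer G π)
    (T : GL (Fin 2) ℂ) : IsUniformizer G fun z => T • π z where
  holomorphic := h.holomorphic.smul T
  fibre z w := by rw [smul_left_cancel_iff]; exact h.fibre z w

/-- The fractional linear transformation `x ↦ (a x + b) / (c x + d)`. -/
noncomputable def moebius (a b c d : ℂ) (h : a * d - b * c ≠ 0) : GL (Fin 2) ℂ :=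
  Matrix.GeneralLinearGroup.mkOfDetNeZero !![a, b; c, d] (by rwa [Matrix.det_fin_two_of])

theorem moebius_coe (a b c d : ℂ) (h : a * d - b * c ≠ 0) (x : ℂ) :
    moebius a b c d h • (x : OnePoint ℂ) =
      if c * x + d = 0 then OnePoint.infty else (((a * x + b) / (c * x + d) : ℂ) : OnePoint ℂ) := by
  rw [OnePoint.smul_some_eq_ite]
  rfl

theorem moebius_infty (a b c d : ℂ) (h : a * d - b * c ≠ 0) :
    moebius a b c d h • (OnePoint.infty : OnePoint ℂ) =
      if c = 0 then OnePoint.infty else ((a / c : ℂ) : OnePoint ℂ) := by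
  rw [OnePoint.smul_infty_eq_ite]
  rfl

theorem exists_smul_eq_infty (x : Sphere) : ∃ T : GL (Fin 2) ℂ, T • x = OnePoint.infty := by
  induction x using OnePoint.rec with
  | infty => exact ⟨1, one_smul _ _⟩
  | coe x =>
    refine ⟨moebius 0 1 1 (-x) (by simp), ?_⟩
    rw [moebius_coe, if_pos (by ring)]

/-- Three points of the sphere can be moved to `0`, `1`, `∞`. -/
theorem exists_smul_standard {x₁ x₂ x₃ : Sphere} (h12 : x₁ ≠ x₂) (h13 : x₁ ≠ x₃) (h23 : x₂ ≠ x₃) :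
    ∃ T : GL (Fin 2) ℂ, T • x₁ = ((0 : ℂ) : OnePoint ℂ) ∧ T • x₂ = ((1 : ℂ) : OnePoint ℂ) ∧
      T • x₃ = OnePoint.infty := by
  obtain ⟨S, hS⟩ := exists_smul_eq_infty x₃
  have h1 : S • x₁ ≠ OnePoint.infty := by
    rw [← hS]; exact fun h => h13 (smul_left_cancel S h)
  have h2 : S • x₂ ≠ OnePoint.infty := by
    rw [← hS]; exact fun h => h23 (smul_left_cancel S h)
  have h3 : S • x₁ ≠ S • x₂ := fun h => h12 (smul_left_cancel S h)
  obtain ⟨a, ha⟩ := OnePoint.ne_infty_iff_exists.1 h1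
  obtain ⟨b, hb⟩ := OnePoint.ne_infty_iff_exists.1 h2
  have hab : b - a ≠ 0 := by
    intro h
    rw [← ha, ← hb, sub_eq_zero.1 h] at h3
    exact h3 rfl
  refine ⟨moebius 1 (-a) 0 (b - a) (by simpa using hab) * S, ?_, ?_, ?_⟩
  · rw [mul_smul, ← ha, moebius_coe, if_neg (by simpa using hab)]
    simp
  · rw [mul_smul, ← hb, moebius_coe, if_neg (by simpa using hab)]
    congr 1
    rw [div_eq_one_iff_eq (by simpa using hab)]
    ring
  · rw [mul_smul, hS, moebius_infty, if_pos rfl]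

theorem exists_smul_three {x₁ x₂ x₃ y₁ y₂ y₃ : Sphere} (h12 : x₁ ≠ x₂) (h13 : x₁ ≠ x₃)
    (h23 : x₂ ≠ x₃) (k12 : y₁ ≠ y₂) (k13 : y₁ ≠ y₃) (k23 : y₂ ≠ y₃) :
    ∃ T : GL (Fin 2) ℂ, T • x₁ = y₁ ∧ T • x₂ = y₂ ∧ T • x₃ = y₃ := by
  obtain ⟨T, hT1, hT2, hT3⟩ := exists_smul_standard h12 h13 h23
  obtain ⟨S, hS1, hS2, hS3⟩ := exists_smul_standard k12 k13 k23
  refine ⟨S⁻¹ * T, ?_, ?_, ?_⟩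
  · rw [mul_smul, hT1, ← hS1, inv_smul_smul]
  · rw [mul_smul, hT2, ← hS2, inv_smul_smul]
  · rw [mul_smul, hT3, ← hS3, inv_smul_smul]

/-- At most three points of the sphere can be moved arbitrarily. -/
theorem exists_smul_of_pairs : ∀ (n : ℕ) (p : Multiset (Sphere × Sphere)), p.card + n = 3 →
    (p.map Prod.fst).Nodup → (p.map Prod.snd).Nodup →
    ∃ T : GL (Fin 2) ℂ, ∀ x ∈ p, T • x.1 = x.2
  | 0, p, hp, h1, h2 => by
    obtain ⟨⟨a, a'⟩, ⟨b, b'⟩, ⟨c, c'⟩, rfl⟩ := Multiset.card_eq_three.1 hp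
    simp only [Multiset.insert_eq_cons, Multiset.map_cons, Multiset.map_singleton,
      Multiset.nodup_cons, Multiset.mem_cons, Multiset.mem_singleton, not_or,
      Multiset.nodup_singleton, and_true] at h1 h2
    obtain ⟨T, hT1, hT2, hT3⟩ := exists_smul_three h1.1.1 h1.1.2 h1.2 h2.1.1 h2.1.2 h2.2
    refine ⟨T, ?_⟩
    simp only [Multiset.insert_eq_cons, Multiset.mem_cons, Multiset.mem_singleton]
    rintro x (rfl | rfl | rfl)
    exacts [hT1, hT2, hT3]
  | n + 1, p, hp, h1, h2 => by
    classical
    obtain ⟨a, ha⟩ := Infinite.exists_notMem_finset (p.map Prod.fst).toFinset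
    obtain ⟨b, hb⟩ := Infinite.exists_notMem_finset (p.map Prod.snd).toFinset
    rw [Multiset.mem_toFinset] at ha hb
    obtain ⟨T, hT⟩ := exists_smul_of_pairs n ((a, b) ::ₘ p) (by
      rw [Multiset.card_cons]; omega) (by
      rw [Multiset.map_cons]; exact Multiset.nodup_cons.2 ⟨ha, h1⟩) (by
      rw [Multiset.map_cons]; exact Multiset.nodup_cons.2 ⟨hb, h2⟩)
    exact ⟨T, fun x hx => hT x (Multiset.mem_cons_of_mem hx)⟩

/-! ### Equivalence of signatures -/

theorem Signature.Equivalent.refl (σ : Signature) : σ.Equivalent σ :=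
  ⟨1, fun x => by rw [one_smul], fun x => by rw [one_smul], fun x _ => by rw [one_smul]⟩

theorem Signature.Equivalent.symm {σ σ' : Signature} (h : σ.Equivalent σ') : σ'.Equivalent σ := by
  obtain ⟨T, hA, hB, ho⟩ := h
  refine ⟨T⁻¹, fun x => ?_, fun x => ?_, fun x hx => ?_⟩
  · rw [← hA, smul_inv_smul]
  · rw [← hB, smul_inv_smul]
  · rw [← ho _ (by rwa [← hA, smul_inv_smul]), smul_inv_smul]

theorem Signature.Equivalent.trans {σ σ' σ'' : Signature} (h : σ.Equivalent σ')
    (h' : σ'.Equivalent σ'') : σ.Equivalent σ'' := by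
  obtain ⟨T, hA, hB, ho⟩ := h
  obtain ⟨S, hA', hB', ho'⟩ := h'
  refine ⟨S * T, fun x => ?_, fun x => ?_, fun x hx => ?_⟩
  · rw [mul_smul, hA', hA]
  · rw [mul_smul, hB', hB]
  · rw [mul_smul, ho' _ ((hA x).2 hx), ho x hx]

theorem Signature.Equivalent.orders_eq {σ σ' : Signature} (h : σ.Equivalent σ') :
    σ.orders = σ'.orders := by
  classical
  obtain ⟨T, hA, hB, ho⟩ := h
  have himage : ∀ s s' : Finset Sphere, (∀ x : Sphere, T • x ∈ s' ↔ x ∈ s) →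
      s' = s.map (MulAction.toPerm T).toEmbedding := by
    intro s s' hs
    ext x
    rw [Finset.mem_map]
    constructor
    · intro hx
      exact ⟨T⁻¹ • x, by rw [← hs, smul_inv_smul]; exact hx, smul_inv_smul T x⟩
    · rintro ⟨y, hy, rfl⟩
      exact (hs y).2 hy
  rw [Signature.orders, Signature.orders, himage _ _ hA, himage _ _ hB, Finset.card_map,
    Finset.map_val, Multiset.map_map]
  congr 1
  refine Multiset.map_congr rfl fun x hx => ?_
  simp only [Function.comp_apply]
  rw [← ho x hx]
  rfl

theorem exists_pairs_of_rel {α β : Type*} {r : α → β → Prop} {s : Multiset α} {t : Multiset β}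
    (h : Multiset.Rel r s t) :
    ∃ p : Multiset (α × β), p.map Prod.fst = s ∧ p.map Prod.snd = t ∧ ∀ x ∈ p, r x.1 x.2 := by
  induction h with
  | zero => exact ⟨0, rfl, rfl, fun x hx => absurd hx (Multiset.notMem_zero x)⟩
  | @cons a b as bs hab _ ih =>
    obtain ⟨p, rfl, rfl, hp⟩ := ih
    refine ⟨(a, b) ::ₘ p, by simp, by simp, fun x hx => ?_⟩
    rcases Multiset.mem_cons.1 hx with rfl | hx
    exacts [hab, hp x hx]

theorem Signature.orders_eq_iff {σ σ' : Signature} (h : σ.orders = σ'.orders) :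
    σ.A.val.map σ.ord = σ'.A.val.map σ'.ord ∧ σ.B.card = σ'.B.card := by
  classical
  have hA : ∀ τ : Signature, τ.orders.filter (· ≠ ⊤) = τ.A.val.map fun a => (τ.ord a : ℕ∞) := by
    intro τ
    rw [Signature.orders, Multiset.filter_add, Multiset.filter_eq_self.2, Multiset.filter_eq_nil.2,
      add_zero]
    · intro x hx hne
      exact hne (Multiset.eq_of_mem_replicate hx)
    · intro x hx
      obtain ⟨a, -, rfl⟩ := Multiset.mem_map.1 hx
      exact ENat.natCast_ne_top _
  have h1 := (hA σ).symm.trans ((congrArg _ h).trans (hA σ'))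
  constructor
  · have := congrArg (Multiset.map ENat.toNat) h1
    rw [Multiset.map_map, Multiset.map_map] at this
    simpa [Function.comp_def] using this
  · have h2 := h
    rw [Signature.orders, Signature.orders, h1, add_right_inj] at h2
    simpa using congrArg Multiset.card h2

/-- A signature with at most three points is determined by its orders. -/
theorem Signature.equivalent_of_orders_eq {σ σ' : Signature} (h : σ.orders = σ'.orders)
    (hcard : σ.orders.card ≤ 3) : σ.Equivalent σ' := by
  classical
  obtain ⟨hA, hB⟩ := Signature.orders_eq_iff h
  have hr : Multiset.Rel (fun a b => σ.ord a = σ'.ord b) σ.A.val σ'.A.val := by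
    rw [← Multiset.rel_map, hA, Multiset.rel_eq]
  have hrB : Multiset.Rel (fun _ _ => True) σ.B.val σ'.B.val := by
    have : Multiset.Rel (· = ·) (σ.B.val.map fun _ => ()) (σ'.B.val.map fun _ => ()) := by
      rw [Multiset.rel_eq, Multiset.map_const', Multiset.map_const']
      exact congrArg (fun n => Multiset.replicate n ()) hB
    rw [Multiset.rel_map] at this
    exact this.mono fun _ _ _ _ _ => trivial
  obtain ⟨p, hp1, hp2, hp⟩ := exists_pairs_of_rel hr
  obtain ⟨q, hq1, hq2, -⟩ := exists_pairs_of_rel hrB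
  have hnd : ∀ τ : Signature, (τ.A.val + τ.B.val).Nodup := fun τ =>
    Multiset.nodup_add.2 ⟨τ.A.nodup, τ.B.nodup, Multiset.disjoint_left.2 fun hx hx' =>
      Finset.disjoint_left.1 τ.disj hx hx'⟩
  have hc : (p + q).card ≤ 3 := by
    have e1 : p.card = σ.A.card := by
      rw [Finset.card, ← hp1, Multiset.card_map]
    have e2 : q.card = σ.B.card := by
      rw [Finset.card, ← hq1, Multiset.card_map]
    have e3 : σ.orders.card = σ.A.card + σ.B.card := by
      rw [Signature.orders]; simp
    rw [Multiset.card_add, e1, e2, ← e3]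
    exact hcard
  obtain ⟨T, hT⟩ := exists_smul_of_pairs (3 - (p + q).card) (p + q) (by omega)
    (by rw [Multiset.map_add, hp1, hq1]; exact hnd σ)
    (by rw [Multiset.map_add, hp2, hq2]; exact hnd σ')
  have hmem : ∀ (s s' : Finset Sphere) (u : Multiset (Sphere × Sphere)), u.map Prod.fst = s.val →
      u.map Prod.snd = s'.val → (∀ x ∈ u, T • x.1 = x.2) → ∀ x : Sphere, T • x ∈ s' ↔ x ∈ s := by
    intro s s' u h1 h2 hu x
    rw [← Finset.mem_val, ← Finset.mem_val, ← h1, ← h2, Multiset.mem_map, Multiset.mem_map]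
    constructor
    · rintro ⟨y, hy, hyx⟩
      refine ⟨y, hy, ?_⟩
      rw [← hu y hy] at hyx
      exact smul_left_cancel T hyx
    · rintro ⟨y, hy, rfl⟩
      exact ⟨y, hy, (hu y hy).symm⟩
  refine ⟨T, hmem _ _ p hp1 hp2 fun x hx => hT x (Multiset.mem_add.2 (Or.inl hx)),
    hmem _ _ q hq1 hq2 fun x hx => hT x (Multiset.mem_add.2 (Or.inr hx)), fun a ha => ?_⟩
  rw [← Finset.mem_val, ← hp1, Multiset.mem_map] at ha
  obtain ⟨x, hx, rfl⟩ := ha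
  rw [hT x (Multiset.mem_add.2 (Or.inl hx)), hp x hx]

/-! ### Four points and their cross-ratio -/

theorem mem_fourPoint {l : ℂ} {x : Sphere} : x ∈ (fourPointSignature l).A ↔
    x = ((0 : ℂ) : OnePoint ℂ) ∨ x = ((1 : ℂ) : OnePoint ℂ) ∨ x = OnePoint.infty ∨
      x = (l : OnePoint ℂ) := by
  simp [fourPointSignature]

theorem fourPoint_card {l : ℂ} (h0 : l ≠ 0) (h1 : l ≠ 1) : (fourPointSignature l).A.card = 4 := by
  classical
  have h0' : (0 : ℂ) ≠ l := h0.symm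
  have h1' : (1 : ℂ) ≠ l := h1.symm
  rw [fourPointSignature]
  simp only
  rw [Finset.card_insert_of_notMem, Finset.card_insert_of_notMem, Finset.card_insert_of_notMem,
    Finset.card_singleton]
  · simp
  · simpa [OnePoint.coe_eq_coe] using h1'
  · simpa [OnePoint.coe_eq_coe] using h0'

/-- To compare signatures with four points it is enough to map branching points to branching
points. -/
theorem fourPoint_equivalent_of {l : ℂ} (h0 : l ≠ 0) (h1 : l ≠ 1) {σ : Signature}
    (hA : σ.A.card = 4) (hB : σ.B = ∅) (ho : ∀ a ∈ σ.A, σ.ord a = 2) (T : GL (Fin 2) ℂ)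
    (hT : ∀ x ∈ (fourPointSignature l).A, T • x ∈ σ.A) : (fourPointSignature l).Equivalent σ := by
  classical
  have himage : (fourPointSignature l).A.map (MulAction.toPerm T).toEmbedding = σ.A := by
    refine Finset.eq_of_subset_of_card_le ?_ (by rw [Finset.card_map, hA, fourPoint_card h0 h1])
    intro x hx
    obtain ⟨y, hy, rfl⟩ := Finset.mem_map.1 hx
    exact hT y hy
  refine ⟨T, fun x => ⟨fun hx => ?_, hT x⟩, fun x => by simp [hB, fourPointSignature],
    fun x hx => ho _ (hT x hx)⟩
  rw [← himage, Finset.mem_map] at hx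
  obtain ⟨y, hy, hyx⟩ := hx
  have : y = x := smul_left_cancel T hyx
  exact this ▸ hy

theorem fourPoint_equivalent_one_sub {l : ℂ} (h0 : l ≠ 0) (h1 : l ≠ 1) :
    (fourPointSignature l).Equivalent (fourPointSignature (1 - l)) := by
  refine fourPoint_equivalent_of h0 h1 (fourPoint_card (sub_ne_zero.2 h1.symm) (by simpa using h0))
    rfl (fun _ _ => rfl) (moebius (-1) 1 0 1 (by simp)) fun x hx => ?_
  rw [mem_fourPoint] at hx ⊢
  rcases hx with rfl | rfl | rfl | rfl
  · simp [moebius_coe]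
  · simp [moebius_coe]
  · simp [moebius_infty]
  · right; right; right
    rw [moebius_coe, if_neg (by simp)]
    congr 1; ring

theorem fourPoint_equivalent_inv {l : ℂ} (h0 : l ≠ 0) (h1 : l ≠ 1) :
    (fourPointSignature l).Equivalent (fourPointSignature l⁻¹) := by
  refine fourPoint_equivalent_of h0 h1 (fourPoint_card (inv_ne_zero h0) (by simpa using h1))
    rfl (fun _ _ => rfl) (moebius 0 1 1 0 (by simp)) fun x hx => ?_
  rw [mem_fourPoint] at hx ⊢
  rcases hx with rfl | rfl | rfl | rfl
  · simp [moebius_coe]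
  · simp [moebius_coe]
  · simp [moebius_infty]
  · right; right; right
    rw [moebius_coe, if_neg (by simpa using h0)]
    congr 1; simp

/-- The symmetries of four points act transitively on them. -/
theorem exists_fourPoint_symmetry {l : ℂ} (h0 : l ≠ 0) (h1 : l ≠ 1) {p : Sphere}
    (hp : p ∈ (fourPointSignature l).A) : ∃ T : GL (Fin 2) ℂ, T • p = OnePoint.infty ∧
      ∀ x ∈ (fourPointSignature l).A, T • x ∈ (fourPointSignature l).A := by
  have h1' : 1 - l ≠ 0 := sub_ne_zero.2 h1.symm
  have h1'' : l - 1 ≠ 0 := sub_ne_zero.2 h1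
  rw [mem_fourPoint] at hp
  rcases hp with rfl | rfl | rfl | rfl
  · refine ⟨moebius 0 l 1 0 (by simpa using h0), by simp [moebius_coe], fun x hx => ?_⟩
    rw [mem_fourPoint] at hx ⊢
    rcases hx with rfl | rfl | rfl | rfl
    · simp [moebius_coe]
    · simp [moebius_coe]
    · simp [moebius_infty]
    · simp [moebius_coe, h0]
  · refine ⟨moebius 1 (-l) 1 (-1) (by intro h; apply h1; linear_combination h),
      by simp [moebius_coe], fun x hx => ?_⟩
    rw [mem_fourPoint] at hx ⊢
    rcases hx with rfl | rfl | rfl | rfl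
    · simp [moebius_coe]
    · simp [moebius_coe]
    · simp [moebius_infty]
    · left
      rw [moebius_coe, if_neg (by intro h; apply h1''; linear_combination h)]
      congr 1
      field_simp
      ring
  · exact ⟨1, one_smul _ _, fun x hx => by rwa [one_smul]⟩
  · refine ⟨moebius l (-l) 1 (-l) (by
      intro h
      have : l * (1 - l) = 0 := by linear_combination h
      rcases mul_eq_zero.1 this with h | h
      exacts [h0 h, h1' h]), by simp [moebius_coe], fun x hx => ?_⟩
    rw [mem_fourPoint] at hx ⊢
    rcases hx with rfl | rfl | rfl | rfl
    · right; left
      rw [moebius_coe, if_neg (by simpa using h0)]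
      congr 1
      rw [div_eq_one_iff_eq (by simpa using h0)]
      ring
    · left
      rw [moebius_coe, if_neg (by intro h; apply h1'; linear_combination h)]
      congr 1
      field_simp
      ring
    · simp [moebius_infty]
    · simp [moebius_coe]

theorem crossRatioEquiv_of_equivalent {l l' : ℂ} (h0 : l ≠ 0) (h1 : l ≠ 1) (h0' : l' ≠ 0)
    (h1' : l' ≠ 1) (h : (fourPointSignature l).Equivalent (fourPointSignature l')) :
    CrossRatioEquiv l l' := by
  obtain ⟨T, hT, -, -⟩ := h
  have hmem (x : Sphere) := (@mem_fourPoint l x).2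
  obtain ⟨S, hS, hS'⟩ := exists_fourPoint_symmetry h0' h1'
    ((hT OnePoint.infty).2 (hmem _ (by simp)))
  set R := S * T with hR
  have hRA : ∀ x ∈ (fourPointSignature l).A, R • x ∈ (fourPointSignature l').A := by
    intro x hx
    rw [hR, mul_smul]
    exact hS' _ ((hT x).2 hx)
  have hRi : R • (OnePoint.infty : OnePoint ℂ) = OnePoint.infty := by rw [hR, mul_smul, hS]
  have hc : R 1 0 = 0 := OnePoint.smul_infty_eq_self_iff.1 hRi
  have hd : R 1 1 ≠ 0 := by
    intro h
    have := det_ne_zero R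
    rw [hc, h] at this
    simp at this
  -- `R` fixes `∞`, so it is affine on the other three points
  set α := R 0 0 / R 1 1
  set β := R 0 1 / R 1 1
  have hcoe (x : ℂ) : R • (x : OnePoint ℂ) = ((α * x + β : ℂ) : OnePoint ℂ) := by
    rw [OnePoint.smul_some_eq_ite, hc, zero_mul, zero_add, if_neg hd]
    congr 1
    simp only [α, β]
    field_simp
  have hval (x : ℂ) (hx : (x : OnePoint ℂ) ∈ (fourPointSignature l).A) :
      α * x + β = 0 ∨ α * x + β = 1 ∨ α * x + β = l' := by
    have := hRA _ hx
    rw [hcoe, mem_fourPoint] at this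
    simpa [OnePoint.coe_eq_coe] using this
  have hinj (x y : ℂ) (h : α * x + β = α * y + β) : x = y := by
    have : R • (x : OnePoint ℂ) = R • (y : OnePoint ℂ) := by rw [hcoe, hcoe, h]
    exact OnePoint.coe_eq_coe.1 (smul_left_cancel R this)
  have v0 := hval 0 (hmem _ (by simp))
  have v1 := hval 1 (hmem _ (by simp))
  have vl := hval l (hmem _ (by simp))
  have n01 : ¬ (α * 0 + β = α * 1 + β) := fun h => zero_ne_one (hinj _ _ h)
  have n0l : ¬ (α * 0 + β = α * l + β) := fun h => h0 (hinj _ _ h).symm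
  have n1l : ¬ (α * 1 + β = α * l + β) := fun h => h1 (hinj _ _ h).symm
  have hl1 : 1 - l ≠ 0 := sub_ne_zero.2 h1.symm
  have hl1' : l - 1 ≠ 0 := sub_ne_zero.2 h1
  rw [CrossRatioEquiv]
  rcases v0 with v0 | v0 | v0 <;> rcases v1 with v1 | v1 | v1 <;> rcases vl with vl | vl | vl <;>
    first
    | exact absurd (v0.trans v1.symm) n01
    | exact absurd (v0.trans vl.symm) n0l
    | exact absurd (v1.trans vl.symm) n1l
    | skip
  · left; linear_combination (1 - l) * v0 + l * v1 - vl
  · right; right; left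
    refine eq_inv_of_mul_eq_one_left ?_
    linear_combination vl - l * v1 - (1 - l) * v0
  · right; left
    linear_combination l * v1 - vl + (1 - l) * v0
  · right; right; right; right; right
    field_simp
    linear_combination vl - l * v1 - (1 - l) * v0
  · right; right; right; left
    refine eq_inv_of_mul_eq_one_left ?_
    linear_combination vl - l * v1 - (1 - l) * v0
  · right; right; right; right; left
    rw [← div_eq_mul_inv, eq_div_iff hl1']
    linear_combination l * v1 - vl + (1 - l) * v0

theorem equivalent_of_crossRatioEquiv {l l' : ℂ} (h0 : l ≠ 0) (h1 : l ≠ 1)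
    (h : CrossRatioEquiv l l') : (fourPointSignature l).Equivalent (fourPointSignature l') := by
  have hs0 : 1 - l ≠ 0 := sub_ne_zero.2 h1.symm
  have hs1 : 1 - l ≠ 1 := by simpa using h0
  have hi0 : l⁻¹ ≠ 0 := inv_ne_zero h0
  have hi1 : l⁻¹ ≠ 1 := by simpa using h1
  have e1 := fourPoint_equivalent_one_sub h0 h1
  have e2 := fourPoint_equivalent_inv h0 h1
  have e3 := e1.trans (fourPoint_equivalent_inv hs0 hs1)
  rcases h with rfl | rfl | rfl | rfl | rfl | rfl
  · exact .refl _
  · exact e1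
  · exact e2
  · exact e3
  · have := e3.trans (fourPoint_equivalent_one_sub (inv_ne_zero hs0) (by simpa using hs1))
    convert this using 2
    have hl1' : l - 1 ≠ 0 := sub_ne_zero.2 h1
    field_simp
    ring
  · have := e2.trans (fourPoint_equivalent_one_sub hi0 hi1)
    convert this using 2
    field_simp

end AffineDiscrete

namespace AffineDiscrete

/-! ### Uniqueness of the quotient map -/

/-- A bounded holomorphic function on the complement of a finite set is constant. -/
theorem exists_const_of_bounded {F : Set ℂ} (hF : F.Finite) : ∀ {h : ℂ → ℂ},
    (∀ z ∉ F, DifferentiableAt ℂ h z) → (∃ C, ∀ z ∉ F, ‖h z‖ ≤ C) → ∃ c, ∀ z ∉ F, h z = c := by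
  induction F, hF using Set.Finite.induction_on with
  | empty =>
    intro h hd ⟨C, hC⟩
    have hd' : Differentiable ℂ h := fun z => hd z (Set.notMem_empty z)
    obtain ⟨c, hc⟩ := hd'.exists_const_forall_eq_of_bounded
      (isBounded_iff_forall_norm_le.2 ⟨C, by rintro _ ⟨z, rfl⟩; exact hC z (Set.notMem_empty z)⟩)
    exact ⟨c, fun z _ => hc z⟩
  | @insert a F ha hF ih =>
    intro h hd ⟨C, hC⟩
    have hnot : ∀ z ∉ F, z ≠ a → z ∉ insert a F := fun z hz hza h => by
      rcases h with h | h
      exacts [hza h, hz h]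
    have hopen : IsOpen Fᶜ := hF.isClosed.isOpen_compl
    set h' := Function.update h a ((𝓝[≠] a).limUnder h) with hh'
    have hdiff : DifferentiableOn ℂ h' Fᶜ := by
      refine Complex.differentiableOn_update_limUnder_of_bddAbove (hopen.mem_nhds ha) ?_ ?_
      · intro z hz
        exact (hd z (hnot z hz.1 hz.2)).differentiableWithinAt
      · refine ⟨C, ?_⟩
        rintro _ ⟨z, hz, rfl⟩
        exact hC z (hnot z hz.1 hz.2)
    have hne : ∀ z, z ≠ a → h' z = h z := fun z hz => Function.update_of_ne hz _ _
    have hd' : ∀ z ∉ F, DifferentiableAt ℂ h' z := fun z hz =>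
      hdiff.differentiableAt (hopen.mem_nhds hz)
    obtain ⟨c, hc⟩ := ih hd' ⟨C, fun z hz => by
      by_cases hza : z = a
      · subst hza
        refine le_of_tendsto (x := 𝓝[≠] z) (f := fun w => ‖h' w‖)
          ((hd' z hz).continuousAt.norm.tendsto.mono_left nhdsWithin_le_nhds) ?_
        filter_upwards [self_mem_nhdsWithin, nhdsWithin_le_nhds (hopen.mem_nhds hz)] with w hw hw'
        rw [hne w hw]
        exact hC w (hnot w hw' hw)
      · rw [hne z hza]
        exact hC z (hnot z hz hza)⟩
    refine ⟨c, fun z hz => ?_⟩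
    rw [← hc z fun h => hz (Set.mem_insert_of_mem _ h), hne]
    rintro rfl
    exact hz (Set.mem_insert _ _)

/-- The reciprocal of an analytic function with a simple zero at `0` has principal part
`α / t`. -/
theorem eventually_norm_inv_sub_le {φ : ℂ → ℂ} (hφ : AnalyticAt ℂ φ 0) (h0 : φ 0 = 0)
    (hd : deriv φ 0 ≠ 0) : ∃ C, ∀ᶠ t in 𝓝[≠] 0, ‖(φ t)⁻¹ - (deriv φ 0)⁻¹ * t⁻¹‖ ≤ C := by
  obtain ⟨p, hp⟩ := hφ
  have hψ : AnalyticAt ℂ (dslope φ 0) 0 := ⟨_, hp.has_fpower_series_dslope_fslope⟩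
  have hψ0 : dslope φ 0 0 = deriv φ 0 := dslope_same φ 0
  have hinv : AnalyticAt ℂ (fun t => (dslope φ 0 t)⁻¹) 0 := hψ.inv (by rwa [hψ0])
  have hs := hasDerivAt_iff_tendsto_slope.1 hinv.differentiableAt.hasDerivAt
  refine ⟨‖deriv (fun t => (dslope φ 0 t)⁻¹) 0‖ + 1, ?_⟩
  filter_upwards [hs.norm.eventually (Iic_mem_nhds (lt_add_one _)), self_mem_nhdsWithin]
    with t ht ht'
  rw [slope_def_field, hψ0, sub_zero, dslope_of_ne _ ht', slope_def_field, h0, sub_zero,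
    sub_zero, inv_div] at ht
  have ht0 : t ≠ 0 := ht'
  have e : (t / φ t - (deriv φ 0)⁻¹) / t = (φ t)⁻¹ - (deriv φ 0)⁻¹ * t⁻¹ := by
    field_simp
  rw [← e]
  exact ht

/-- Near a point with trivial stabilizer the quotient map has a holomorphic local section. -/
theorem IsUniformizer.exists_section {G : Subgroup Aff} {π : ℂ → Sphere} (h : IsUniformizer G π)
    (hG : IsDiscreteGroup G) {y : ℂ} (hy : (stab G y).ncard = 1) :
    ∃ s : ℂ → ℂ, AnalyticAt ℂ s 0 ∧ s 0 = y ∧ deriv s 0 ≠ 0 ∧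
      ∀ᶠ t in 𝓝 0, π (s t) = param (π y) t := by
  set u : ℂ → ℂ := fun w => coord (π y) (π w) with hu
  have hua : AnalyticAt ℂ u y := (h.holomorphic y).2
  have hu0 : u y = 0 := coord_self _
  have hord : analyticOrderAt u y = 1 := by
    have := h.multiplicity_eq hG y
    rw [hy] at this
    simpa [multiplicity] using this
  have hd : deriv u y ≠ 0 := by
    have h1 := hua.analyticOrderAt_deriv_add_one
    simp only [hu0, sub_zero] at h1
    rw [hord] at h1
    have h2 : analyticOrderAt (deriv u) y = 0 := by
      rcases ENat.ne_top_iff_exists.1 (show analyticOrderAt (deriv u) y ≠ ⊤ from fun h => by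
        rw [h] at h1; simp at h1) with ⟨n, hn⟩
      rw [← hn] at h1 ⊢
      have : n + 1 = 1 := by exact_mod_cast h1
      simpa using this
    exact hua.deriv.analyticOrderAt_eq_zero.1 h2
  have hsd := hua.hasStrictDerivAt
  have hsa := hua.analyticAt_localInverse hd
  set s := hsd.localInverse _ _ _ hd with hs
  rw [hu0] at hsa
  have hright : ∀ᶠ t in 𝓝 0, u (s t) = t := by
    have := (hsd.hasStrictFDerivAt_equiv hd).eventually_right_inverse
    rw [hu0] at this
    exact this
  have hs0 : s 0 = y := by
    have := (hsd.hasStrictFDerivAt_equiv hd).localInverse_apply_image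
    rw [hu0] at this
    exact this
  refine ⟨s, hsa, hs0, ?_, ?_⟩
  · intro hds
    have h1 : HasDerivAt (fun t => u (s t)) (deriv u y * deriv s 0) 0 := by
      refine HasDerivAt.comp (h₂ := u) 0 ?_ hsa.differentiableAt.hasDerivAt
      rw [hs0]
      exact hua.differentiableAt.hasDerivAt
    have h2 : HasDerivAt (fun t : ℂ => t) (deriv u y * deriv s 0) 0 :=
      h1.congr_of_eventuallyEq (hright.mono fun t ht => ht.symm)
    have := h2.unique (hasDerivAt_id 0)
    rw [hds, mul_zero] at this
    exact zero_ne_one this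
  · have hcont : ContinuousAt (fun t => π (s t)) 0 := by
      refine ContinuousAt.comp ?_ hsa.continuousAt
      exact h.holomorphic.continuous.continuousAt
    have hpole : ∀ᶠ t in 𝓝 0, π (s t) ≠ pole (π y) := by
      refine hcont.eventually (isOpen_ne.mem_nhds ?_)
      change π (s 0) ≠ pole (π y)
      rw [hs0]; exact ne_pole _
    filter_upwards [hright, hpole] with t ht ht'
    rw [← param_coord _ _ ht']
    congr 1

/-- The finite value of a point of the sphere, and `0` at infinity. -/
noncomputable def finiteValue : Sphere → ℂ
  | none => 0
  | some x => x

theorem coe_finiteValue {x : Sphere} (h : x ≠ OnePoint.infty) :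
    ((finiteValue x : ℂ) : OnePoint ℂ) = x := by
  induction x using OnePoint.rec with
  | infty => exact absurd rfl h
  | coe x => rfl

theorem IsUniformizer.dense_preimage {G : Subgroup Aff} {π : ℂ → Sphere} (h : IsUniformizer G π)
    (hG : IsDiscreteGroup G) {F : Set Sphere} (hF : F.Finite) : Dense {z | π z ∉ F} := by
  rw [dense_iff_inter_open]
  intro O hO ⟨w, hw⟩
  by_contra hne
  rw [Set.not_nonempty_iff_eq_empty] at hne
  obtain ⟨ρ, hρ, hsub⟩ := eventually_disc _
    (h.holomorphic.image_mem_nhds (h.multiplicity_ne_top hG w) (hO.mem_nhds hw))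
  have hinj : Function.Injective (param (π w)) := fun s t hst => by
    rw [← coord_param (π w) s, hst, coord_param]
  have hfin : (Metric.ball (0 : ℂ) ρ).Finite := by
    refine (hF.preimage (f := param (π w)) hinj.injOn).subset fun t ht => ?_
    obtain ⟨v, hv, hvt⟩ := hsub (param_mem_disc (π w) (mem_ball_zero_iff.1 ht))
    by_contra hnot
    have : v ∈ O ∩ {z | π z ∉ F} := ⟨hv, by rw [Set.mem_ofPred_eq, hvt]; exact hnot⟩
    rw [hne] at this
    exact this
  exact (infinite_of_mem_nhds (0 : ℂ) (Metric.ball_mem_nhds 0 hρ)) hfin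

/-- Two quotient maps that send a point with trivial stabilizer to infinity differ by an affine
transformation. -/
theorem IsUniformizer.exists_affine {G : Subgroup Aff} (hG : IsDiscreteGroup G)
    {π π' : ℂ → Sphere} (h : IsUniformizer G π) (h' : IsUniformizer G π') {F : Set Sphere}
    (hF : F.Finite) (hreg : ∀ x ∉ F, ∃ y, π y = x ∧ (stab G y).ncard = 1) {y₀ : ℂ}
    (hy₀ : (stab G y₀).ncard = 1) (hi : π y₀ = OnePoint.infty) (hi' : π' y₀ = OnePoint.infty) :
    ∃ T : GL (Fin 2) ℂ, ∀ z, π' z = T • π z := by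
  classical
  have hfib : ∀ z w, π z = π w ↔ π' z = π' w := fun z w => (h.fibre z w).trans (h'.fibre z w).symm
  -- `f` is the map of the sphere induced by `π` and `π'`, on finite points
  set f : ℂ → ℂ := fun x =>
    if hx : ∃ y, π y = (x : OnePoint ℂ) then finiteValue (π' hx.choose) else 0 with hf
  have hfv : ∀ (x w : ℂ), π w = (x : OnePoint ℂ) → π' w = (f x : OnePoint ℂ) := by
    intro x w hw
    have hx : ∃ y, π y = (x : OnePoint ℂ) := ⟨w, hw⟩
    have h1 : π' hx.choose = π' w := (hfib _ _).1 (hx.choose_spec.trans hw.symm)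
    have h2 : π' w ≠ OnePoint.infty := by
      rw [← hi', Ne, ← hfib, hw, hi]
      exact OnePoint.coe_ne_infty x
    simp only [hf]
    rw [dif_pos hx, h1, coe_finiteValue h2]
  set F₀ : Set ℂ := (fun x : ℂ => (x : OnePoint ℂ)) ⁻¹' F with hF₀
  have hF₀fin : F₀.Finite := hF.preimage OnePoint.coe_injective.injOn
  have hdiff : ∀ x ∉ F₀, DifferentiableAt ℂ f x := by
    intro x hx
    obtain ⟨y, hy, hys⟩ := hreg x hx
    obtain ⟨s, hsa, hs0, -, hs⟩ := h.exists_section hG hys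
    have hfy := hfv x y hy
    have h1 : AnalyticAt ℂ (fun t => coord (π' y) (π' (s t))) 0 := by
      refine AnalyticAt.fun_comp (g := fun w => coord (π' y) (π' w)) ?_ hsa
      rw [hs0]
      exact (h'.holomorphic y).2
    have h2 : AnalyticAt ℂ (fun z => f x + coord (π' y) (π' (s (z - x)))) x := by
      refine analyticAt_const.add (AnalyticAt.fun_comp
        (g := fun t => coord (π' y) (π' (s t))) ?_ (by fun_prop))
      rwa [sub_self]
    refine h2.differentiableAt.congr_of_eventuallyEq ?_
    have h3 : Filter.Tendsto (fun z => z - x) (𝓝 x) (𝓝 0) := by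
      have : ContinuousAt (fun z => z - x) x := by fun_prop
      simpa [ContinuousAt] using this
    filter_upwards [h3.eventually hs] with z hz
    rw [hy, param_coe, add_sub_cancel] at hz
    rw [hfy, hfv z _ hz, coord_coe_coe]
    ring
  obtain ⟨s, hsa, hs0, hsd, hs⟩ := h.exists_section hG hy₀
  obtain ⟨s', hsa', hs0', hsd', hs'⟩ := h'.exists_section hG hy₀
  set φ : ℂ → ℂ := fun t => coord OnePoint.infty (π' (s t)) with hφ
  have hφa : AnalyticAt ℂ φ 0 := by
    refine AnalyticAt.fun_comp (g := fun w => coord OnePoint.infty (π' w)) ?_ hsa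
    rw [hs0, ← hi']
    exact (h'.holomorphic y₀).2
  have hφ0 : φ 0 = 0 := by simp only [hφ]; rw [hs0, hi', coord_self]
  have hφd : deriv φ 0 ≠ 0 := by
    -- the coordinate of `π'` at `y₀` is inverse to `s'`, so its derivative does not vanish
    set u : ℂ → ℂ := fun w => coord OnePoint.infty (π' w) with hu
    have hua : AnalyticAt ℂ u y₀ := by rw [hu, ← hi']; exact (h'.holomorphic y₀).2
    have hud : deriv u y₀ ≠ 0 := by
      intro h0
      have h1 : HasDerivAt (fun t => u (s' t)) (deriv u y₀ * deriv s' 0) 0 := by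
        refine HasDerivAt.comp (h₂ := u) 0 ?_ hsa'.differentiableAt.hasDerivAt
        rw [hs0']
        exact hua.differentiableAt.hasDerivAt
      have h2 : HasDerivAt (fun t : ℂ => t) (deriv u y₀ * deriv s' 0) 0 := by
        refine h1.congr_of_eventuallyEq ?_
        filter_upwards [hs'] with t ht
        simp only [hu]
        rw [ht, hi', coord_param]
      have := h2.unique (hasDerivAt_id 0)
      rw [h0, zero_mul] at this
      exact zero_ne_one this
    have h1 : HasDerivAt φ (deriv u y₀ * deriv s 0) 0 := by
      refine HasDerivAt.comp (h₂ := u) 0 ?_ hsa.differentiableAt.hasDerivAt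
      rw [hs0]
      exact hua.differentiableAt.hasDerivAt
    rw [h1.deriv]
    exact mul_ne_zero hud hsd
  set α := (deriv φ 0)⁻¹ with hα
  have hα0 : α ≠ 0 := inv_ne_zero hφd
  obtain ⟨C, hC⟩ := eventually_norm_inv_sub_le hφa hφ0 hφd
  -- near infinity, `f x = α x + O(1)`
  have hC' : ∀ᶠ t in 𝓝[≠] (0 : ℂ), ‖f t⁻¹ - α * t⁻¹‖ ≤ C := by
    filter_upwards [hC, nhdsWithin_le_nhds hs, self_mem_nhdsWithin] with t ht hst ht0
    rw [hi, param_of_ne _ ht0, coordInv_infty] at hst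
    have h1 : φ t = (f t⁻¹)⁻¹ := by simp only [hφ]; rw [hfv _ _ hst, coord_infty_coe]
    rw [h1, inv_inv] at ht
    exact ht
  obtain ⟨r, hr, hball⟩ := Metric.mem_nhdsWithin_iff.1 hC'
  have hlarge : ∀ x : ℂ, r⁻¹ < ‖x‖ → ‖f x - α * x‖ ≤ C := by
    intro x hx
    have hx0 : x ≠ 0 := by
      rintro rfl
      rw [norm_zero] at hx
      exact absurd hx (not_lt.2 (inv_nonneg.2 hr.le))
    have := @hball x⁻¹ ⟨mem_ball_zero_iff.2 (by
      rw [norm_inv]; exact inv_lt_of_inv_lt₀ hr hx), inv_ne_zero hx0⟩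
    simpa using this
  -- by injectivity, `f` is bounded away from infinity
  have hsmall : ∃ M, ∀ x ∉ F₀, ‖x‖ ≤ r⁻¹ → ‖f x‖ ≤ M := by
    have hN : {w | π w ∈ disc OnePoint.infty r} ∈ 𝓝 y₀ := by
      refine h.holomorphic.continuous.continuousAt.preimage_mem_nhds ?_
      rw [hi]
      exact (isOpen_disc _ _).mem_nhds (mem_disc_self _ hr)
    obtain ⟨ρ, hρ, hsub⟩ := eventually_disc _
      (h'.holomorphic.image_mem_nhds (h'.multiplicity_ne_top hG y₀) hN)
    refine ⟨ρ⁻¹, fun x hx hxr => ?_⟩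
    by_contra hlt
    rw [not_le] at hlt
    have hfx0 : f x ≠ 0 := by
      intro h0
      rw [h0, norm_zero] at hlt
      exact absurd hlt (not_lt.2 (inv_nonneg.2 hρ.le))
    obtain ⟨w, hw, hwx⟩ := hsub (show (f x : OnePoint ℂ) ∈ disc (π' y₀) ρ by
      rw [hi']
      refine ⟨by rw [pole_infty]; simpa [OnePoint.coe_eq_coe] using hfx0, ?_⟩
      rw [coord_infty_coe, norm_inv]
      exact inv_lt_of_inv_lt₀ hρ hlt)
    obtain ⟨y, hy, -⟩ := hreg x hx
    have h1 : π w = (x : OnePoint ℂ) := by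
      rw [← hy, hfib, hwx, hfv x y hy]
    have h2 : ‖coord OnePoint.infty (π w)‖ < r := hw.2
    rw [h1, coord_infty_coe, norm_inv] at h2
    have hx0 : x ≠ 0 := by
      rintro rfl
      have := hw.1
      rw [h1] at this
      exact this rfl
    have := inv_lt_of_inv_lt₀ (norm_pos_iff.2 hx0) h2
    linarith
  obtain ⟨M, hM⟩ := hsmall
  obtain ⟨β, hβ⟩ := exists_const_of_bounded hF₀fin (h := fun x => f x - α * x)
    (fun x hx => (hdiff x hx).sub (by fun_prop))
    ⟨max C (M + ‖α‖ * r⁻¹), fun x hx => by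
      by_cases hxr : ‖x‖ ≤ r⁻¹
      · refine le_trans ?_ (le_max_right _ _)
        refine (norm_sub_le _ _).trans (add_le_add (hM x hx hxr) ?_)
        rw [norm_mul]
        exact mul_le_mul_of_nonneg_left hxr (norm_nonneg _)
      · exact (hlarge x (not_le.1 hxr)).trans (le_max_left _ _)⟩
  set T := moebius α β 0 1 (by simpa using hα0) with hT
  refine ⟨T, ?_⟩
  have hdense := h.dense_preimage hG (hF.insert OnePoint.infty)
  have hcl : IsClosed {z | π' z = T • π z} :=
    isClosed_eq h'.holomorphic.continuous (h.holomorphic.smul T).continuous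
  have hsub : {z | π z ∉ insert OnePoint.infty F} ⊆ {z | π' z = T • π z} := by
    intro z hz
    rw [Set.mem_ofPred_eq, Set.mem_insert_iff, not_or] at hz
    obtain ⟨x, hx⟩ := OnePoint.ne_infty_iff_exists.1 hz.1
    have hx' : x ∉ F₀ := fun h => hz.2 (by rw [← hx]; exact h)
    rw [Set.mem_ofPred_eq, hfv x z hx.symm, ← hx, hT, moebius_coe, if_neg (by simp)]
    congr 1
    rw [← hβ x hx']
    simp
  intro z
  have := hcl.closure_subset_iff.2 hsub (hdense z)
  exact this

/-- Quotient maps of the same group differ by an automorphism of the sphere. -/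
theorem IsUniformizer.exists_smul_eq {G : Subgroup Aff} (hG : IsDiscreteGroup G)
    {π π' : ℂ → Sphere} (h : IsUniformizer G π) (h' : IsUniformizer G π') {σ : Signature}
    (hσ : IsCoveringWithSignature π σ) : ∃ T : GL (Fin 2) ℂ, ∀ z, π' z = T • π z := by
  classical
  obtain ⟨hr, hA, -⟩ := (h.isCoveringWithSignature_iff hG σ).1 hσ
  have hreg : ∀ x ∉ ((σ.A ∪ σ.B : Finset Sphere) : Set Sphere),
      ∃ y, π y = x ∧ (stab G y).ncard = 1 := by
    intro x hx
    rw [Finset.mem_coe, Finset.mem_union, not_or] at hx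
    have : x ∈ Set.range π := by rw [hr]; exact hx.2
    obtain ⟨y, rfl⟩ := this
    refine ⟨y, rfl, ?_⟩
    by_contra hne
    exact hx.1 ((hA y).2 hne)
  obtain ⟨x₀, hx₀⟩ := Infinite.exists_notMem_finset (σ.A ∪ σ.B)
  obtain ⟨y₀, hy₀, hs₀⟩ := hreg x₀ (by exact_mod_cast hx₀)
  obtain ⟨S, hS⟩ := exists_smul_eq_infty (π y₀)
  obtain ⟨S', hS'⟩ := exists_smul_eq_infty (π' y₀)
  obtain ⟨T, hT⟩ := IsUniformizer.exists_affine hG (h.smul S) (h'.smul S')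
    (F := (fun x : Sphere => S⁻¹ • x) ⁻¹' ((σ.A ∪ σ.B : Finset Sphere) : Set Sphere))
    ((σ.A ∪ σ.B).finite_toSet.preimage (MulAction.injective S⁻¹).injOn) (fun x hx => by
      obtain ⟨y, hy, hys⟩ := hreg _ hx
      exact ⟨y, by rw [hy, smul_inv_smul], hys⟩) hs₀ hS hS'
  refine ⟨S'⁻¹ * T * S, fun z => ?_⟩
  rw [mul_smul, mul_smul, ← hT z, inv_smul_smul]

/-! ### The signatures of a group -/

theorem isQuotientCovering_iff {G : Subgroup Aff} {π : ℂ → Sphere} {σ : Signature} :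
    IsQuotientCovering G π σ ↔ IsUniformizer G π ∧ IsCoveringWithSignature π σ :=
  ⟨fun h => ⟨⟨h.1.holomorphic, h.2⟩, h.1⟩, fun h => ⟨h.2, h.1.fibre⟩⟩

/-- The signatures of `G` are those equivalent to a given one. -/
theorem IsQuotientCovering.isSignatureOf_iff {G : Subgroup Aff} (hG : IsDiscreteGroup G)
    {π : ℂ → Sphere} {σ : Signature} (h : IsQuotientCovering G π σ) (σ' : Signature) :
    IsSignatureOf G σ' ↔ σ.Equivalent σ' := by
  obtain ⟨hu, hc⟩ := isQuotientCovering_iff.1 h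
  have hσ := (hu.isCoveringWithSignature_iff hG σ).1 hc
  constructor
  · rintro ⟨π', h'⟩
    obtain ⟨hu', hc'⟩ := isQuotientCovering_iff.1 h'
    have hσ' := (hu'.isCoveringWithSignature_iff hG σ').1 hc'
    obtain ⟨T, hT⟩ := hu.exists_smul_eq hG hu' hc
    have hrange : ∀ x ∈ σ.A, ∃ y, π y = x := by
      intro x hx
      have : x ∈ Set.range π := by rw [hσ.1]; exact Finset.disjoint_left.1 σ.disj hx
      exact this
    refine ⟨T, fun x => ⟨fun hx => ?_, fun hx => ?_⟩, fun x => not_iff_not.1 ?_, fun x hx => ?_⟩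
    · have : T • x ∈ Set.range π' := by rw [hσ'.1]; exact Finset.disjoint_left.1 σ'.disj hx
      obtain ⟨y, hy⟩ := this
      have hxy : x = π y := smul_left_cancel T (hy.symm.trans (hT y))
      rw [hxy, hσ.2.1, ← hσ'.2.1, hT, ← hxy]
      exact hx
    · obtain ⟨y, rfl⟩ := hrange x hx
      rw [← hT, hσ'.2.1, ← hσ.2.1]
      exact hx
    · have e1 : T • x ∉ σ'.B ↔ T • x ∈ Set.range π' := by rw [hσ'.1]; rfl
      have e2 : x ∉ σ.B ↔ x ∈ Set.range π := by rw [hσ.1]; rfl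
      rw [e1, e2]
      constructor
      · rintro ⟨y, hy⟩
        exact ⟨y, smul_left_cancel T ((hT y).symm.trans hy)⟩
      · rintro ⟨y, rfl⟩
        exact ⟨y, hT y⟩
    · obtain ⟨y, rfl⟩ := hrange x hx
      rw [← hT, hσ.2.2 y hx]
      refine hσ'.2.2 y ?_
      rw [hσ'.2.1, ← hσ.2.1]
      exact hx
  · rintro ⟨T, hA, hB, ho⟩
    refine ⟨fun z => T • π z, isQuotientCovering_iff.2 ⟨hu.smul T, ?_⟩⟩
    refine ((hu.smul T).isCoveringWithSignature_iff hG σ').2 ⟨?_, fun y => ?_, fun y hy => ?_⟩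
    · ext x
      rw [Set.mem_ofPred_eq, ← smul_inv_smul T x, hB]
      have e2 : T⁻¹ • x ∉ σ.B ↔ T⁻¹ • x ∈ Set.range π := by rw [hσ.1]; rfl
      rw [e2]
      constructor
      · rintro ⟨y, hy⟩
        exact ⟨y, smul_left_cancel T hy⟩
      · rintro ⟨y, hy⟩
        exact ⟨y, by simp only [hy]⟩
    · rw [hA, hσ.2.1]
    · rw [hA] at hy
      rw [ho _ hy, hσ.2.2 y hy]

theorem IsQuotientCovering.isUniversalCovering {G : Subgroup Aff} (hG : IsDiscreteGroup G)
    {π : ℂ → Sphere} {σ : Signature} (h : IsQuotientCovering G π σ) : IsUniversalCovering π σ :=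
  (isQuotientCovering_iff.1 h).1.isUniversalCovering hG h.1

theorem IsQuotientCovering.hasOrders {G : Subgroup Aff} (hG : IsDiscreteGroup G)
    {π : ℂ → Sphere} {σ : Signature} (h : IsQuotientCovering G π σ) {R : Multiset ℕ∞}
    (hR : σ.orders = R) (hcard : R.card ≤ 3) : HasOrders G R := by
  have hiff := h.isSignatureOf_iff hG
  refine ⟨fun σ' => ⟨fun h' => ?_, fun h' => ?_⟩, ⟨σ, π, h⟩, fun σ₁ σ₂ h₁ h₂ => ?_,
    fun π' σ' h' => h'.isUniversalCovering hG⟩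
  · rw [← ((hiff σ').1 h').orders_eq, hR]
  · rw [hiff]
    exact Signature.equivalent_of_orders_eq (hR.trans h'.symm) (hR ▸ hcard)
  · exact ((hiff σ₁).1 h₁).symm.trans ((hiff σ₂).1 h₂)

theorem IsQuotientCovering.hasFourPointSignature {G : Subgroup Aff} (hG : IsDiscreteGroup G)
    {π : ℂ → Sphere} {σ : Signature} (h : IsQuotientCovering G π σ)
    (hR : σ.orders = {2, 2, 2, 2}) : HasFourPointSignature G := by
  classical
  refine ⟨?_, fun π' σ' h' => h'.isUniversalCovering hG⟩
  have hord : ∀ a ∈ σ.A, σ.ord a = 2 := by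
    intro a ha
    have : (σ.ord a : ℕ∞) ∈ σ.orders := by
      rw [Signature.orders, Multiset.mem_add]
      exact Or.inl (Multiset.mem_map_of_mem _ ha)
    rw [hR] at this
    simp at this
    exact_mod_cast this
  have hB : σ.B = ∅ := by
    by_contra hne
    have : (⊤ : ℕ∞) ∈ σ.orders := by
      rw [Signature.orders, Multiset.mem_add]
      exact Or.inr (Multiset.mem_replicate.2 ⟨by simpa using hne, rfl⟩)
    rw [hR] at this
    simp at this
  have hA : σ.A.card = 4 := by
    have := congrArg Multiset.card hR
    rw [Signature.orders, hB] at this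
    simpa using this
  obtain ⟨a, b, c, d, hab, hac, had, hbc, hbd, hcd, hA'⟩ := Finset.card_eq_four.1 hA
  obtain ⟨T, hTa, hTb, hTc⟩ := exists_smul_standard hab hac hbc
  have hTd : T • d ≠ OnePoint.infty := by
    rw [← hTc]; exact fun h => hcd (smul_left_cancel T h).symm
  obtain ⟨l, hl⟩ := OnePoint.ne_infty_iff_exists.1 hTd
  have hl0 : l ≠ 0 := by
    rintro rfl
    exact had (smul_left_cancel T (hTa.trans hl))
  have hl1 : l ≠ 1 := by
    rintro rfl
    exact hbd (smul_left_cancel T (hTb.trans hl))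
  have heq : (fourPointSignature l).Equivalent σ := by
    refine fourPoint_equivalent_of hl0 hl1 hA hB hord T⁻¹ fun x hx => ?_
    rw [mem_fourPoint] at hx
    rw [hA']
    rcases hx with rfl | rfl | rfl | rfl
    · rw [← hTa, inv_smul_smul]; simp
    · rw [← hTb, inv_smul_smul]; simp
    · rw [← hTc, inv_smul_smul]; simp
    · rw [hl, inv_smul_smul]; simp
  refine ⟨l, hl0, hl1, fun σ' => ?_, fun l' h0 h1 => ?_⟩
  · rw [h.isSignatureOf_iff hG]
    exact ⟨heq.trans, heq.symm.trans⟩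
  · rw [h.isSignatureOf_iff hG]
    exact ⟨fun h' => crossRatioEquiv_of_equivalent hl0 hl1 h0 h1 (heq.trans h'),
      fun h' => heq.symm.trans (equivalent_of_crossRatioEquiv hl0 hl1 h')⟩

theorem IsUniformizer.ncard_stab_eq {G : Subgroup Aff} (hG : IsDiscreteGroup G)
    {π : ℂ → Sphere} (h : IsUniformizer G π) {y z : ℂ} (hyz : π y = π z) :
    (stab G y).ncard = (stab G z).ncard := by
  have h1 := h.localMonodromyOrder hG y
  rw [hyz] at h1
  exact h1.unique (h.localMonodromyOrder hG z)

/-- A quotient map by `G` has a signature, given by the finitely many orbits of points with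
nontrivial stabilizer. -/
theorem IsUniformizer.exists_signature {G : Subgroup Aff} (hG : IsDiscreteGroup G)
    {π : ℂ → Sphere} (h : IsUniformizer G π) (B : Finset Sphere)
    (hB : Set.range π = {x | x ∉ B}) (s : Finset ℂ)
    (hs : ∀ p ∈ s, (stab G p).ncard ≠ 1)
    (hs' : ∀ y, (stab G y).ncard ≠ 1 → ∃ p ∈ s, ∃ g ∈ G, g p = y)
    (hinj : ∀ p ∈ s, ∀ q ∈ s, (∃ g ∈ G, g p = q) → p = q) :
    ∃ σ : Signature, IsQuotientCovering G π σ ∧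
      σ.orders = s.val.map (fun p => ((stab G p).ncard : ℕ∞)) + Multiset.replicate B.card ⊤ := by
  classical
  have hstab : ∀ y z, π y = π z → (stab G y).ncard = (stab G z).ncard :=
    fun y z hyz => h.ncard_stab_eq hG hyz
  set o : Sphere → ℕ := fun x => if hx : ∃ y, π y = x then (stab G hx.choose).ncard else 0 with ho
  have hoπ : ∀ y, o (π y) = (stab G y).ncard := by
    intro y
    have hx : ∃ z, π z = π y := ⟨y, rfl⟩
    simp only [ho]
    rw [dif_pos hx]
    exact hstab _ _ hx.choose_spec
  have hinj' : Set.InjOn π s := fun p hp q hq hpq => hinj p hp q hq ((h.fibre p q).1 hpq)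
  have hmem : ∀ y, π y ∈ s.image π ↔ (stab G y).ncard ≠ 1 := by
    intro y
    rw [Finset.mem_image]
    constructor
    · rintro ⟨p, hp, hpy⟩
      rw [← hstab _ _ hpy]
      exact hs p hp
    · intro hy
      obtain ⟨p, hp, hpy⟩ := hs' y hy
      exact ⟨p, hp, (h.fibre p y).2 hpy⟩
  refine ⟨⟨s.image π, B, o, ?_, ?_⟩, isQuotientCovering_iff.2 ⟨h,
    (h.isCoveringWithSignature_iff hG _).2 ⟨hB, hmem, fun y _ => hoπ y⟩⟩, ?_⟩
  · rw [Finset.disjoint_left]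
    intro x hx
    obtain ⟨p, -, rfl⟩ := Finset.mem_image.1 hx
    have : π p ∈ {x | x ∉ B} := hB ▸ ⟨p, rfl⟩
    exact this
  · intro x hx
    obtain ⟨p, -, rfl⟩ := Finset.mem_image.1 hx
    rw [hoπ]
    have h1 := (hmem p).1 hx
    have h2 := hG.ncard_stab_pos p
    omega
  · rw [Signature.orders]
    simp only
    rw [Finset.image_val_of_injOn hinj', Multiset.map_map]
    congr 1
    refine Multiset.map_congr rfl fun p _ => ?_
    rw [Function.comp_apply, hoπ]

/-! ### Change of coordinate -/

theorem ncard_stab_conj {G H : Subgroup Aff} {φ : Aff}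
    (h : H = G.map (MulAut.conj φ).toMonoidHom) (y : ℂ) :
    (stab H (φ y)).ncard = (stab G y).ncard := by
  have : stab H (φ y) = (fun g => φ * g * φ⁻¹) '' stab G y := by
    ext g
    constructor
    · rintro ⟨hg, hgy⟩
      refine ⟨φ⁻¹ * g * φ, ⟨?_, ?_⟩, by simp [mul_assoc]⟩
      · rw [mem_of_conj h]
        simpa [mul_assoc] using hg
      · rw [mul_apply, mul_apply, hgy, inv_apply_apply]
    · rintro ⟨g, ⟨hg, hgy⟩, rfl⟩
      refine ⟨(mem_of_conj h g).1 hg, ?_⟩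
      rw [mul_apply, mul_apply, inv_apply_apply, hgy]
  rw [this]
  refine Set.InjOn.ncard_image fun g _ g' _ hgg' => ?_
  simpa using hgg'

theorem IsHolomorphic.comp_aff {π : ℂ → Sphere} (hπ : IsHolomorphic π) (φ : Aff) :
    IsHolomorphic fun z => π (φ z) := by
  intro z
  refine ⟨(hπ (φ z)).1.comp (continuous_aff φ).continuousAt, ?_⟩
  have hφ : AnalyticAt ℂ φ z := by
    have : (φ : ℂ → ℂ) = fun z => slope φ * z + φ 0 := funext (apply_eq φ)
    rw [this]; fun_prop
  exact AnalyticAt.fun_comp (g := fun w => coord (π (φ z)) (π w)) (hπ (φ z)).2 hφ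

theorem IsQuotientCovering.of_conj {G H : Subgroup Aff} (hH : IsDiscreteGroup H)
    (hc : AffConj G H) {π : ℂ → Sphere} {σ : Signature} (h : IsQuotientCovering H π σ) :
    ∃ π', IsQuotientCovering G π' σ := by
  have hG := hH.of_affConj hc
  obtain ⟨φ, hφ⟩ := hc
  obtain ⟨hu, hσ⟩ := isQuotientCovering_iff.1 h
  obtain ⟨hr, hA, ho⟩ := (hu.isCoveringWithSignature_iff hH σ).1 hσ
  have hu' : IsUniformizer G fun z => π (φ z) := by
    refine ⟨hu.holomorphic.comp_aff φ, fun z w => ?_⟩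
    rw [hu.fibre]
    constructor
    · rintro ⟨g, hg, hgz⟩
      refine ⟨φ⁻¹ * g * φ, ?_, ?_⟩
      · rw [mem_of_conj hφ]
        simpa [mul_assoc] using hg
      · rw [mul_apply, mul_apply, hgz, inv_apply_apply]
    · rintro ⟨g, hg, rfl⟩
      refine ⟨φ * g * φ⁻¹, (mem_of_conj hφ g).1 hg, ?_⟩
      rw [mul_apply, mul_apply, inv_apply_apply]
  refine ⟨_, isQuotientCovering_iff.2 ⟨hu', (hu'.isCoveringWithSignature_iff hG σ).2 ⟨?_, ?_, ?_⟩⟩⟩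
  · rw [← hr]
    exact φ.surjective.range_comp π
  · intro y
    rw [hA, ncard_stab_conj hφ]
  · intro y hy
    rw [ho _ hy, ncard_stab_conj hφ]

end AffineDiscrete

namespace AffineDiscrete

/-! ### Invariant maps of degree one -/

theorem isHolomorphic_at_of_eventually {π : ℂ → Sphere} {z : ℂ} {v : ℂ → ℂ}
    (hv : AnalyticAt ℂ v z) (h : ∀ᶠ w in 𝓝 z, π w = param (π z) (v w)) :
    (ContinuousAt π z ∧ AnalyticAt ℂ (fun w => coord (π z) (π w)) z) ∧
      multiplicity π z = analyticOrderAt v z := by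
  have heq : (fun w => coord (π z) (π w)) =ᶠ[𝓝 z] v := by
    filter_upwards [h] with w hw
    rw [hw, coord_param]
  refine ⟨⟨?_, hv.congr heq.symm⟩, analyticOrderAt_congr heq⟩
  refine ContinuousAt.congr ?_ (h.mono fun w hw => hw.symm)
  exact (continuous_param _).continuousAt.comp hv.continuousAt

/-- A holomorphic map of finite multiplicity at one point has finite multiplicity everywhere. -/
theorem IsHolomorphic.multiplicity_ne_top {π : ℂ → Sphere} (hπ : IsHolomorphic π) {y₀ : ℂ}
    (h0 : multiplicity π y₀ ≠ ⊤) (y : ℂ) : multiplicity π y ≠ ⊤ := by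
  have hiff : ∀ y, multiplicity π y = ⊤ ↔ ∀ᶠ z in 𝓝 y, π z = π y := by
    intro y
    rw [multiplicity, analyticOrderAt_eq_top]
    have hpole : ∀ᶠ z in 𝓝 y, π z ≠ pole (π y) :=
      (hπ y).1.eventually (isOpen_ne.mem_nhds (ne_pole (π y)))
    constructor
    · intro h
      filter_upwards [h, hpole] with z hz hz'
      exact (coord_eq_zero hz').1 hz
    · intro h
      filter_upwards [h] with z hz
      rw [hz, coord_self]
  have hopen : IsOpen {y | multiplicity π y = ⊤} := by
    rw [isOpen_iff_mem_nhds]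
    intro y hy
    have h1 := eventually_eventually_nhds.2 ((hiff y).1 hy)
    filter_upwards [h1, (hiff y).1 hy] with z hz hzy
    rw [hiff]
    filter_upwards [hz] with w hw
    rw [hw, hzy]
  have hclosed : IsClosed {y | multiplicity π y = ⊤} := by
    rw [← isOpen_compl_iff, isOpen_iff_mem_nhds]
    intro y hy
    obtain ⟨m, hm⟩ := ENat.ne_top_iff_exists.1 hy
    have hm0 : m ≠ 0 := by
      rintro rfl
      exact multiplicity_ne_zero hπ y (by simpa using hm.symm)
    obtain ⟨e, hye, hey, he⟩ := exists_local_chart hπ hm.symm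
    have hsrc := e.open_source.mem_nhds hye
    filter_upwards [hsrc] with z hz htop
    have h2 := (hiff z).1 htop
    -- `e w ^ m` would be constant near `z`, and so would be `e`
    have h3 : ∀ᶠ w in 𝓝 z, e w ^ m = e z ^ m := by
      filter_upwards [h2, e.open_source.mem_nhds hz] with w hw hw'
      rw [← (he w hw').2, ← (he z hz).2, hw]
    have h4 : ∀ᶠ t in 𝓝 (e z), t ^ m = e z ^ m := by
      have h5 := (e.tendsto_symm hz).eventually h3
      filter_upwards [h5, e.open_target.mem_nhds (e.map_source hz)] with t ht ht'
      rwa [e.right_inv ht'] at ht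
    have hfin : {t : ℂ | t ^ m = e z ^ m}.Finite := by
      refine (Polynomial.nthRoots m (e z ^ m)).toFinset.finite_toSet.subset fun a ha => ?_
      simpa [Polynomial.mem_nthRoots (Nat.pos_of_ne_zero hm0)] using ha
    exact infinite_of_mem_nhds _ h4 hfin
  intro htop
  have huniv := IsClopen.eq_univ ⟨hclosed, hopen⟩ ⟨y, htop⟩
  have : y₀ ∈ {y | multiplicity π y = ⊤} := huniv ▸ Set.mem_univ y₀
  exact h0 this

section DegreeOne

variable {G : Subgroup Aff} {π : ℂ → Sphere}

/-- If the fibre of `y` is a single orbit, counted with the right multiplicity, then the same is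
true of nearby fibres. -/
theorem exists_nhds_single_orbit (hG : IsDiscreteGroup G) (hπ : IsHolomorphic π)
    (hinv : ∀ g ∈ G, ∀ z, π (g z) = π z) {K : Set ℂ} (hK : IsCompact K)
    (hGK : ∀ z, ∃ g ∈ G, g z ∈ K) {y : ℂ} (hy : ∀ z, π z = π y → ∃ g ∈ G, g y = z)
    (hmult : multiplicity π y = ((stab G y).ncard : ℕ∞)) :
    ∃ N ∈ 𝓝 (π y), ∀ z w, π z ∈ N → π w = π z → ∃ g ∈ G, g z = w := by
  have hm := (hG.ncard_stab_pos y).ne'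
  obtain ⟨e, ρ, hc, -⟩ := exists_adaptedChart hG hπ hinv hmult Filter.univ_mem
  set W : Set ℂ := ⋃ g ∈ G, {z | g z ∈ e.source} with hW
  have hWo : IsOpen W := isOpen_biUnion fun g _ => e.open_source.preimage (continuous_aff g)
  have hcomp : IsCompact (π '' (K \ W)) := (hK.diff hWo).image hπ.continuous
  have hnot : π y ∉ π '' (K \ W) := by
    rintro ⟨z, ⟨-, hzW⟩, hz⟩
    obtain ⟨g, hg, rfl⟩ := hy z hz
    refine hzW ?_
    simp only [hW, Set.mem_iUnion]
    exact ⟨g⁻¹, G.inv_mem hg, by rw [Set.mem_ofPred_eq, inv_apply_apply]; exact hc.mem⟩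
  refine ⟨(π '' (K \ W))ᶜ, hcomp.isClosed.isOpen_compl.mem_nhds hnot, fun z w hz hw => ?_⟩
  have key : ∀ z, π z ∉ π '' (K \ W) → ∃ g ∈ G, g z ∈ e.source := by
    intro z hz
    obtain ⟨g, hg, hgK⟩ := hGK z
    have : g z ∈ W := by
      by_contra hgW
      exact hz ⟨g z, ⟨hgK, hgW⟩, hinv g hg z⟩
    simp only [hW, Set.mem_iUnion] at this
    obtain ⟨g', hg', hgz⟩ := this
    exact ⟨g' * g, G.mul_mem hg' hg, hgz⟩
  obtain ⟨g, hg, hgz⟩ := key z hz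
  obtain ⟨g', hg', hgw⟩ := key w (by rw [hw]; exact hz)
  obtain ⟨k, hk, hkz⟩ := hc.exists_of_eq hm hinv rfl hgw hgz (by
    rw [hinv g' hg', hinv g hg, hw])
  refine ⟨g'⁻¹ * k * g, G.mul_mem (G.mul_mem (G.inv_mem hg') hk) hg, ?_⟩
  rw [mul_apply, mul_apply, hkz, inv_apply_apply]

/-- A holomorphic map invariant under a group with compact quotient is the quotient map as soon
as one of its fibres is a single orbit, with multiplicity the order of the stabilizer; it is then
surjective. -/
theorem isUniformizer_of_single_orbit (hG : IsDiscreteGroup G) (hπ : IsHolomorphic π)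
    (hinv : ∀ g ∈ G, ∀ z, π (g z) = π z) {K : Set ℂ} (hK : IsCompact K)
    (hGK : ∀ z, ∃ g ∈ G, g z ∈ K) {y₀ : ℂ} (hy₀ : ∀ z, π z = π y₀ → ∃ g ∈ G, g y₀ = z)
    (hmult : multiplicity π y₀ = ((stab G y₀).ncard : ℕ∞)) :
    IsUniformizer G π ∧ Set.range π = Set.univ := by
  have htop : ∀ y, multiplicity π y ≠ ⊤ := hπ.multiplicity_ne_top (y₀ := y₀) (by
    rw [hmult]; exact ENat.natCast_ne_top _)
  have hrange : Set.range π = Set.univ := by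
    refine IsClopen.eq_univ ⟨?_, ?_⟩ ⟨π y₀, y₀, rfl⟩
    · have : Set.range π = π '' K := by
        refine Set.Subset.antisymm ?_ (Set.image_subset_range _ _)
        rintro _ ⟨z, rfl⟩
        obtain ⟨g, hg, hgK⟩ := hGK z
        exact ⟨g z, hgK, hinv g hg z⟩
      rw [this]
      exact (hK.image hπ.continuous).isClosed
    · rw [isOpen_iff_mem_nhds]
      rintro _ ⟨y, rfl⟩
      have := hπ.image_mem_nhds (htop y) Filter.univ_mem
      rwa [Set.image_univ] at this
  -- `D`: values taken on several orbits; `E`: values near which fibres are single orbits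
  set D : Set Sphere := {x | ∃ z w, π z = x ∧ π w = x ∧ ¬ ∃ g ∈ G, g z = w} with hD
  set E : Set Sphere := {x | ∃ N ∈ 𝓝 x, ∀ z w, π z ∈ N → π w = π z → ∃ g ∈ G, g z = w} with hE
  have hDE : Disjoint D E := by
    rw [Set.disjoint_left]
    rintro x ⟨z, w, rfl, hw, hne⟩ ⟨N, hN, h⟩
    exact hne (h z w (mem_of_mem_nhds hN) hw)
  have hDo : IsOpen D := by
    rw [isOpen_iff_mem_nhds]
    rintro _ ⟨z, w, rfl, hw, hne⟩
    obtain ⟨r, hr, hb⟩ := hG.exists_radius z w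
    have h1 := hπ.image_mem_nhds (htop z) (Metric.ball_mem_nhds z hr)
    have h2 := hπ.image_mem_nhds (htop w) (Metric.ball_mem_nhds w hr)
    rw [hw] at h2
    filter_upwards [h1, h2]
    rintro x ⟨z', hz', rfl⟩ ⟨w', hw', hwx⟩
    refine ⟨z', w', rfl, hwx, ?_⟩
    rintro ⟨g, hg, rfl⟩
    exact hne ⟨g, hg, hb g hg z' hz' hw'⟩
  have hEo : IsOpen E := by
    rw [isOpen_iff_mem_nhds]
    rintro x ⟨N, hN, h⟩
    filter_upwards [eventually_mem_nhds_iff.2 hN] with x' hx'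
    exact ⟨N, hx', h⟩
  have hEc : IsClosed E := by
    rw [← isOpen_compl_iff, isOpen_iff_mem_nhds]
    intro x hx
    by_cases hxD : x ∈ D
    · exact Filter.mem_of_superset (hDo.mem_nhds hxD) fun x' hx' => Set.disjoint_left.1 hDE hx'
    · obtain ⟨y, rfl⟩ : x ∈ Set.range π := hrange ▸ Set.mem_univ x
      have hy : ∀ z, π z = π y → ∃ g ∈ G, g y = z := by
        intro z hz
        by_contra hne
        exact hxD ⟨y, z, rfl, hz, hne⟩
      obtain ⟨m, hm⟩ := ENat.ne_top_iff_exists.1 (htop y)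
      have hm0 : m ≠ 0 := by
        rintro rfl
        exact multiplicity_ne_zero hπ y (by simpa using hm.symm)
      have hne : (stab G y).ncard ≠ m := by
        rintro h
        exact hx (exists_nhds_single_orbit hG hπ hinv hK hGK hy (by rw [h, hm]))
      obtain ⟨e, ρ, hc, -⟩ := exists_adaptedChart hG hπ hinv hm.symm Filter.univ_mem
      filter_upwards [(isOpen_disc (π y) (ρ ^ m)).mem_nhds
        (mem_disc_self _ (pow_pos hc.pos m))] with x' hx'
      by_cases hxy : x' = π y
      · rwa [hxy]
      · refine Set.disjoint_left.1 hDE ?_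
        obtain ⟨v, hv, rfl⟩ := hc.exists_of_mem_disc hm0 hx'
        by_contra hnD
        refine hne (hc.ncard_stab hm0 hinv hv (by rintro rfl; exact hxy rfl) fun u _ huv => ?_)
        by_contra hno
        exact hnD ⟨v, u, rfl, huv, hno⟩
  have hEu : E = Set.univ := IsClopen.eq_univ ⟨hEc, hEo⟩
    ⟨π y₀, exists_nhds_single_orbit hG hπ hinv hK hGK hy₀ hmult⟩
  refine ⟨⟨hπ, fun z w => ⟨fun hzw => ?_, ?_⟩⟩, hrange⟩
  · obtain ⟨N, hN, h⟩ : π z ∈ E := hEu ▸ Set.mem_univ _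
    exact h z w (mem_of_mem_nhds hN) hzw.symm
  · rintro ⟨g, hg, rfl⟩
    exact (hinv g hg z).symm

end DegreeOne

/-! ### Lattices -/

theorem mem_lattice_iff {c b : ℂ} : b ∈ lattice c ↔ ∃ m n : ℤ, b = m + n * c := by
  rw [lattice, AddSubgroup.mem_closure_pair]
  simp only [zsmul_eq_mul, mul_one, eq_comm]

theorem mem_integers_iff {b : ℂ} : b ∈ integers ↔ ∃ m : ℤ, b = m := by
  rw [integers, AddSubgroup.mem_closure_singleton]
  simp only [zsmul_eq_mul, mul_one, eq_comm]

/-- Real coordinates with respect to `1, c` are unique. -/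
theorem real_coords_unique {c : ℂ} (hc : c.im ≠ 0) {x y x' y' : ℝ}
    (h : (x + y * c : ℂ) = x' + y' * c) : x = x' ∧ y = y' := by
  have him := congrArg Complex.im h
  have hre := congrArg Complex.re h
  simp at him hre
  have hy : y = y' := by
    rcases him with h | h
    exacts [h, absurd h hc]
  subst hy
  exact ⟨by linarith, rfl⟩

theorem real_coords_exist {c : ℂ} (hc : c.im ≠ 0) (z : ℂ) : ∃ x y : ℝ, z = x + y * c := by
  refine ⟨z.re - z.im / c.im * c.re, z.im / c.im, ?_⟩
  apply Complex.ext
  · simp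
  · simp [hc]

theorem lattice_finite {c : ℂ} (hc : c.im ≠ 0) (r : ℝ) : {b | b ∈ lattice c ∧ ‖b‖ ≤ r}.Finite := by
  set N := ⌈r / |c.im|⌉ with hN
  set M := ⌈r + N * ‖c‖⌉ with hM
  refine ((Set.finite_Icc ((-M, -N) : ℤ × ℤ) (M, N)).image
    fun p : ℤ × ℤ => (p.1 + p.2 * c : ℂ)).subset ?_
  rintro b ⟨hb, hbr⟩
  obtain ⟨m, n, rfl⟩ := mem_lattice_iff.1 hb
  have him : |(n : ℝ)| * |c.im| ≤ r := by
    have := (Complex.abs_im_le_norm (m + n * c : ℂ)).trans hbr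
    simpa [abs_mul] using this
  have hn : |(n : ℝ)| ≤ N :=
    ((le_div_iff₀ (abs_pos.2 hc)).2 him).trans (Int.le_ceil _)
  have hm : |(m : ℝ)| ≤ M := by
    have h1 : ‖(m : ℂ)‖ ≤ ‖(m + n * c : ℂ)‖ + ‖(n * c : ℂ)‖ := by
      have : (m : ℂ) = (m + n * c) - n * c := by ring
      conv_lhs => rw [this]
      exact norm_sub_le _ _
    rw [Complex.norm_intCast, norm_mul, Complex.norm_intCast] at h1
    refine (h1.trans (add_le_add hbr ?_)).trans (Int.le_ceil _)
    exact mul_le_mul_of_nonneg_right hn (norm_nonneg _)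
  rw [abs_le] at hn hm
  refine ⟨(m, n), ⟨Prod.mk_le_mk.2 ⟨?_, ?_⟩, Prod.mk_le_mk.2 ⟨?_, ?_⟩⟩, rfl⟩
  · exact_mod_cast hm.1
  · exact_mod_cast hn.1
  · exact_mod_cast hm.2
  · exact_mod_cast hn.2

theorem exists_compact_lattice {c : ℂ} (hc : c.im ≠ 0) : ∃ K : Set ℂ, IsCompact K ∧
    ∀ z, ∃ b ∈ lattice c, z + b ∈ K := by
  refine ⟨(fun p : ℝ × ℝ => (p.1 + p.2 * c : ℂ)) '' (Set.Icc 0 1 ×ˢ Set.Icc 0 1),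
    (isCompact_Icc.prod isCompact_Icc).image (by fun_prop), fun z => ?_⟩
  obtain ⟨x, y, rfl⟩ := real_coords_exist hc z
  refine ⟨((-⌊x⌋ : ℤ) : ℂ) + ((-⌊y⌋ : ℤ) : ℂ) * c, mem_lattice_iff.2 ⟨_, _, rfl⟩,
    (Int.fract x, Int.fract y), ⟨⟨Int.fract_nonneg _, (Int.fract_lt_one _).le⟩,
      ⟨Int.fract_nonneg _, (Int.fract_lt_one _).le⟩⟩, ?_⟩
  simp only [Int.fract]
  push_cast
  ring

/-- The stabilizer of `y` in a group of the list, in terms of its rotational parts. -/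
theorem ncard_stab_affineGroup {k : ℕ} {Λ : AddSubgroup ℂ} {hk : 0 < k}
    {hΛ : ∀ a b : ℂ, a ^ k = 1 → b ∈ Λ → a * b ∈ Λ} (y : ℂ) :
    (stab (affineGroup k Λ hk hΛ) y).ncard = {a : ℂ | a ^ k = 1 ∧ (1 - a) * y ∈ Λ}.ncard := by
  have hb : Set.BijOn slope (stab (affineGroup k Λ hk hΛ) y)
      {a : ℂ | a ^ k = 1 ∧ (1 - a) * y ∈ Λ} := by
    refine ⟨?_, ?_, ?_⟩
    · rintro g ⟨hg, hgy⟩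
      rw [mem_affineGroup] at hg
      refine ⟨hg.1, ?_⟩
      have : (1 - slope g) * y = g 0 := by
        have := apply_eq g y
        rw [hgy] at this
        linear_combination this
      rw [this]
      exact hg.2
    · rintro g ⟨-, hgy⟩ g' ⟨-, hgy'⟩ h
      refine aff_ext h ?_
      have h1 := apply_eq g y
      have h2 := apply_eq g' y
      rw [hgy] at h1
      rw [hgy', ← h] at h2
      linear_combination h2 - h1
    · rintro a ⟨ha, hay⟩
      refine ⟨mkAff a ((1 - a) * y) (ne_zero_of_pow_eq_one hk ha),
        ⟨mkAff_mem_affineGroup _ ha hay, ?_⟩, ?_⟩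
      · rw [mkAff_apply]; ring
      · exact slope_eq_of_apply fun z => mkAff_apply _ _ _ z
  rw [← hb.image_eq, hb.injOn.ncard_image]

theorem ncard_stab_affineGroup_zero {k : ℕ} {Λ : AddSubgroup ℂ} {hk : 0 < k}
    {hΛ : ∀ a b : ℂ, a ^ k = 1 → b ∈ Λ → a * b ∈ Λ} :
    (stab (affineGroup k Λ hk hΛ) 0).ncard = k := by
  rw [ncard_stab_affineGroup]
  simp only [mul_zero, Λ.zero_mem, and_true]
  exact ncard_roots hk.ne'

theorem exists_root_of_ncard_stab_ne_one {k : ℕ} {Λ : AddSubgroup ℂ} {hk : 0 < k}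
    {hΛ : ∀ a b : ℂ, a ^ k = 1 → b ∈ Λ → a * b ∈ Λ} {y : ℂ}
    (h : (stab (affineGroup k Λ hk hΛ) y).ncard ≠ 1) :
    ∃ a : ℂ, a ≠ 1 ∧ a ^ k = 1 ∧ (1 - a) * y ∈ Λ := by
  by_contra hne
  push Not at hne
  refine h ?_
  rw [ncard_stab_affineGroup, Set.ncard_eq_one]
  refine ⟨1, Set.eq_singleton_iff_unique_mem.2 ⟨⟨one_pow k, by simp⟩, fun a ha => ?_⟩⟩
  by_contra ha1
  exact hne a ha1 ha.1 ha.2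

/-! ### Elliptic functions as maps to the sphere -/

open Classical in
/-- The map to the sphere defined by a meromorphic function `f` with poles at the points of `Λ`. -/
noncomputable def ellipticMap (Λ : AddSubgroup ℂ) (f : ℂ → ℂ) (z : ℂ) : Sphere :=
  if z ∈ Λ then OnePoint.infty else (f z : OnePoint ℂ)

/-- A meromorphic function on `ℂ / Λ`, invariant under the roots of unity of order `k`, whose only
pole is a pole of order `k` at the origin, realizes the quotient by the group of transformations
`z ↦ a z + b`, `a ^ k = 1`, `b ∈ Λ`. -/
theorem isUniformizer_ellipticMap {k : ℕ} {c : ℂ} (hc : c.im ≠ 0) (hk : 0 < k)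
    (hΛ : ∀ a b : ℂ, a ^ k = 1 → b ∈ lattice c → a * b ∈ lattice c) {f u : ℂ → ℂ}
    (hf : ∀ z ∉ lattice c, AnalyticAt ℂ f z) (hper : ∀ z, ∀ b ∈ lattice c, f (z + b) = f z)
    (hrot : ∀ a : ℂ, a ^ k = 1 → ∀ z, f (a * z) = f z) (hu : AnalyticAt ℂ u 0) (hu0 : u 0 ≠ 0)
    (hfu : ∀ᶠ z in 𝓝[≠] 0, f z = u z / z ^ k) :
    IsUniformizer (affineGroup k (lattice c) hk hΛ) (ellipticMap (lattice c) f) ∧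
      Set.range (ellipticMap (lattice c) f) = Set.univ := by
  classical
  have hG : IsDiscreteGroup (affineGroup k (lattice c) hk hΛ) :=
    isDiscreteGroup_affineGroup (lattice_finite hc)
  have hin : ∀ z ∈ lattice c, ellipticMap (lattice c) f z = OnePoint.infty := fun z hz => if_pos hz
  have hout : ∀ z ∉ lattice c, ellipticMap (lattice c) f z = (f z : OnePoint ℂ) :=
    fun z hz => if_neg hz
  have hinv : ∀ g ∈ affineGroup k (lattice c) hk hΛ, ∀ z,
      ellipticMap (lattice c) f (g z) = ellipticMap (lattice c) f z := by
    rintro g ⟨a, b, ha, hb, hg⟩ z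
    have hiff : g z ∈ lattice c ↔ z ∈ lattice c := by
      rw [hg]
      constructor
      · intro h
        have h1 := (lattice c).sub_mem h hb
        rw [add_sub_cancel_right] at h1
        have ha0 := ne_zero_of_pow_eq_one hk ha
        have := hΛ a⁻¹ _ (by rw [inv_pow, ha, inv_one]) h1
        rwa [inv_mul_cancel_left₀ ha0] at this
      · exact fun h => (lattice c).add_mem (hΛ a z ha h) hb
    by_cases hz : z ∈ lattice c
    · rw [hin _ hz, hin _ (hiff.2 hz)]
    · rw [hout _ hz, hout _ (fun h => hz (hiff.1 h)), hg, hper _ _ hb, hrot a ha]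
  -- lattice points are isolated
  have hiso : ∀ z, ∀ᶠ w in 𝓝[≠] z, w ∉ lattice c := by
    intro z
    have hfin := lattice_finite hc (‖z‖ + 1)
    have h1 : ({b | b ∈ lattice c ∧ ‖b‖ ≤ ‖z‖ + 1} \ {z})ᶜ ∈ 𝓝 z :=
      (hfin.subset Set.sdiff_subset).isClosed.isOpen_compl.mem_nhds (by simp)
    filter_upwards [nhdsWithin_le_nhds h1, nhdsWithin_le_nhds (Metric.ball_mem_nhds z one_pos),
      self_mem_nhdsWithin] with w hw hwb hwz hwΛ
    refine hw ⟨⟨hwΛ, ?_⟩, hwz⟩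
    have := norm_sub_norm_le w z
    rw [Metric.mem_ball, dist_eq_norm] at hwb
    linarith
  have hpoint : ∀ z ∈ lattice c, (ContinuousAt (ellipticMap (lattice c) f) z ∧
      AnalyticAt ℂ (fun w => coord (ellipticMap (lattice c) f z) (ellipticMap (lattice c) f w)) z) ∧
      multiplicity (ellipticMap (lattice c) f) z = k := by
    intro z hz
    set v : ℂ → ℂ := fun w => (w - z) ^ k * (u (w - z))⁻¹ with hv
    have hua : AnalyticAt ℂ (fun w => (u (w - z))⁻¹) z := by
      refine AnalyticAt.inv (AnalyticAt.fun_comp (g := u) ?_ (by fun_prop)) ?_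
      · rwa [sub_self]
      · rwa [sub_self]
    have hva : AnalyticAt ℂ v z := by fun_prop
    have hv0 : v z = 0 := by simp [hv, hk.ne']
    have hord : analyticOrderAt v z = k := by
      rw [hva.analyticOrderAt_eq_natCast]
      refine ⟨fun w => (u (w - z))⁻¹, hua, ?_, Filter.Eventually.of_forall fun w => rfl⟩
      change (u (z - z))⁻¹ ≠ 0
      rw [sub_self]
      exact inv_ne_zero hu0
    have htend : Filter.Tendsto (fun w => w - z) (𝓝 z) (𝓝 0) := by
      have : ContinuousAt (fun w => w - z) z := by fun_prop
      simpa [ContinuousAt] using this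
    have htend' : Filter.Tendsto (fun w => w - z) (𝓝[≠] z) (𝓝[≠] 0) := by
      refine tendsto_nhdsWithin_iff.2 ⟨htend.mono_left nhdsWithin_le_nhds, ?_⟩
      filter_upwards [self_mem_nhdsWithin] with w hw
      exact sub_ne_zero.2 hw
    have hune : ∀ᶠ w in 𝓝 z, u (w - z) ≠ 0 :=
      htend.eventually (hu.continuousAt.eventually (isOpen_ne.mem_nhds hu0))
    have hev : ∀ᶠ w in 𝓝[≠] z, ellipticMap (lattice c) f w =
        param (ellipticMap (lattice c) f z) (v w) := by
      filter_upwards [hiso z, htend'.eventually hfu, nhdsWithin_le_nhds hune, self_mem_nhdsWithin]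
        with w hw hfw huw hwz
      have hwz' : w - z ≠ 0 := sub_ne_zero.2 hwz
      have hvw : v w ≠ 0 := mul_ne_zero (pow_ne_zero _ hwz') (inv_ne_zero huw)
      rw [hout w hw, hin z hz, param_of_ne _ hvw, coordInv_infty]
      congr 1
      have h1 := hper (w - z) z hz
      rw [sub_add_cancel] at h1
      rw [h1, hfw, hv]
      field_simp
    rw [← hord]
    refine isHolomorphic_at_of_eventually hva ?_
    rw [eventually_nhdsWithin_iff] at hev
    filter_upwards [hev] with w hw
    by_cases hwz : w = z
    · rw [hwz, hv0, param_zero]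
    · exact hw hwz
  have hhol : IsHolomorphic (ellipticMap (lattice c) f) := by
    intro z
    by_cases hz : z ∈ lattice c
    · exact (hpoint z hz).1
    · have hv : AnalyticAt ℂ (fun w => f w - f z) z := (hf z hz).sub analyticAt_const
      refine (isHolomorphic_at_of_eventually hv ?_).1
      have hev := hiso z
      rw [eventually_nhdsWithin_iff] at hev
      filter_upwards [hev] with w hw
      have hw' : w ∉ lattice c := by
        by_cases hwz : w = z
        · rwa [hwz]
        · exact hw hwz
      rw [hout w hw', hout z hz, param_coe, add_sub_cancel]
  obtain ⟨K, hK, hKc⟩ := exists_compact_lattice hc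
  refine isUniformizer_of_single_orbit hG hhol hinv hK (fun z => ?_) (y₀ := 0) (fun z hz => ?_) ?_
  · obtain ⟨b, hb, hbK⟩ := hKc z
    exact ⟨mkAff 1 b one_ne_zero, mkAff_mem_affineGroup _ (one_pow k) hb, by
      rw [mkAff_apply, one_mul]; exact hbK⟩
  · rw [hin 0 (lattice c).zero_mem] at hz
    have hzΛ : z ∈ lattice c := by
      by_contra hne
      rw [hout z hne] at hz
      exact OnePoint.coe_ne_infty _ hz
    exact ⟨mkAff 1 z one_ne_zero, mkAff_mem_affineGroup _ (one_pow k) hzΛ, by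
      rw [mkAff_apply]; ring⟩
  · rw [ncard_stab_affineGroup_zero]
    exact (hpoint 0 (lattice c).zero_mem).2

/-! ### The functions `℘` and `℘'` -/

/-- The pair of periods `1, c`. -/
noncomputable def periods (c : ℂ) (hc : c.im ≠ 0) : PeriodPair where
  ω₁ := 1
  ω₂ := c
  indep := by
    rw [LinearIndependent.pair_iff]
    intro s t h
    have := real_coords_unique hc (x := s) (y := t) (x' := 0) (y' := 0) (by
      simpa using h)
    exact this

theorem mem_periods_lattice {c : ℂ} {hc : c.im ≠ 0} {z : ℂ} :
    z ∈ (periods c hc).lattice ↔ z ∈ lattice c := by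
  rw [PeriodPair.mem_lattice, mem_lattice_iff]
  simp only [periods, mul_one, eq_comm]

section Weierstrass

variable {c : ℂ} (hc : c.im ≠ 0)

theorem lattice_smul_bijective {a : ℂ} (ha0 : a ≠ 0)
    (ha : ∀ b, b ∈ lattice c ↔ a * b ∈ lattice c) : Function.Bijective
      (fun l : (periods c hc).lattice =>
        (⟨a * l, mem_periods_lattice.2 ((ha l).1 (mem_periods_lattice.1 l.2))⟩ :
          (periods c hc).lattice)) := by
  constructor
  · intro l l' h
    exact Subtype.ext (mul_left_cancel₀ ha0 (congrArg Subtype.val h))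
  · rintro ⟨l, hl⟩
    refine ⟨⟨a⁻¹ * l, mem_periods_lattice.2 ((ha _).2 ?_)⟩, Subtype.ext ?_⟩
    · rw [mul_inv_cancel_left₀ ha0]
      exact mem_periods_lattice.1 hl
    · exact mul_inv_cancel_left₀ ha0 l

/-- `℘` is homogeneous of degree `-2` under rotations preserving the lattice. -/
theorem weierstrassP_mul {a : ℂ} (ha0 : a ≠ 0) (ha : ∀ b, b ∈ lattice c ↔ a * b ∈ lattice c)
    (z : ℂ) : (periods c hc).weierstrassP (a * z) = (a ^ 2)⁻¹ * (periods c hc).weierstrassP z := by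
  rw [PeriodPair.weierstrassP, PeriodPair.weierstrassP, ← tsum_mul_left,
    ← (Equiv.ofBijective _ (lattice_smul_bijective hc ha0 ha)).tsum_eq]
  refine tsum_congr fun l => ?_
  simp only [Equiv.ofBijective_apply]
  rw [← mul_sub, mul_pow, mul_pow, mul_sub, one_div, one_div, one_div, one_div, mul_inv, mul_inv]

/-- `℘'` is homogeneous of degree `-3` under rotations preserving the lattice. -/
theorem derivWeierstrassP_mul {a : ℂ} (ha0 : a ≠ 0)
    (ha : ∀ b, b ∈ lattice c ↔ a * b ∈ lattice c) (z : ℂ) :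
    (periods c hc).derivWeierstrassP (a * z) =
      (a ^ 3)⁻¹ * (periods c hc).derivWeierstrassP z := by
  rw [PeriodPair.derivWeierstrassP, PeriodPair.derivWeierstrassP, mul_neg, ← tsum_mul_left,
    ← (Equiv.ofBijective _ (lattice_smul_bijective hc ha0 ha)).tsum_eq]
  refine congrArg _ (tsum_congr fun l => ?_)
  simp only [Equiv.ofBijective_apply]
  rw [← mul_sub, mul_pow, div_eq_mul_inv, div_eq_mul_inv, mul_inv]
  ring

theorem mem_iff_mul_mem {k : ℕ} (hk : 0 < k)
    (hΛ : ∀ a b : ℂ, a ^ k = 1 → b ∈ lattice c → a * b ∈ lattice c) {a : ℂ} (ha : a ^ k = 1)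
    (b : ℂ) : b ∈ lattice c ↔ a * b ∈ lattice c := by
  refine ⟨hΛ a b ha, fun h => ?_⟩
  have := hΛ a⁻¹ _ (by rw [inv_pow, ha, inv_one]) h
  rwa [inv_mul_cancel_left₀ (ne_zero_of_pow_eq_one hk ha)] at this

theorem weierstrassP_analyticAt {z : ℂ} (hz : z ∉ lattice c) :
    AnalyticAt ℂ (periods c hc).weierstrassP z :=
  (periods c hc).analyticOnNhd_weierstrassP z fun h => hz (mem_periods_lattice.1 h)

theorem derivWeierstrassP_analyticAt {z : ℂ} (hz : z ∉ lattice c) :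
    AnalyticAt ℂ (periods c hc).derivWeierstrassP z :=
  (periods c hc).analyticOnNhd_derivWeierstrassP z fun h => hz (mem_periods_lattice.1 h)

theorem weierstrassP_pole : ∃ u : ℂ → ℂ, AnalyticAt ℂ u 0 ∧ u 0 = 1 ∧
    ∀ᶠ z in 𝓝[≠] 0, (periods c hc).weierstrassP z = u z / z ^ 2 := by
  refine ⟨fun z => z ^ 2 * (periods c hc).weierstrassPExcept 0 z + 1, ?_, by simp, ?_⟩
  · have := (periods c hc).analyticAt_weierstrassPExcept 0
    fun_prop
  · filter_upwards [self_mem_nhdsWithin] with z hz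
    have hz0 : z ≠ 0 := hz
    have h := (periods c hc).weierstrassPExcept_add 0 z
    rw [← h]
    simp
    field_simp

theorem derivWeierstrassP_pole : ∃ u : ℂ → ℂ, AnalyticAt ℂ u 0 ∧ u 0 = -2 ∧
    ∀ᶠ z in 𝓝[≠] 0, (periods c hc).derivWeierstrassP z = u z / z ^ 3 := by
  refine ⟨fun z => z ^ 3 * (periods c hc).derivWeierstrassPExcept 0 z - 2, ?_, by simp, ?_⟩
  · have := (periods c hc).analyticAt_derivWeierstrassPExcept 0
    fun_prop
  · filter_upwards [self_mem_nhdsWithin] with z hz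
    have hz0 : z ≠ 0 := hz
    have h := (periods c hc).derivWeierstrassPExcept_sub 0 z
    rw [← h]
    simp
    field_simp

end Weierstrass

/-- Powers of `℘` realize the quotients by groups whose rotations have even order. -/
theorem exists_uniformizer_even {c : ℂ} (hc : c.im ≠ 0) {n : ℕ} (hk : 0 < 2 * n)
    (hΛ : ∀ a b : ℂ, a ^ (2 * n) = 1 → b ∈ lattice c → a * b ∈ lattice c) :
    ∃ π, IsUniformizer (affineGroup (2 * n) (lattice c) hk hΛ) π ∧ Set.range π = Set.univ := by
  obtain ⟨u, hu, hu0, hfu⟩ := weierstrassP_pole hc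
  refine ⟨_, isUniformizer_ellipticMap hc hk hΛ (f := fun z => (periods c hc).weierstrassP z ^ n)
    (u := fun z => u z ^ n) (fun z hz => (weierstrassP_analyticAt hc hz).pow n) (fun z b hb => ?_)
    (fun a ha z => ?_) (hu.pow n) (by simp [hu0]) ?_⟩
  · rw [(periods c hc).weierstrassP_add_coe z ⟨b, mem_periods_lattice.2 hb⟩]
  · rw [weierstrassP_mul hc (ne_zero_of_pow_eq_one hk ha) (mem_iff_mul_mem hk hΛ ha), mul_pow,
      inv_pow, ← pow_mul, ha, inv_one, one_mul]
  · filter_upwards [hfu] with z hz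
    rw [hz, div_pow, ← pow_mul]

/-- The function `℘'` realizes the quotient by the group whose rotations have order three. -/
theorem exists_uniformizer_three {c : ℂ} (hc : c.im ≠ 0)
    (hΛ : ∀ a b : ℂ, a ^ 3 = 1 → b ∈ lattice c → a * b ∈ lattice c) :
    ∃ π, IsUniformizer (affineGroup 3 (lattice c) three_pos hΛ) π ∧
      Set.range π = Set.univ := by
  obtain ⟨u, hu, hu0, hfu⟩ := derivWeierstrassP_pole hc
  refine ⟨_, isUniformizer_ellipticMap hc three_pos hΛ (f := (periods c hc).derivWeierstrassP)
    (u := u) (fun z hz => derivWeierstrassP_analyticAt hc hz) (fun z b hb => ?_)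
    (fun a ha z => ?_) hu (by simp [hu0]) hfu⟩
  · rw [(periods c hc).derivWeierstrassP_add_coe z ⟨b, mem_periods_lattice.2 hb⟩]
  · rw [derivWeierstrassP_mul hc (ne_zero_of_pow_eq_one three_pos ha)
      (mem_iff_mul_mem three_pos hΛ ha), ha, inv_one, one_mul]

end AffineDiscrete

namespace AffineDiscrete

/-! ### Membership in lattices and roots of unity of small order -/

/-- A point of the lattice with a common denominator `N` of its coordinates. -/
theorem mem_lattice_iff_dvd {c : ℂ} (hc : c.im ≠ 0) {z : ℂ} (p q N : ℤ) (hN : N ≠ 0)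
    (h : N * z = p + q * c) : z ∈ lattice c ↔ N ∣ p ∧ N ∣ q := by
  have hN' : (N : ℂ) ≠ 0 := Int.cast_ne_zero.2 hN
  rw [mem_lattice_iff]
  constructor
  · rintro ⟨m, n, rfl⟩
    have := real_coords_unique hc (x := p) (y := q) (x' := N * m) (y' := N * n) (by
      push_cast; rw [← h]; ring)
    exact ⟨⟨m, by exact_mod_cast this.1⟩, ⟨n, by exact_mod_cast this.2⟩⟩
  · rintro ⟨⟨m, rfl⟩, ⟨n, rfl⟩⟩
    refine ⟨m, n, mul_left_cancel₀ hN' ?_⟩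
    rw [h]; push_cast; ring

theorem one_mem_lattice {c : ℂ} : (1 : ℂ) ∈ lattice c := AddSubgroup.subset_closure (by simp)

theorem self_mem_lattice {c : ℂ} : c ∈ lattice c := AddSubgroup.subset_closure (by simp)

theorem mem_lattice_of_mem_integers {c b : ℂ} (hb : b ∈ integers) : b ∈ lattice c := by
  obtain ⟨m, rfl⟩ := mem_integers_iff.1 hb
  exact mem_lattice_iff.2 ⟨m, 0, by simp⟩

theorem integers_finite (r : ℝ) : {b | b ∈ integers ∧ ‖b‖ ≤ r}.Finite :=
  (lattice_finite (c := Complex.I) (by simp) r).subset fun _ hb =>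
    ⟨mem_lattice_of_mem_integers hb.1, hb.2⟩

theorem tau6_im_ne_zero : tau6.im ≠ 0 := by
  intro h
  have h1 := congrArg Complex.re tau6_sq
  simp [h] at h1
  nlinarith [sq_nonneg (tau6.re - 1 / 2)]

theorem eq_of_sq_eq_one {a : ℂ} (h : a ^ 2 = 1) : a = 1 ∨ a = -1 :=
  sq_eq_one_iff.1 h

theorem eq_of_pow_four_eq_one {a : ℂ} (h : a ^ 4 = 1) :
    a = 1 ∨ a = -1 ∨ a = Complex.I ∨ a = -Complex.I := by
  have : (a - 1) * ((a + 1) * ((a - Complex.I) * (a + Complex.I))) = 0 := by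
    linear_combination h - (a ^ 2 - 1) * Complex.I_mul_I
  simpa [sub_eq_zero, add_eq_zero_iff_eq_neg] using this

theorem eq_of_pow_three_eq_one {a : ℂ} (h : a ^ 3 = 1) :
    a = 1 ∨ a = tau6 - 1 ∨ a = -tau6 := by
  have : (a - 1) * ((a - (tau6 - 1)) * (a + tau6)) = 0 := by
    linear_combination h - (a - 1) * tau6_sq
  simpa only [mul_eq_zero, sub_eq_zero, add_eq_zero_iff_eq_neg] using this

theorem eq_of_pow_six_eq_one {a : ℂ} (h : a ^ 6 = 1) :
    (a = 1 ∨ a = tau6 - 1 ∨ a = -tau6) ∨ a = -1 ∨ a = tau6 ∨ a = 1 - tau6 := by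
  have : (a ^ 3 - 1) * (a ^ 3 + 1) = 0 := by linear_combination h
  rcases mul_eq_zero.1 this with h | h
  · exact Or.inl (eq_of_pow_three_eq_one (sub_eq_zero.1 h))
  · right
    have : (a + 1) * ((a - tau6) * (a - (1 - tau6))) = 0 := by
      linear_combination h - (a + 1) * tau6_sq
    simpa only [mul_eq_zero, sub_eq_zero, add_eq_zero_iff_eq_neg] using this

/-! ### Orders of stabilizers and orbits in the groups of the list -/

section Stabilizers

variable {k : ℕ} {Λ : AddSubgroup ℂ} {hk : 0 < k}
  {hΛ : ∀ a b : ℂ, a ^ k = 1 → b ∈ Λ → a * b ∈ Λ}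

theorem ncard_stab_eq_of_forall {r : ℕ} (hr : r ≠ 0) (hrk : r ∣ k) {y : ℂ}
    (h : ∀ a : ℂ, a ^ k = 1 → ((1 - a) * y ∈ Λ ↔ a ^ r = 1)) :
    (stab (affineGroup k Λ hk hΛ) y).ncard = r := by
  rw [ncard_stab_affineGroup, ← ncard_roots hr]
  congr 1
  ext a
  refine ⟨fun ha => (h a ha.1).1 ha.2, fun ha => ?_⟩
  have hak : a ^ k = 1 := by
    obtain ⟨d, rfl⟩ := hrk
    have ha' : a ^ r = 1 := ha
    rw [pow_mul, ha', one_pow]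
  exact ⟨hak, (h a hak).2 ha⟩

/-- A point fixed, modulo translations, by all rotations of the group has an orbit consisting of
its translates. -/
theorem sub_mem_of_fixed {p q : ℂ} (h : ∀ a : ℂ, a ^ k = 1 → (1 - a) * p ∈ Λ)
    (hpq : ∃ g ∈ affineGroup k Λ hk hΛ, g p = q) : q - p ∈ Λ := by
  obtain ⟨a, ha, hq⟩ := exists_mem_affineGroup.1 hpq
  have := Λ.sub_mem hq (h a ha)
  rwa [show q - a * p - (1 - a) * p = q - p by ring] at this

end Stabilizers

/-! ### Quotients by groups preserving a point or a line -/

theorem isHolomorphic_coe {f : ℂ → ℂ} (hf : ∀ z, AnalyticAt ℂ f z) :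
    IsHolomorphic fun z => (f z : OnePoint ℂ) := by
  intro z
  refine (isHolomorphic_at_of_eventually (v := fun w => f w - f z)
    ((hf z).sub analyticAt_const) (Filter.Eventually.of_forall fun w => ?_)).1
  rw [param_coe, add_sub_cancel]

theorem range_coe_of_surjective {f : ℂ → ℂ} (hf : Function.Surjective f) :
    Set.range (fun z => (f z : OnePoint ℂ)) =
      {x | x ∉ ({OnePoint.infty} : Finset (OnePoint ℂ))} := by
  ext x
  simp only [Set.mem_range, Finset.mem_singleton, Set.mem_ofPred_eq]
  constructor
  · rintro ⟨z, rfl⟩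
    exact OnePoint.coe_ne_infty _
  · intro hx
    obtain ⟨y, rfl⟩ := OnePoint.ne_infty_iff_exists.1 hx
    obtain ⟨z, rfl⟩ := hf y
    exact ⟨z, rfl⟩

theorem isDiscreteGroup_rotations (k : ℕ) (hk : 0 < k) : IsDiscreteGroup (rotations k hk) :=
  isDiscreteGroup_affineGroup fun _ =>
    (Set.finite_singleton (0 : ℂ)).subset fun _ hb => AddSubgroup.mem_bot.1 hb.1

/-- The map `z ↦ z ^ k`. -/
theorem isUniformizer_pow {k : ℕ} (hk : 0 < k) :
    IsUniformizer (rotations k hk) fun z => ((z ^ k : ℂ) : OnePoint ℂ) := by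
  refine ⟨isHolomorphic_coe fun z => by fun_prop, fun z w => ?_⟩
  rw [OnePoint.coe_eq_coe, rotations, exists_mem_affineGroup]
  constructor
  · intro h
    by_cases hz : z = 0
    · have hw : w = 0 := by
        rw [hz, zero_pow hk.ne'] at h
        exact eq_zero_of_pow_eq_zero h.symm
      exact ⟨1, one_pow k, by simp [hz, hw]⟩
    · refine ⟨w / z, ?_, ?_⟩
      · rw [div_pow, ← h, div_self (pow_ne_zero k hz)]
      · rw [div_mul_cancel₀ _ hz, sub_self]
        exact AddSubgroup.zero_mem _
  · rintro ⟨a, ha, h⟩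
    rw [AddSubgroup.mem_bot, sub_eq_zero] at h
    rw [h, mul_pow, ha, one_mul]

theorem exists_signature_rotations {k : ℕ} (hk : 0 < k) :
    ∃ π σ, IsQuotientCovering (rotations k hk) π σ ∧
      σ.orders = if k = 1 then {⊤} else {(k : ℕ∞), ⊤} := by
  have hrange := range_coe_of_surjective (f := fun z : ℂ => z ^ k)
    fun y => IsAlgClosed.exists_pow_nat_eq y hk
  have hstab : ∀ y, (stab (rotations k hk) y).ncard ≠ 1 → y = 0 := by
    intro y hy
    obtain ⟨a, ha, -, h⟩ := exists_root_of_ncard_stab_ne_one hy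
    rw [AddSubgroup.mem_bot, mul_eq_zero, sub_eq_zero] at h
    exact h.resolve_left (Ne.symm ha)
  have h0 : (stab (rotations k hk) 0).ncard = k := ncard_stab_affineGroup_zero
  have hu := isUniformizer_pow hk
  by_cases h1 : k = 1
  · obtain ⟨σ, hσ, ho⟩ := hu.exists_signature (isDiscreteGroup_rotations k hk) _ hrange ∅
      (by simp) (fun y hy => absurd (hstab y hy ▸ h0.trans h1) hy) (by simp)
    refine ⟨_, σ, hσ, ?_⟩
    rw [ho, if_pos h1]
    rfl
  · obtain ⟨σ, hσ, ho⟩ := hu.exists_signature (isDiscreteGroup_rotations k hk) _ hrange {0}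
      (fun p hp => by rw [Finset.mem_singleton.1 hp, h0]; exact h1)
      (fun y hy => ⟨0, by simp, 1, Subgroup.one_mem _, (hstab y hy).symm⟩) (by simp)
    refine ⟨_, σ, hσ, ?_⟩
    rw [ho, if_neg h1]
    simp only [Finset.singleton_val, Multiset.map_singleton, h0]
    rfl

theorem isDiscreteGroup_integerTranslations : IsDiscreteGroup integerTranslations :=
  isDiscreteGroup_affineGroup integers_finite

theorem isDiscreteGroup_integerDihedral : IsDiscreteGroup integerDihedral :=
  isDiscreteGroup_affineGroup integers_finite

theorem isUniformizer_exp : IsUniformizer integerTranslations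
    fun z => ((Complex.exp (2 * Real.pi * Complex.I * z) : ℂ) : OnePoint ℂ) := by
  refine ⟨isHolomorphic_coe fun z => by fun_prop, fun z w => ?_⟩
  rw [OnePoint.coe_eq_coe, integerTranslations, exists_mem_affineGroup,
    Complex.exp_eq_exp_iff_exists_int]
  have hpi : (2 * Real.pi * Complex.I : ℂ) ≠ 0 := Complex.two_pi_I_ne_zero
  constructor
  · rintro ⟨n, hn⟩
    refine ⟨1, one_pow 1, mem_integers_iff.2 ⟨-n, mul_left_cancel₀ hpi ?_⟩⟩
    push_cast
    linear_combination -hn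
  · rintro ⟨a, ha, h⟩
    obtain ⟨n, hn⟩ := mem_integers_iff.1 h
    rw [pow_one] at ha
    subst ha
    refine ⟨-n, ?_⟩
    push_cast
    linear_combination -(2 * Real.pi * Complex.I : ℂ) * hn

theorem exists_signature_integerTranslations :
    ∃ π σ, IsQuotientCovering integerTranslations π σ ∧ σ.orders = {⊤, ⊤} := by
  classical
  have hrange : Set.range (fun z => ((Complex.exp (2 * Real.pi * Complex.I * z) : ℂ) : OnePoint ℂ))
      = {x | x ∉ ({OnePoint.infty, ((0 : ℂ) : OnePoint ℂ)} : Finset (OnePoint ℂ))} := by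
    ext x
    simp only [Set.mem_range, Finset.mem_singleton, Finset.mem_insert, Set.mem_ofPred_eq, not_or]
    constructor
    · rintro ⟨z, rfl⟩
      exact ⟨OnePoint.coe_ne_infty _, fun h => Complex.exp_ne_zero _ (OnePoint.coe_injective h)⟩
    · rintro ⟨hx, hx0⟩
      obtain ⟨y, rfl⟩ := OnePoint.ne_infty_iff_exists.1 hx
      have hy : y ≠ 0 := fun h => hx0 (by rw [h])
      refine ⟨Complex.log y / (2 * Real.pi * Complex.I), ?_⟩
      rw [mul_div_cancel₀ _ Complex.two_pi_I_ne_zero, Complex.exp_log hy]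
  obtain ⟨σ, hσ, ho⟩ := isUniformizer_exp.exists_signature isDiscreteGroup_integerTranslations _
    hrange ∅ (by simp) (fun y hy => by
      obtain ⟨a, ha, ha1, -⟩ := exists_root_of_ncard_stab_ne_one hy
      rw [pow_one] at ha1
      exact absurd ha1 ha) (by simp)
  refine ⟨_, σ, hσ, ?_⟩
  rw [ho, Finset.card_pair (OnePoint.infty_ne_coe 0)]
  rfl

theorem isUniformizer_cos : IsUniformizer integerDihedral
    fun z => ((Complex.cos (2 * Real.pi * z) : ℂ) : OnePoint ℂ) := by
  refine ⟨isHolomorphic_coe fun z => by fun_prop, fun z w => ?_⟩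
  rw [OnePoint.coe_eq_coe, integerDihedral, exists_mem_affineGroup, Complex.cos_eq_cos_iff]
  have hpi : (2 * Real.pi : ℂ) ≠ 0 := by exact_mod_cast Real.two_pi_pos.ne'
  constructor
  · rintro ⟨n, hn | hn⟩
    · refine ⟨1, one_pow 2, mem_integers_iff.2 ⟨n, mul_left_cancel₀ hpi ?_⟩⟩
      linear_combination hn
    · refine ⟨-1, by norm_num, mem_integers_iff.2 ⟨n, mul_left_cancel₀ hpi ?_⟩⟩
      linear_combination hn
  · rintro ⟨a, ha, h⟩
    obtain ⟨n, hn⟩ := mem_integers_iff.1 h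
    rcases eq_of_sq_eq_one ha with rfl | rfl
    · exact ⟨n, Or.inl (by linear_combination (2 * Real.pi : ℂ) * hn)⟩
    · exact ⟨n, Or.inr (by linear_combination (2 * Real.pi : ℂ) * hn)⟩

theorem exists_signature_integerDihedral :
    ∃ π σ, IsQuotientCovering integerDihedral π σ ∧ σ.orders = {2, 2, ⊤} := by
  classical
  have hrange := range_coe_of_surjective (f := fun z : ℂ => Complex.cos (2 * Real.pi * z))
    fun y => by
      obtain ⟨x, rfl⟩ := Complex.cos_surjective y
      refine ⟨x / (2 * Real.pi), ?_⟩
      have hpi : (2 * Real.pi : ℂ) ≠ 0 := by exact_mod_cast Real.two_pi_pos.ne'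
      simp only [mul_div_cancel₀ _ hpi]
  have hfix : ∀ p ∈ ({0, 1 / 2} : Finset ℂ), ∀ a : ℂ, a ^ 2 = 1 → (1 - a) * p ∈ integers := by
    intro p hp a ha
    simp only [Finset.mem_insert, Finset.mem_singleton] at hp
    rw [mem_integers_iff]
    rcases hp with rfl | rfl
    · exact ⟨0, by simp⟩
    · rcases eq_of_sq_eq_one ha with rfl | rfl
      · exact ⟨0, by simp⟩
      · exact ⟨1, by norm_num⟩
  have hstab : ∀ p ∈ ({0, 1 / 2} : Finset ℂ), (stab integerDihedral p).ncard = 2 := fun p hp =>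
    ncard_stab_eq_of_forall two_ne_zero dvd_rfl fun a ha => iff_of_true (hfix p hp a ha) ha
  have hhalf : ((1 : ℂ) / 2) ∉ integers := fun h => by
    obtain ⟨m, hm⟩ := mem_integers_iff.1 h
    have : (1 : ℤ) = 2 * m := by
      have : (1 : ℂ) = 2 * m := by linear_combination 2 * hm
      exact_mod_cast this
    omega
  obtain ⟨σ, hσ, ho⟩ := isUniformizer_cos.exists_signature isDiscreteGroup_integerDihedral _ hrange
    {0, 1 / 2} (fun p hp => by rw [hstab p hp]; norm_num) (fun y hy => by
      obtain ⟨a, ha, ha1, h⟩ := exists_root_of_ncard_stab_ne_one hy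
      have ha' := (eq_of_sq_eq_one ha1).resolve_left ha
      subst ha'
      obtain ⟨m, hm⟩ := mem_integers_iff.1 h
      obtain ⟨n, rfl | rfl⟩ := Int.even_or_odd' m
      · refine ⟨0, by simp, exists_mem_affineGroup.2 ⟨1, one_pow 2, mem_integers_iff.2 ⟨n, ?_⟩⟩⟩
        push_cast at hm
        linear_combination hm / 2
      · refine ⟨1 / 2, by simp, exists_mem_affineGroup.2
          ⟨1, one_pow 2, mem_integers_iff.2 ⟨n, ?_⟩⟩⟩
        push_cast at hm
        linear_combination hm / 2) (fun p hp q hq hpq => by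
      have := sub_mem_of_fixed (hfix p hp) hpq
      simp only [Finset.mem_insert, Finset.mem_singleton] at hp hq
      rcases hp with rfl | rfl <;> rcases hq with rfl | rfl
      · rfl
      · rw [sub_zero] at this; exact absurd this hhalf
      · rw [zero_sub, neg_mem_iff] at this; exact absurd this hhalf
      · rfl)
  refine ⟨_, σ, hσ, ?_⟩
  rw [ho, Multiset.map_congr rfl fun p hp => by rw [hstab p hp], Multiset.map_const']
  have : ({0, 1 / 2} : Finset ℂ).card = 2 := Finset.card_pair (by norm_num)
  rw [← Finset.card_def, this, Finset.card_singleton]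
  rfl

end AffineDiscrete

namespace AffineDiscrete

/-! ### Quotients by groups preserving a lattice -/

theorem isDiscreteGroup_lattice {k : ℕ} {c : ℂ} (hc : c.im ≠ 0) {hk : 0 < k}
    {hΛ : ∀ a b : ℂ, a ^ k = 1 → b ∈ lattice c → a * b ∈ lattice c} :
    IsDiscreteGroup (affineGroup k (lattice c) hk hΛ) :=
  isDiscreteGroup_affineGroup (lattice_finite hc)

theorem exists_orbit_of_sub_mem {k : ℕ} {Λ : AddSubgroup ℂ} {hk : 0 < k}
    {hΛ : ∀ a b : ℂ, a ^ k = 1 → b ∈ Λ → a * b ∈ Λ} {p q : ℂ} (h : q - p ∈ Λ) :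
    ∃ g ∈ affineGroup k Λ hk hΛ, g p = q :=
  exists_mem_affineGroup.2 ⟨1, one_pow k, by rwa [one_mul]⟩

/-- The classes of half-periods. -/
theorem half_period_cases {c y : ℂ} (h : 2 * y ∈ lattice c) :
    y ∈ lattice c ∨ y - 1 / 2 ∈ lattice c ∨ y - c / 2 ∈ lattice c ∨
      y - (1 + c) / 2 ∈ lattice c := by
  obtain ⟨m, n, hmn⟩ := mem_lattice_iff.1 h
  obtain ⟨m, rfl | rfl⟩ := Int.even_or_odd' m <;> obtain ⟨n, rfl | rfl⟩ := Int.even_or_odd' n <;>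
    push_cast at hmn
  · exact Or.inl (mem_lattice_iff.2 ⟨m, n, by linear_combination hmn / 2⟩)
  · exact Or.inr (Or.inr (Or.inl (mem_lattice_iff.2 ⟨m, n, by linear_combination hmn / 2⟩)))
  · exact Or.inr (Or.inl (mem_lattice_iff.2 ⟨m, n, by linear_combination hmn / 2⟩))
  · exact Or.inr (Or.inr (Or.inr (mem_lattice_iff.2 ⟨m, n, by linear_combination hmn / 2⟩)))

/-- The four half-periods are inequivalent modulo the lattice. -/
theorem half_period_inj {c : ℂ} (hc : c.im ≠ 0) {p q : ℂ}
    (hp : p ∈ ({0, 1 / 2, c / 2, (1 + c) / 2} : Finset ℂ))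
    (hq : q ∈ ({0, 1 / 2, c / 2, (1 + c) / 2} : Finset ℂ)) (h : q - p ∈ lattice c) : p = q := by
  have hex : ∀ p ∈ ({0, 1 / 2, c / 2, (1 + c) / 2} : Finset ℂ), ∃ m n : ℤ, (m = 0 ∨ m = 1) ∧
      (n = 0 ∨ n = 1) ∧ 2 * p = m + n * c := by
    intro p hp
    simp only [Finset.mem_insert, Finset.mem_singleton] at hp
    rcases hp with rfl | rfl | rfl | rfl
    · exact ⟨0, 0, by simp, by simp, by simp⟩
    · exact ⟨1, 0, by simp, by simp, by simp⟩
    · exact ⟨0, 1, by simp, by simp, by push_cast; ring⟩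
    · exact ⟨1, 1, by simp, by simp, by push_cast; ring⟩
  obtain ⟨m, n, hm, hn, hp⟩ := hex p hp
  obtain ⟨m', n', hm', hn', hq⟩ := hex q hq
  have := (mem_lattice_iff_dvd hc (m' - m) (n' - n) 2 two_ne_zero (by
    push_cast; linear_combination hq - hp)).1 h
  have h1 : m = m' := by omega
  have h2 : n = n' := by omega
  rw [← h1, ← h2, ← hp] at hq
  exact (mul_left_cancel₀ two_ne_zero hq).symm

theorem card_half_periods {c : ℂ} (hc : c.im ≠ 0) :
    ({0, 1 / 2, c / 2, (1 + c) / 2} : Finset ℂ).card = 4 := by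
  have hc0 : c ≠ 0 := by rintro rfl; simp at hc
  have hc1 : c ≠ 1 := by rintro rfl; simp at hc
  have hc2 : 1 + c ≠ 0 := fun h => by
    have := congrArg Complex.im h
    simp at this
    exact hc this
  rw [Finset.card_insert_of_notMem, Finset.card_insert_of_notMem, Finset.card_insert_of_notMem,
    Finset.card_singleton]
  · simp only [Finset.mem_singleton]
    intro h
    exact one_ne_zero (α := ℂ) (by linear_combination -2 * h)
  · simp only [Finset.mem_insert, Finset.mem_singleton, not_or]
    exact ⟨fun h => hc1 (by linear_combination -2 * h), fun h => hc0 (by linear_combination -2 * h)⟩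
  · simp only [Finset.mem_insert, Finset.mem_singleton, not_or]
    exact ⟨fun h => one_ne_zero (α := ℂ) (by linear_combination -2 * h),
      fun h => hc0 (by linear_combination -2 * h), fun h => hc2 (by linear_combination -2 * h)⟩

theorem exists_signature_latticeTwo {c : ℂ} (hc : c.im ≠ 0) :
    ∃ π σ, IsQuotientCovering (latticeTwo c) π σ ∧ σ.orders = {2, 2, 2, 2} := by
  classical
  obtain ⟨π, hu, hrange⟩ := exists_uniformizer_even hc (n := 1) two_pos
    (fun a b => stable_two (lattice c) a b)
  have hfix : ∀ p ∈ ({0, 1 / 2, c / 2, (1 + c) / 2} : Finset ℂ), ∀ a : ℂ, a ^ 2 = 1 →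
      (1 - a) * p ∈ lattice c := by
    intro p hp a ha
    simp only [Finset.mem_insert, Finset.mem_singleton] at hp
    rw [mem_lattice_iff]
    rcases eq_of_sq_eq_one ha with rfl | rfl
    · exact ⟨0, 0, by simp⟩
    · rcases hp with rfl | rfl | rfl | rfl
      · exact ⟨0, 0, by simp⟩
      · exact ⟨1, 0, by norm_num⟩
      · exact ⟨0, 1, by push_cast; ring⟩
      · exact ⟨1, 1, by push_cast; ring⟩
  have hstab : ∀ p ∈ ({0, 1 / 2, c / 2, (1 + c) / 2} : Finset ℂ),
      (stab (latticeTwo c) p).ncard = 2 := fun p hp =>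
    ncard_stab_eq_of_forall two_ne_zero dvd_rfl fun a ha => iff_of_true (hfix p hp a ha) ha
  obtain ⟨σ, hσ, ho⟩ := IsUniformizer.exists_signature (G := latticeTwo c)
    (isDiscreteGroup_lattice hc) hu ∅ (by simpa using hrange)
    {0, 1 / 2, c / 2, (1 + c) / 2} (fun p hp => by rw [hstab p hp]; norm_num) (fun y hy => by
      obtain ⟨a, ha, ha1, h⟩ := exists_root_of_ncard_stab_ne_one hy
      have ha' := (eq_of_sq_eq_one ha1).resolve_left ha
      subst ha'
      rw [show (1 - -1) * y = 2 * y by ring] at h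
      rcases half_period_cases h with h | h | h | h
      · exact ⟨0, by simp, exists_orbit_of_sub_mem (by rwa [sub_zero])⟩
      · exact ⟨_, by simp, exists_orbit_of_sub_mem h⟩
      · exact ⟨c / 2, by simp, exists_orbit_of_sub_mem h⟩
      · exact ⟨(1 + c) / 2, by simp, exists_orbit_of_sub_mem h⟩)
    (fun p hp q hq hpq => half_period_inj hc hp hq (sub_mem_of_fixed (hfix p hp) hpq))
  refine ⟨_, σ, hσ, ?_⟩
  rw [ho, Multiset.map_congr rfl fun p hp => by rw [hstab p hp], Multiset.map_const',
    ← Finset.card_def, card_half_periods hc]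
  rfl

theorem exists_signature_latticeFour :
    ∃ π σ, IsQuotientCovering latticeFour π σ ∧ σ.orders = {4, 4, 2} := by
  classical
  have hI : Complex.I.im ≠ 0 := by simp
  have hII := Complex.I_mul_I
  obtain ⟨π, hu, hrange⟩ := exists_uniformizer_even hI (n := 2) four_pos
    (fun a b => stable_four a b)
  have hfix : ∀ a : ℂ, a ^ 4 = 1 → (1 - a) * ((1 + Complex.I) / 2) ∈ lattice Complex.I := by
    intro a ha
    rw [mem_lattice_iff]
    rcases eq_of_pow_four_eq_one ha with rfl | rfl | rfl | rfl
    · exact ⟨0, 0, by simp⟩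
    · exact ⟨1, 1, by push_cast; ring⟩
    · exact ⟨1, 0, by push_cast; linear_combination -hII / 2⟩
    · exact ⟨0, 1, by push_cast; linear_combination hII / 2⟩
  have h0 : (stab latticeFour 0).ncard = 4 := ncard_stab_affineGroup_zero
  have h1 : (stab latticeFour ((1 + Complex.I) / 2)).ncard = 4 :=
    ncard_stab_eq_of_forall four_ne_zero dvd_rfl fun a ha => iff_of_true (hfix a ha) ha
  have h2 : (stab latticeFour (1 / 2)).ncard = 2 := by
    refine ncard_stab_eq_of_forall two_ne_zero (by norm_num) fun a ha => ?_
    rcases eq_of_pow_four_eq_one ha with rfl | rfl | rfl | rfl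
    · simp
    · exact iff_of_true (mem_lattice_iff.2 ⟨1, 0, by norm_num⟩) (by norm_num)
    · refine iff_of_false (fun h => ?_) (by norm_num)
      have := (mem_lattice_iff_dvd hI 1 (-1) 2 two_ne_zero (by push_cast; ring)).1 h
      omega
    · refine iff_of_false (fun h => ?_) (by norm_num)
      have := (mem_lattice_iff_dvd hI 1 1 2 two_ne_zero (by push_cast; ring)).1 h
      omega
  have hne : (0 : ℂ) ≠ (1 + Complex.I) / 2 := fun h => by
    have := congrArg Complex.im h
    simp at this
  have hnm : ((1 + Complex.I) / 2 : ℂ) ∉ lattice Complex.I := fun h => by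
    have := (mem_lattice_iff_dvd hI 1 1 2 two_ne_zero (by push_cast; ring)).1 h
    omega
  have hne2 : ∀ p, p ∈ ({0, (1 + Complex.I) / 2} : Finset ℂ) → p ≠ 1 / 2 := by
    intro p hp h
    rw [h, Finset.mem_insert, Finset.mem_singleton] at hp
    rcases hp with hp | hp <;> rw [hp] at h2 <;> omega
  have hG : IsDiscreteGroup latticeFour := isDiscreteGroup_lattice hI
  obtain ⟨σ, hσ, ho⟩ := IsUniformizer.exists_signature (G := latticeFour)
    hG hu ∅ (by simpa using hrange) {0, (1 + Complex.I) / 2, 1 / 2} (fun p hp => by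
      simp only [Finset.mem_insert, Finset.mem_singleton] at hp
      rcases hp with rfl | rfl | rfl <;> omega) (fun y hy => by
      obtain ⟨a, ha, ha1, h⟩ := exists_root_of_ncard_stab_ne_one hy
      have h : 2 * y ∈ lattice Complex.I := by
        rcases eq_of_pow_four_eq_one ha1 with rfl | rfl | rfl | rfl
        · exact absurd rfl ha
        · rwa [show (1 - -1) * y = 2 * y by ring] at h
        -- the products of `1 - a`, for `a = ± i`, with their conjugates are equal to `2`
        · have h' := AddSubgroup.add_mem _ h (stable_four Complex.I _ Complex.I_pow_four h)
          convert h' using 1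
          linear_combination y * hII
        · have h' := AddSubgroup.sub_mem _ h (stable_four Complex.I _ Complex.I_pow_four h)
          convert h' using 1
          linear_combination y * hII
      rcases half_period_cases h with h | h | h | h
      · exact ⟨0, by simp, exists_orbit_of_sub_mem (by rwa [sub_zero])⟩
      · exact ⟨1 / 2, by simp, exists_orbit_of_sub_mem h⟩
      · refine ⟨1 / 2, by simp, exists_mem_affineGroup.2 ⟨Complex.I, Complex.I_pow_four, ?_⟩⟩
        convert h using 1
        ring
      · exact ⟨(1 + Complex.I) / 2, by simp, exists_orbit_of_sub_mem h⟩) (fun p hp q hq hpq => by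
      have hn := IsUniformizer.ncard_stab_eq hG hu ((hu.fibre _ _).2 hpq)
      simp only [Finset.mem_insert, Finset.mem_singleton] at hp hq
      rcases hp with rfl | rfl | rfl <;> rcases hq with rfl | rfl | rfl
      · rfl
      · have := sub_mem_of_fixed (fun a _ => by simp) hpq
        rw [sub_zero] at this
        exact absurd this hnm
      · omega
      · have := sub_mem_of_fixed hfix hpq
        rw [zero_sub, neg_mem_iff] at this
        exact absurd this hnm
      · rfl
      · omega
      · omega
      · omega
      · rfl)
  refine ⟨_, σ, hσ, ?_⟩
  have hval : ({0, (1 + Complex.I) / 2, 1 / 2} : Finset ℂ).val =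
      {0, (1 + Complex.I) / 2, 1 / 2} := by
    rw [Finset.insert_val_of_notMem, Finset.insert_val_of_notMem, Finset.singleton_val]
    · rfl
    · rw [Finset.mem_singleton]; exact hne2 _ (by simp)
    · rw [Finset.mem_insert, Finset.mem_singleton]
      rintro (h | h)
      exacts [hne h, hne2 _ (by simp) h]
  rw [ho, hval]
  simp only [Multiset.insert_eq_cons, Multiset.map_cons, Multiset.map_singleton, h0, h1, h2]
  rfl

/-! The fixed points of the rotations of order three of the lattice `(1, τ₆)` are the multiples of
`(1 + τ₆) / 3`, because `(1 - τ₆²) (1 + τ₆) = 3`. -/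

theorem third_period_fixed {a : ℂ} (ha : a ^ 3 = 1) :
    (1 - a) * ((1 + tau6) / 3) ∈ lattice tau6 := by
  have hτ := tau6_sq
  rw [mem_lattice_iff]
  rcases eq_of_pow_three_eq_one ha with rfl | rfl | rfl
  · exact ⟨0, 0, by simp⟩
  · exact ⟨1, 0, by push_cast; linear_combination -hτ / 3⟩
  · exact ⟨0, 1, by push_cast; linear_combination hτ / 3⟩

theorem third_period_cases {a y : ℂ} (ha : a ^ 3 = 1) (ha1 : a ≠ 1)
    (h : (1 - a) * y ∈ lattice tau6) :
    y ∈ lattice tau6 ∨ y - (1 + tau6) / 3 ∈ lattice tau6 ∨ y + (1 + tau6) / 3 ∈ lattice tau6 := by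
  have hτ := tau6_sq
  have h2 : (2 - tau6) * y ∈ lattice tau6 := by
    rcases eq_of_pow_three_eq_one ha with rfl | rfl | rfl
    · exact absurd rfl ha1
    · rwa [show 1 - (tau6 - 1) = 2 - tau6 by ring] at h
    · have h' := stable_six (1 - tau6) _ (by
        have : (1 - tau6) ^ 2 = -tau6 := by linear_combination hτ
        calc (1 - tau6) ^ 6 = ((1 - tau6) ^ 2) ^ 3 := by ring
          _ = -tau6 ^ 3 := by rw [this]; ring
          _ = 1 := by linear_combination (-tau6 - 1) * hτ) h
      convert h' using 1
      linear_combination y * hτ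
  obtain ⟨m, n, hmn⟩ := mem_lattice_iff.1 h2
  have hy : 3 * y = (1 + tau6) * (m + n * tau6) := by
    rw [← hmn]; linear_combination y * hτ
  have hd : (m - n) % 3 = 0 ∨ (m - n) % 3 = 1 ∨ (m - n) % 3 = 2 := by omega
  rcases hd with hd | hd | hd
  · obtain ⟨q, hq⟩ : ∃ q, m = n + 3 * q := ⟨(m - n) / 3, by omega⟩
    subst hq
    push_cast at hy
    exact Or.inl (mem_lattice_iff.2 ⟨q, n + q, by
      push_cast; linear_combination hy / 3 + n * hτ / 3⟩)
  · obtain ⟨q, hq⟩ : ∃ q, m = n + 1 + 3 * q := ⟨(m - n) / 3, by omega⟩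
    subst hq
    push_cast at hy
    exact Or.inr (Or.inl (mem_lattice_iff.2 ⟨q, n + q, by
      push_cast; linear_combination hy / 3 + n * hτ / 3⟩))
  · obtain ⟨q, hq⟩ : ∃ q, m = n - 1 + 3 * q := ⟨(m - n + 1) / 3, by omega⟩
    subst hq
    push_cast at hy
    exact Or.inr (Or.inr (mem_lattice_iff.2 ⟨q, n + q, by
      push_cast; linear_combination hy / 3 + n * hτ / 3⟩))

theorem not_third_mem (m n : ℤ) (h : ¬ (3 : ℤ) ∣ m) {z : ℂ} (hz : 3 * z = m + n * tau6) :
    z ∉ lattice tau6 := fun hmem =>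
  h ((mem_lattice_iff_dvd tau6_im_ne_zero m n 3 three_ne_zero (by push_cast; exact hz)).1 hmem).1

theorem exists_signature_latticeThree :
    ∃ π σ, IsQuotientCovering latticeThree π σ ∧ σ.orders = {3, 3, 3} := by
  classical
  obtain ⟨π, hu, hrange⟩ := exists_uniformizer_three tau6_im_ne_zero
    (fun a b => stable_three a b)
  set p : ℂ := (1 + tau6) / 3 with hp
  have hp1 : p ∉ lattice tau6 := not_third_mem 1 1 (by norm_num) (by push_cast; ring)
  have hp2 : 2 * p ∉ lattice tau6 := not_third_mem 2 2 (by norm_num) (by push_cast; ring)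
  have hfix : ∀ q ∈ ({0, p, -p} : Finset ℂ), ∀ a : ℂ, a ^ 3 = 1 → (1 - a) * q ∈ lattice tau6 := by
    intro q hq a ha
    simp only [Finset.mem_insert, Finset.mem_singleton] at hq
    rcases hq with rfl | rfl | rfl
    · simp
    · exact third_period_fixed ha
    · rw [mul_neg, neg_mem_iff]
      exact third_period_fixed ha
  have hstab : ∀ q ∈ ({0, p, -p} : Finset ℂ), (stab latticeThree q).ncard = 3 := fun q hq =>
    ncard_stab_eq_of_forall three_ne_zero dvd_rfl fun a ha => iff_of_true (hfix q hq a ha) ha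
  have hinj : ∀ q ∈ ({0, p, -p} : Finset ℂ), ∀ q' ∈ ({0, p, -p} : Finset ℂ),
      q' - q ∈ lattice tau6 → q = q' := by
    intro q hq q' hq' h
    simp only [Finset.mem_insert, Finset.mem_singleton] at hq hq'
    have e1 : -p - p = -(2 * p) := by ring
    have e2 : p - -p = 2 * p := by ring
    rcases hq with rfl | rfl | rfl <;> rcases hq' with rfl | rfl | rfl <;>
      simp_all
  have hp0 : p ≠ 0 := fun h => hp1 (h ▸ AddSubgroup.zero_mem _)
  have hpp : p ≠ -p := fun h => hp2 (by
    rw [show 2 * p = 0 by linear_combination h]; exact AddSubgroup.zero_mem _)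
  obtain ⟨σ, hσ, ho⟩ := IsUniformizer.exists_signature (G := latticeThree)
    (isDiscreteGroup_lattice tau6_im_ne_zero) hu ∅ (by simpa using hrange)
    {0, p, -p} (fun q hq => by rw [hstab q hq]; norm_num) (fun y hy => by
      obtain ⟨a, ha, ha1, h⟩ := exists_root_of_ncard_stab_ne_one hy
      rcases third_period_cases ha1 ha h with h | h | h
      · exact ⟨0, by simp, exists_orbit_of_sub_mem (by rwa [sub_zero])⟩
      · exact ⟨p, by simp, exists_orbit_of_sub_mem h⟩
      · exact ⟨-p, by simp, exists_orbit_of_sub_mem (by rwa [sub_neg_eq_add])⟩)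
    (fun q hq q' hq' hqq' => hinj q hq q' hq' (sub_mem_of_fixed (hfix q hq) hqq'))
  refine ⟨_, σ, hσ, ?_⟩
  have hcard : ({0, p, -p} : Finset ℂ).card = 3 := by
    rw [Finset.card_eq_three]
    exact ⟨0, p, -p, hp0.symm, by simpa using hp0, hpp, rfl⟩
  rw [ho, Multiset.map_congr rfl fun q hq => by rw [hstab q hq], Multiset.map_const',
    ← Finset.card_def, hcard]
  rfl

theorem exists_signature_latticeSix :
    ∃ π σ, IsQuotientCovering latticeSix π σ ∧ σ.orders = {6, 3, 2} := by
  classical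
  have hτ := tau6_sq
  have hτ6 := tau6_primitive.pow_eq_one
  have him := tau6_im_ne_zero
  obtain ⟨π, hu, hrange⟩ := exists_uniformizer_even him (n := 3) (by norm_num)
    (fun a b => stable_six a b)
  set p : ℂ := (1 + tau6) / 3 with hp
  have cube : (-1 : ℂ) ^ 3 ≠ 1 ∧ tau6 ^ 3 ≠ 1 ∧ (1 - tau6) ^ 3 ≠ 1 := by
    have e1 : tau6 ^ 3 = -1 := by linear_combination (tau6 + 1) * hτ
    have e2 : (1 - tau6) ^ 3 = -1 := by linear_combination (2 - tau6) * hτ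
    rw [e1, e2]
    norm_num
  have h0 : (stab latticeSix 0).ncard = 6 := ncard_stab_affineGroup_zero
  have h1 : (stab latticeSix p).ncard = 3 := by
    refine ncard_stab_eq_of_forall three_ne_zero (by norm_num) fun a ha => ?_
    rcases eq_of_pow_six_eq_one ha with ha' | rfl | rfl | rfl
    · have : a ^ 3 = 1 := by
        rcases ha' with rfl | rfl | rfl
        · norm_num
        · linear_combination (tau6 - 2) * hτ
        · linear_combination (-tau6 - 1) * hτ
      exact iff_of_true (third_period_fixed this) this
    · exact iff_of_false (not_third_mem 2 2 (by norm_num) (by push_cast; ring)) cube.1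
    · refine iff_of_false (not_third_mem 2 (-1) (by norm_num) ?_) cube.2.1
      push_cast
      linear_combination -hτ
    · refine iff_of_false (not_third_mem (-1) 2 (by norm_num) ?_) cube.2.2
      push_cast
      linear_combination hτ
  have h2 : (stab latticeSix (1 / 2)).ncard = 2 := by
    have hsq : ∀ a : ℂ, a = tau6 - 1 ∨ a = -tau6 ∨ a = tau6 ∨ a = 1 - tau6 → a ^ 2 ≠ 1 := by
      intro a ha h
      have hn : ∀ m n : ℤ, n ≠ 0 → (m + n * tau6 : ℂ) ≠ 0 := fun m n hn h => hn (by
        have := (real_coords_unique him (x := m) (y := n) (x' := 0) (y' := 0) (by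
          push_cast; rw [h]; ring)).2
        exact_mod_cast this)
      rcases eq_of_sq_eq_one h with rfl | rfl <;> rcases ha with h | h | h | h
      · exact hn (-2) 1 one_ne_zero (by push_cast; linear_combination -h)
      · exact hn 1 1 one_ne_zero (by push_cast; linear_combination h)
      · exact hn (-1) 1 one_ne_zero (by push_cast; linear_combination -h)
      · exact hn 0 1 one_ne_zero (by push_cast; linear_combination h)
      · exact hn 0 1 one_ne_zero (by push_cast; linear_combination -h)
      · exact hn (-1) 1 one_ne_zero (by push_cast; linear_combination h)
      · exact hn 1 1 one_ne_zero (by push_cast; linear_combination -h)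
      · exact hn (-2) 1 one_ne_zero (by push_cast; linear_combination h)
    have hhalf : ∀ (z : ℂ) (m n : ℤ), ¬ (2 ∣ m ∧ 2 ∣ n) → 2 * z = m + n * tau6 →
        z ∉ lattice tau6 := fun z m n hmn hz hmem =>
      hmn ((mem_lattice_iff_dvd him m n 2 two_ne_zero (by push_cast; exact hz)).1 hmem)
    refine ncard_stab_eq_of_forall two_ne_zero (by norm_num) fun a ha => ?_
    rcases eq_of_pow_six_eq_one ha with (rfl | rfl | rfl) | rfl | rfl | rfl
    · simp
    · exact iff_of_false (hhalf _ 2 (-1) (by norm_num) (by push_cast; ring)) (hsq _ (by simp))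
    · exact iff_of_false (hhalf _ 1 1 (by norm_num) (by push_cast; ring)) (hsq _ (by simp))
    · exact iff_of_true (mem_lattice_iff.2 ⟨1, 0, by norm_num⟩) (by norm_num)
    · exact iff_of_false (hhalf _ 1 (-1) (by norm_num) (by push_cast; ring)) (hsq _ (by simp))
    · exact iff_of_false (hhalf _ 0 1 (by norm_num) (by push_cast; ring)) (hsq _ (by simp))
  have hG : IsDiscreteGroup latticeSix := isDiscreteGroup_lattice him
  obtain ⟨σ, hσ, ho⟩ := IsUniformizer.exists_signature (G := latticeSix)
    hG hu ∅ (by simpa using hrange) {0, p, 1 / 2} (fun q hq => by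
      simp only [Finset.mem_insert, Finset.mem_singleton] at hq
      rcases hq with rfl | rfl | rfl <;> omega) (fun y hy => by
      obtain ⟨a, ha, ha1, h⟩ := exists_root_of_ncard_stab_ne_one hy
      have hthree : a ^ 3 = 1 → ∃ q ∈ ({0, p, 1 / 2} : Finset ℂ), ∃ g ∈ latticeSix, g q = y := by
        intro ha3
        rcases third_period_cases ha3 ha h with h | h | h
        · exact ⟨0, by simp, exists_orbit_of_sub_mem (by rwa [sub_zero])⟩
        · exact ⟨p, by simp, exists_orbit_of_sub_mem h⟩
        · exact ⟨p, by simp, exists_mem_affineGroup.2 ⟨-1, by norm_num, by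
            rwa [neg_one_mul, sub_neg_eq_add]⟩⟩
      rcases eq_of_pow_six_eq_one ha1 with (rfl | rfl | rfl) | rfl | rfl | rfl
      · exact absurd rfl ha
      · exact hthree (by linear_combination (tau6 - 2) * hτ)
      · exact hthree (by linear_combination (-tau6 - 1) * hτ)
      · rw [show (1 - -1) * y = 2 * y by ring] at h
        rcases half_period_cases h with h | h | h | h
        · exact ⟨0, by simp, exists_orbit_of_sub_mem (by rwa [sub_zero])⟩
        · exact ⟨1 / 2, by simp, exists_orbit_of_sub_mem h⟩
        · refine ⟨1 / 2, by simp, exists_mem_affineGroup.2 ⟨tau6, hτ6, ?_⟩⟩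
          convert h using 1
          ring
        · refine ⟨1 / 2, by simp, exists_mem_affineGroup.2 ⟨tau6 - 1, by
            linear_combination ((tau6 - 1) ^ 3 + 1) * (tau6 - 2) * hτ, ?_⟩⟩
          convert AddSubgroup.add_mem _ h one_mem_lattice using 1
          ring
      · refine ⟨0, by simp, exists_orbit_of_sub_mem ?_⟩
        convert stable_six tau6 _ hτ6 h using 1
        linear_combination y * hτ
      · refine ⟨0, by simp, exists_orbit_of_sub_mem ?_⟩
        rw [sub_sub_cancel] at h
        convert AddSubgroup.sub_mem _ h (stable_six tau6 _ hτ6 h) using 1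
        linear_combination y * hτ) (fun q hq q' hq' hqq' => by
      have hn := IsUniformizer.ncard_stab_eq hG hu ((hu.fibre _ _).2 hqq')
      simp only [Finset.mem_insert, Finset.mem_singleton] at hq hq'
      rcases hq with rfl | rfl | rfl <;> rcases hq' with rfl | rfl | rfl <;> first | rfl | omega)
  refine ⟨_, σ, hσ, ?_⟩
  have hval : ({0, p, 1 / 2} : Finset ℂ).val = {0, p, 1 / 2} := by
    rw [Finset.insert_val_of_notMem, Finset.insert_val_of_notMem, Finset.singleton_val]
    · rfl
    · rw [Finset.mem_singleton]
      intro h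
      rw [h] at h1
      omega
    · rw [Finset.mem_insert, Finset.mem_singleton]
      rintro (h | h)
      · rw [← h] at h1
        omega
      · rw [← h] at h2
        omega
  rw [ho, hval]
  simp only [Multiset.insert_eq_cons, Multiset.map_cons, Multiset.map_singleton, h0, h1, h2]
  rfl

end AffineDiscrete

namespace AffineDiscrete

/-! ### Quotients by groups of translations -/

/-- The projection to the orbit space of a discrete group acting freely is a covering. -/
theorem IsDiscreteGroup.isCoveringMap_mk {G : Subgroup Aff} (hG : IsDiscreteGroup G)
    (hfree : ∀ g ∈ G, ∀ z, g z = z → g = 1) : IsCoveringMap (Quotient.mk (orbitSetoid G)) := by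
  let _ : MulAction G ℂ :=
    { smul := fun g z => (g : Aff) z
      one_smul := fun z => rfl
      mul_smul := fun g g' z => rfl }
  have : ContinuousConstSMul G ℂ := ⟨fun g => continuous_aff g⟩
  have hquot : Topology.IsQuotientMap (Quotient.mk (orbitSetoid G)) := isQuotientMap_quotient_mk'
  have hcov := hquot.isCoveringMapOn_of_smul_disjoint (G := G) (fun {e₁ e₂} => by
      rw [eq_comm, Quotient.eq]
      constructor
      · rintro ⟨g, hg, rfl⟩
        exact ⟨⟨g, hg⟩, rfl⟩
      · rintro ⟨g, rfl⟩
        exact ⟨g, g.2, rfl⟩) (fun y => by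
      obtain ⟨r, hr, hb⟩ := hG.exists_radius y y
      refine ⟨_, Metric.ball_mem_nhds y hr, ?_⟩
      rintro g ⟨_, ⟨z, hz, rfl⟩, hgz⟩
      exact hb g g.2 z hz hgz)
  rw [isCoveringMap_iff_isCoveringMapOn_univ]
  convert hcov using 1
  symm
  rw [Set.eq_univ_iff_forall]
  intro q
  obtain ⟨y, rfl⟩ := Quotient.exists_rep q
  refine ⟨y, ?_, rfl⟩
  rw [Set.mem_ofPred_eq, Subgroup.eq_bot_iff_forall]
  exact fun g hg => Subtype.ext (hfree g g.2 y hg)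

/-- A local inverse of the projection, composed with the projection, agrees near each point with an
affine transformation; so the transition maps between local inverses are holomorphic. -/
theorem eventually_symm_eq {G : Subgroup Aff} {e : OpenPartialHomeomorph ℂ (OrbitSpace G)}
    (he : Quotient.mk (orbitSetoid G) = e) {z : ℂ}
    (hz : Quotient.mk (orbitSetoid G) z ∈ e.target) :
    ∃ g : Aff, ∀ᶠ w in 𝓝 z, e.symm (Quotient.mk (orbitSetoid G) w) = g w := by
  have hmem := e.map_target hz
  have heq : Quotient.mk (orbitSetoid G) (e.symm (Quotient.mk (orbitSetoid G) z)) =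
      Quotient.mk (orbitSetoid G) z := by
    have h := e.right_inv hz
    rwa [← he] at h
  obtain ⟨g, hg, hgz⟩ := Quotient.exact heq.symm
  refine ⟨g, ?_⟩
  have hsrc : ∀ᶠ w in 𝓝 z, g w ∈ e.source := by
    refine (continuous_aff g).continuousAt.eventually (e.open_source.mem_nhds ?_)
    rwa [hgz]
  filter_upwards [hsrc] with w hw
  have hw' : Quotient.mk (orbitSetoid G) w = e (g w) := by
    rw [← he]
    exact Quotient.sound ⟨g, hg, rfl⟩
  rw [hw', e.left_inv hw]

theorem contDiff_aff (g : Aff) : ContDiff ℂ ω g := by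
  have : (g : ℂ → ℂ) = fun z => slope g * z + g 0 := funext (apply_eq g)
  rw [this]
  fun_prop

/-- The orbit space of a discrete group acting freely is a Riemann surface. -/
theorem exists_chartedSpace_orbitSpace {G : Subgroup Aff}
    (hloc : IsLocalHomeomorph (Quotient.mk (orbitSetoid G))) :
    ∃ _cs : ChartedSpace ℂ (OrbitSpace G), IsManifold 𝓘(ℂ) ω (OrbitSpace G) ∧
      ContMDiff 𝓘(ℂ) 𝓘(ℂ) ω (Quotient.mk (orbitSetoid G)) := by
  choose e he he' using hloc
  let cs : ChartedSpace ℂ (OrbitSpace G) :=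
    { atlas := Set.range fun z => (e z).symm
      chartAt := fun q => (e q.out).symm
      mem_chart_source := fun q => by
        have h := (e q.out).map_source (he q.out)
        rw [← he' q.out, Quotient.out_eq] at h
        exact h
      chart_mem_atlas := fun q => ⟨q.out, rfl⟩ }
  have hsmooth : ∀ y z, Quotient.mk (orbitSetoid G) z ∈ (e y).target →
      ContDiffAt ℂ ω (fun w => (e y).symm (Quotient.mk (orbitSetoid G) w)) z := by
    intro y z hz
    obtain ⟨g, hg⟩ := eventually_symm_eq (he' y) hz
    exact (contDiff_aff g).contDiffAt.congr_of_eventuallyEq hg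
  refine ⟨cs, isManifold_of_contDiffOn _ _ _ ?_, fun z => ?_⟩
  · rintro _ _ ⟨y, rfl⟩ ⟨y', rfl⟩ z hz
    simp only [mfld_simps] at hz ⊢
    refine ContDiffAt.contDiffWithinAt ?_
    have h := hsmooth y' z (by rw [he' y]; exact hz.2)
    rw [he' y] at h
    exact h
  · rw [contMDiffAt_iff]
    refine ⟨continuous_quotient_mk'.continuousAt, ContDiffAt.contDiffWithinAt ?_⟩
    refine hsmooth (Quotient.mk (orbitSetoid G) z).out z ?_
    exact cs.mem_chart_source _

/-- The real coordinates of `z` with respect to `1, c`. -/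
noncomputable def latticeCoords (c z : ℂ) : ℝ × ℝ := (z.re - z.im / c.im * c.re, z.im / c.im)

theorem latticeCoords_spec {c : ℂ} (hc : c.im ≠ 0) (z : ℂ) :
    ((latticeCoords c z).1 + (latticeCoords c z).2 * c : ℂ) = z := by
  apply Complex.ext
  · simp [latticeCoords]
  · simp [latticeCoords, hc]

theorem continuous_latticeCoords (c : ℂ) : Continuous (latticeCoords c) := by
  unfold latticeCoords
  fun_prop

/-- Two points are congruent modulo the lattice if and only if their real coordinates have the
same images on the circle. -/
theorem circle_exp_eq_iff {c : ℂ} (hc : c.im ≠ 0) (z w : ℂ) :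
    (Circle.exp (2 * Real.pi * (latticeCoords c z).1) =
        Circle.exp (2 * Real.pi * (latticeCoords c w).1) ∧
      Circle.exp (2 * Real.pi * (latticeCoords c z).2) =
        Circle.exp (2 * Real.pi * (latticeCoords c w).2)) ↔ w - z ∈ lattice c := by
  have hpi := Real.two_pi_pos.ne'
  have key : ∀ x y : ℝ, Circle.exp (2 * Real.pi * x) = Circle.exp (2 * Real.pi * y) ↔
      ∃ m : ℤ, y - x = m := by
    intro x y
    rw [eq_comm, Circle.exp_eq_exp]
    refine exists_congr fun m => ⟨fun h => mul_left_cancel₀ hpi (by linarith), fun h => ?_⟩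
    rw [sub_eq_iff_eq_add.1 h]
    ring
  rw [key, key, mem_lattice_iff]
  conv_rhs => rw [← latticeCoords_spec hc z, ← latticeCoords_spec hc w]
  constructor
  · rintro ⟨⟨m, hm⟩, ⟨n, hn⟩⟩
    refine ⟨m, n, ?_⟩
    have hm' := congrArg (fun x : ℝ => (x : ℂ)) hm
    have hn' := congrArg (fun x : ℝ => (x : ℂ)) hn
    push_cast at hm' hn'
    linear_combination hm' + c * hn'
  · rintro ⟨m, n, h⟩
    have := real_coords_unique hc (x := (latticeCoords c w).1 - (latticeCoords c z).1)
      (y := (latticeCoords c w).2 - (latticeCoords c z).2) (x' := m) (y' := n) (by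
        push_cast
        linear_combination h)
    exact ⟨⟨m, this.1⟩, ⟨n, this.2⟩⟩

/-- The quotient of the line by a lattice is homeomorphic to the torus. -/
theorem nonempty_homeomorph_torus {G : Subgroup Aff} {c : ℂ} (hc : c.im ≠ 0) (φ : Aff)
    (horb : ∀ z w, (∃ g ∈ G, g z = w) ↔ φ w - φ z ∈ lattice c) :
    Nonempty (OrbitSpace G ≃ₜ Circle × Circle) := by
  let F : ℂ → Circle × Circle := fun z =>
    (Circle.exp (2 * Real.pi * (latticeCoords c (φ z)).1),
      Circle.exp (2 * Real.pi * (latticeCoords c (φ z)).2))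
  have hF : ∀ z w, F z = F w ↔ ∃ g ∈ G, g z = w := by
    intro z w
    rw [horb, ← circle_exp_eq_iff hc]
    exact Prod.ext_iff
  have hFc : Continuous F := by
    have h1 := (continuous_latticeCoords c).comp (continuous_aff φ)
    have h2 := continuous_fst.comp h1
    have h3 := continuous_snd.comp h1
    exact (Circle.exp.continuous.comp (continuous_const.mul h2)).prodMk
      (Circle.exp.continuous.comp (continuous_const.mul h3))
  let f : OrbitSpace G → Circle × Circle := Quotient.lift F fun z w h => (hF z w).2 h
  have hfc : Continuous f := hFc.quotient_lift _
  have hfb : Function.Bijective f := by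
    constructor
    · intro p q
      induction p using Quotient.ind
      induction q using Quotient.ind
      exact fun h => Quotient.sound ((hF _ _).1 h)
    · rintro ⟨u, v⟩
      obtain ⟨x, rfl⟩ := Circle.exp_surjective u
      obtain ⟨y, rfl⟩ := Circle.exp_surjective v
      have hpi : (2 : ℝ) * Real.pi ≠ 0 := Real.two_pi_pos.ne'
      refine ⟨Quotient.mk _ (φ⁻¹ ((x / (2 * Real.pi) : ℝ) + (y / (2 * Real.pi) : ℝ) * c)), ?_⟩
      have h1 := latticeCoords_spec hc
        ((x / (2 * Real.pi) : ℝ) + (y / (2 * Real.pi) : ℝ) * c)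
      obtain ⟨h2, h3⟩ := real_coords_unique hc h1
      change F _ = _
      simp only [F, apply_inv_apply]
      rw [h2, h3, mul_div_cancel₀ _ hpi, mul_div_cancel₀ _ hpi]
  obtain ⟨K, hK, hKc⟩ := exists_compact_lattice hc
  have hcompact : CompactSpace (OrbitSpace G) := by
    have h1 := (hK.image (continuous_aff φ⁻¹)).image
      (continuous_quotient_mk' (s := orbitSetoid G))
    constructor
    convert h1 using 1
    symm
    rw [Set.eq_univ_iff_forall]
    intro q
    induction q using Quotient.ind with
    | _ z =>
      obtain ⟨b, hb, hbK⟩ := hKc (φ z)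
      refine ⟨φ⁻¹ (φ z + b), ⟨_, hbK, rfl⟩, Quotient.sound ?_⟩
      refine (horb _ _).2 ?_
      rw [apply_inv_apply, sub_add_cancel_left]
      exact (lattice c).neg_mem hb
  exact ⟨Continuous.homeoOfEquivCompactToT2 (f := Equiv.ofBijective f hfb) hfc⟩

/-- The quotient of the line by a group conjugate to a lattice of translations is an elliptic
curve. -/
theorem quotientIsGenusOneCurve {G : Subgroup Aff} {c : ℂ} (hc : c.im ≠ 0)
    (h : AffConj G (latticeTranslations c)) : QuotientIsGenusOneCurve G := by
  have hG : IsDiscreteGroup G := (isDiscreteGroup_lattice hc).of_affConj h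
  obtain ⟨φ, hφ⟩ := h
  have hmem : ∀ g : Aff, g ∈ G ↔ slope (φ * g * φ⁻¹) = 1 ∧ (φ * g * φ⁻¹) 0 ∈ lattice c := by
    intro g
    rw [mem_of_conj hφ, latticeTranslations, mem_affineGroup, pow_one]
  have hfree : ∀ g ∈ G, ∀ z, g z = z → g = 1 := by
    intro g hg z hz
    have h1 := apply_eq (φ * g * φ⁻¹) (φ z)
    rw [((hmem g).1 hg).1, mul_apply, mul_apply, inv_apply_apply, hz, one_mul,
      left_eq_add] at h1
    have h2 : φ * g * φ⁻¹ = 1 := aff_ext (by rw [((hmem g).1 hg).1, slope_one]) h1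
    rwa [mul_inv_eq_one, mul_eq_left] at h2
  have horb : ∀ z w, (∃ g ∈ G, g z = w) ↔ φ w - φ z ∈ lattice c := by
    intro z w
    constructor
    · rintro ⟨g, hg, rfl⟩
      have h1 := apply_eq (φ * g * φ⁻¹) (φ z)
      rw [((hmem g).1 hg).1, mul_apply, mul_apply, inv_apply_apply, one_mul] at h1
      rw [h1, add_sub_cancel_left]
      exact ((hmem g).1 hg).2
    · intro hzw
      have hg : φ⁻¹ * mkAff 1 (φ w - φ z) one_ne_zero * φ ∈ G := by
        rw [mem_of_conj hφ, latticeTranslations]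
        convert mkAff_mem_affineGroup one_ne_zero (one_pow 1) hzw using 1
        group
      refine ⟨_, hg, ?_⟩
      rw [mul_apply, mul_apply, mkAff_apply, one_mul, add_sub_cancel, inv_apply_apply]
  have hcov := hG.isCoveringMap_mk hfree
  exact ⟨exists_chartedSpace_orbitSpace hcov.isLocalHomeomorph, hcov,
    nonempty_homeomorph_torus hc φ horb⟩

end AffineDiscrete

namespace AffineDiscrete

/-! ### Lattices up to similarity -/

/-- Conjugating by an affine transformation with linear part `α` multiplies translations by `α`. -/
theorem conj_apply_zero (φ g : Aff) (hg : slope g = 1) :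
    (φ * g * φ⁻¹) 0 = slope φ * g 0 := by
  have h0 : φ (φ⁻¹ 0) = 0 := apply_inv_apply φ 0
  rw [apply_eq φ] at h0
  rw [mul_apply, mul_apply, apply_eq φ, apply_eq g (φ⁻¹ 0), hg]
  linear_combination h0

theorem slope_conj (φ g : Aff) : slope (φ * g * φ⁻¹) = slope g := by
  rw [slope_mul, slope_mul, slope_inv]
  field_simp [slope_ne_zero φ]

theorem affConj_of_mem_iff {G H : Subgroup Aff} (φ : Aff)
    (h : ∀ g, g ∈ G ↔ φ * g * φ⁻¹ ∈ H) : AffConj G H := by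
  refine ⟨φ, Subgroup.ext fun g => ⟨fun hg => ⟨φ⁻¹ * g * φ, (h _).2 ?_, ?_⟩, ?_⟩⟩
  · convert hg using 1
    group
  · change φ * (φ⁻¹ * g * φ) * φ⁻¹ = g
    group
  · rintro ⟨g', hg', rfl⟩
    exact (h g').1 hg'

theorem affConj_affineGroup_iff {k : ℕ} {Λ Λ' : AddSubgroup ℂ} {hk : 0 < k}
    {hΛ : ∀ a b : ℂ, a ^ k = 1 → b ∈ Λ → a * b ∈ Λ}
    {hΛ' : ∀ a b : ℂ, a ^ k = 1 → b ∈ Λ' → a * b ∈ Λ'} :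
    AffConj (affineGroup k Λ hk hΛ) (affineGroup k Λ' hk hΛ') ↔
      ∃ α : ℂ, α ≠ 0 ∧ ∀ b, b ∈ Λ ↔ α * b ∈ Λ' := by
  constructor
  · rintro ⟨φ, hφ⟩
    refine ⟨slope φ, slope_ne_zero φ, fun b => ?_⟩
    have hs : slope (mkAff 1 b one_ne_zero) = 1 := slope_eq_of_apply (mkAff_apply 1 b one_ne_zero)
    have h := mem_of_conj hφ (mkAff 1 b one_ne_zero)
    rw [mem_affineGroup, mem_affineGroup, slope_conj, conj_apply_zero _ _ hs, hs] at h
    simpa using h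
  · rintro ⟨α, hα, h⟩
    have key : ∀ g : Aff, (mkAff α 0 hα * g * (mkAff α 0 hα)⁻¹) 0 = α * g 0 := by
      intro g
      have h0 : (mkAff α 0 hα)⁻¹ 0 = 0 := by
        rw [AffineEquiv.inv_def, AffineEquiv.symm_apply_eq]
        simp
      rw [mul_apply, mul_apply, h0]
      simp
    refine affConj_of_mem_iff (mkAff α 0 hα) fun g => ?_
    rw [mem_affineGroup, mem_affineGroup, slope_conj, key, h]

/-- The similarity classes of lattices `(1, c)` are the orbits of the modular group. -/
theorem similar_lattice_iff {c c' : ℂ} (hc : c.im ≠ 0) :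
    (∃ α : ℂ, α ≠ 0 ∧ ∀ b, b ∈ lattice c ↔ α * b ∈ lattice c') ↔ ModularEquiv c c' := by
  constructor
  · rintro ⟨α, hα, h⟩
    have h1 : α⁻¹ ∈ lattice c := by
      rw [h, mul_inv_cancel₀ hα]
      exact one_mem_lattice
    have h2 : α⁻¹ * c' ∈ lattice c := by
      rw [h, mul_inv_cancel_left₀ hα]
      exact self_mem_lattice
    obtain ⟨s, r, hsr⟩ := mem_lattice_iff.1 h1
    obtain ⟨q, p, hqp⟩ := mem_lattice_iff.1 h2
    obtain ⟨s', r', hsr'⟩ := mem_lattice_iff.1 ((h 1).1 one_mem_lattice)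
    obtain ⟨q', p', hqp'⟩ := mem_lattice_iff.1 ((h c).1 self_mem_lattice)
    -- the two matrices are inverse to each other
    have e1 := real_coords_unique hc (x := s' * s + r' * q) (y := s' * r + r' * p)
      (x' := 1) (y' := 0) (by
        push_cast
        have : (1 : ℂ) = α⁻¹ * (α * 1) := by field_simp
        rw [hsr'] at this
        linear_combination -this - s' * hsr - r' * hqp)
    have e2 := real_coords_unique hc (x := q' * s + p' * q) (y := q' * r + p' * p)
      (x' := 0) (y' := 1) (by
        push_cast
        have : c = α⁻¹ * (α * c) := by field_simp
        rw [hqp'] at this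
        linear_combination -this - q' * hsr - p' * hqp)
    norm_cast at e1 e2
    refine ⟨p, q, r, s, ?_, ?_⟩
    · refine Int.eq_one_or_neg_one_of_mul_eq_one (v := s' * p' - r' * q') ?_
      linear_combination (q' * r + p' * p) * e1.1 + e2.2 - (q' * s + p' * q) * e1.2
    · have hne : (r * c + s : ℂ) ≠ 0 := by
        rw [add_comm, ← hsr]
        exact inv_ne_zero hα
      rw [eq_div_iff hne]
      linear_combination hqp - c' * hsr
  · rintro ⟨p, q, r, s, hdet, hcc⟩
    have hne : (r * c + s : ℂ) ≠ 0 := by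
      intro h0
      have := real_coords_unique hc (x := s) (y := r) (x' := 0) (y' := 0) (by
        push_cast
        linear_combination h0)
      have h1 : s = 0 := by exact_mod_cast this.1
      have h2 : r = 0 := by exact_mod_cast this.2
      rw [h1, h2] at hdet
      simp at hdet
    rw [eq_div_iff hne] at hcc
    obtain ⟨ε, hε, hd⟩ : ∃ ε : ℤ, ε * ε = 1 ∧ p * s - q * r = ε := by
      rcases hdet with h | h
      exacts [⟨1, rfl, h⟩, ⟨-1, rfl, h⟩]
    have hd' : (ε : ℂ) * (p * s - q * r) = 1 := by
      rw [← hd] at hε ⊢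
      exact_mod_cast hε
    refine ⟨(r * c + s)⁻¹, inv_ne_zero hne, fun b => ?_⟩
    rw [mem_lattice_iff, mem_lattice_iff]
    constructor
    · rintro ⟨m, n, rfl⟩
      refine ⟨ε * (p * m - q * n), ε * (s * n - r * m), ?_⟩
      rw [inv_mul_eq_iff_eq_mul₀ hne]
      push_cast
      linear_combination -(m + n * c) * hd' - ε * (s * n - r * m) * hcc
    · rintro ⟨m, n, hb⟩
      rw [inv_mul_eq_iff_eq_mul₀ hne] at hb
      refine ⟨m * s + n * q, m * r + n * p, ?_⟩
      push_cast
      linear_combination hb + n * hcc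

end AffineDiscrete

namespace AffineDiscrete

/-! ### Translations and rotational parts of a discrete group -/

/-- The vectors of the translations in `G`. -/
noncomputable def translations (G : Subgroup Aff) : AddSubgroup ℂ where
  carrier := {b | mkAff 1 b one_ne_zero ∈ G}
  zero_mem' := by
    have : mkAff 1 0 one_ne_zero = 1 := by
      ext z
      simp
    rw [Set.mem_ofPred_eq, this]
    exact G.one_mem
  add_mem' := by
    intro b b' hb hb'
    have : mkAff 1 (b + b') one_ne_zero = mkAff 1 b one_ne_zero * mkAff 1 b' one_ne_zero := by
      ext z
      rw [mul_apply]
      simp only [mkAff_apply]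
      ring
    rw [Set.mem_ofPred_eq, this]
    exact G.mul_mem hb hb'
  neg_mem' := by
    intro b hb
    have : mkAff 1 (-b) one_ne_zero = (mkAff 1 b one_ne_zero)⁻¹ := by
      ext z
      apply (mkAff 1 b one_ne_zero).injective
      rw [apply_inv_apply]
      simp only [mkAff_apply]
      ring
    rw [Set.mem_ofPred_eq, this]
    exact G.inv_mem hb

variable {G : Subgroup Aff}

theorem mem_translations {b : ℂ} : b ∈ translations G ↔ mkAff 1 b one_ne_zero ∈ G := Iff.rfl

theorem slope_mkAff (a b : ℂ) (ha : a ≠ 0) : slope (mkAff a b ha) = a :=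
  slope_eq_of_apply (mkAff_apply a b ha)

/-- An element of `G` without rotational part is a translation. -/
theorem sub_mem_translations {g : Aff} (hg : g ∈ G) (hs : slope g = 1) (z : ℂ) :
    g z - z ∈ translations G := by
  rw [mem_translations]
  convert hg using 1
  refine aff_ext (by rw [slope_mkAff, hs]) ?_
  rw [mkAff_apply, apply_eq g z, hs]
  ring

theorem slope_mul_mem_translations {g : Aff} (hg : g ∈ G) {b : ℂ} (hb : b ∈ translations G) :
    slope g * b ∈ translations G := by
  have h := G.mul_mem (G.mul_mem hg hb) (G.inv_mem hg)
  have h1 := sub_mem_translations h (by rw [slope_conj, slope_mkAff]) 0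
  rw [conj_apply_zero _ _ (slope_mkAff _ _ _), mkAff_apply] at h1
  simpa using h1

theorem IsDiscreteGroup.finite_translations (hG : IsDiscreteGroup G) (r : ℝ) :
    {b | b ∈ translations G ∧ ‖b‖ ≤ r}.Finite := by
  refine ((hG {0} (Metric.closedBall 0 r) isCompact_singleton (isCompact_closedBall 0 r)).image
    fun g => g 0).subset ?_
  rintro b ⟨hb, hbr⟩
  refine ⟨mkAff 1 b one_ne_zero, ⟨hb, b, ⟨0, rfl, ?_⟩, by simpa using hbr⟩, ?_⟩ <;> simp

/-- A nonzero discrete group of vectors has a shortest nonzero vector. -/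
theorem exists_shortest {Λ : AddSubgroup ℂ} (hfin : ∀ r : ℝ, {b | b ∈ Λ ∧ ‖b‖ ≤ r}.Finite)
    (hne : Λ ≠ ⊥) : ∃ w ∈ Λ, w ≠ 0 ∧ ∀ b ∈ Λ, b ≠ 0 → ‖w‖ ≤ ‖b‖ := by
  obtain ⟨b₀, hb₀, hb₀0⟩ : ∃ b ∈ Λ, b ≠ 0 := by
    by_contra hcon
    push Not at hcon
    exact hne ((AddSubgroup.eq_bot_iff_forall Λ).2 hcon)
  have hfin' := (hfin ‖b₀‖).subset (t := {b | (b ∈ Λ ∧ ‖b‖ ≤ ‖b₀‖) ∧ b ≠ 0})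
    fun b hb => hb.1
  obtain ⟨w, hw, hmin⟩ := Set.exists_min_image _ (fun b : ℂ => ‖b‖) hfin'
    ⟨b₀, ⟨hb₀, le_rfl⟩, hb₀0⟩
  refine ⟨w, hw.1.1, hw.2, fun b hb hb0 => ?_⟩
  rcases le_total ‖b‖ ‖b₀‖ with h | h
  · exact hmin b ⟨⟨hb, h⟩, hb0⟩
  · exact hw.1.2.trans h

/-- The group of rotational parts is finite: it maps a shortest translation to vectors of the
same length, and if there is no translation, the group is commutative and fixes a point. -/
theorem IsDiscreteGroup.finite_slopes (hG : IsDiscreteGroup G) :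
    (slope '' (G : Set Aff)).Finite := by
  by_cases hne : translations G = ⊥
  · have hinj : ∀ g ∈ G, slope g = 1 → g = 1 := by
      intro g hg hs
      have h := sub_mem_translations hg hs 0
      rw [hne, AddSubgroup.mem_bot, sub_zero] at h
      exact aff_ext (by rw [hs, slope_one]) (by rw [h, one_apply])
    by_cases htriv : ∃ g ∈ G, slope g ≠ 1
    · obtain ⟨g, hg, hs⟩ := htriv
      have hne' : 1 - slope g ≠ 0 := sub_ne_zero.2 (Ne.symm hs)
      set p := g 0 / (1 - slope g) with hp
      have hfix : g p = p := by
        rw [apply_eq g p, hp]; field_simp; ring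
      refine ((hG.finite_stab p).image slope).subset (Set.image_mono fun h hh => ⟨hh, ?_⟩)
      -- `h` commutes with `g`, and so preserves its only fixed point
      have hcomm : h * g * h⁻¹ * g⁻¹ = 1 := by
        refine hinj _ (G.mul_mem (G.mul_mem (G.mul_mem hh hg) (G.inv_mem hh)) (G.inv_mem hg)) ?_
        rw [slope_mul, slope_conj, slope_inv, mul_inv_cancel₀ (slope_ne_zero g)]
      have hgh : g (h p) = h p := by
        have : h * g = g * h := by
          rw [mul_inv_eq_one, mul_inv_eq_iff_eq_mul] at hcomm
          exact hcomm
        rw [← mul_apply, ← this, mul_apply, hfix]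
      by_contra hhp
      exact hs (by rw [eq_one_of_fixes_two hhp hfix hgh, slope_one])
    · push Not at htriv
      refine (Set.finite_singleton (1 : ℂ)).subset ?_
      rintro _ ⟨g, hg, rfl⟩
      exact htriv g hg
  · obtain ⟨w, hw, hw0, -⟩ := exists_shortest hG.finite_translations hne
    refine ((hG.finite_translations ‖w‖).image fun b => b / w).subset ?_
    rintro _ ⟨g, hg, rfl⟩
    refine ⟨slope g * w, ⟨slope_mul_mem_translations hg hw, ?_⟩, ?_⟩
    · rw [norm_mul, hG.norm_slope hg, one_mul]
    · exact mul_div_cancel_right₀ _ hw0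

/-- The rotational parts are the roots of unity of some order. -/
theorem IsDiscreteGroup.exists_slopes_eq (hG : IsDiscreteGroup G) :
    ∃ k : ℕ, 0 < k ∧ slope '' (G : Set Aff) = {a : ℂ | a ^ k = 1} := by
  let f : Aff →* ℂˣ :=
    { toFun := fun g => Units.mk0 (slope g) (slope_ne_zero g)
      map_one' := Units.ext slope_one
      map_mul' := fun g h => Units.ext (slope_mul g h) }
  have himg : (fun u : ℂˣ => (u : ℂ)) '' (G.map f : Set ℂˣ) = slope '' (G : Set Aff) := by
    ext a
    constructor
    · rintro ⟨_, ⟨g, hg, rfl⟩, rfl⟩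
      exact ⟨g, hg, rfl⟩
    · rintro ⟨g, hg, rfl⟩
      exact ⟨f g, ⟨g, hg, rfl⟩, rfl⟩
  have hfin : Finite (G.map f) :=
    Set.Finite.of_finite_image (himg ▸ hG.finite_slopes) Units.val_injective.injOn
  have hk : 0 < Nat.card (G.map f) := Nat.card_pos
  refine ⟨Nat.card (G.map f), hk, Set.eq_of_subset_of_ncard_le ?_ ?_ (finite_roots hk)⟩
  · rintro _ ⟨g, hg, rfl⟩
    have h := pow_card_eq_one' (x := (⟨f g, ⟨g, hg, rfl⟩⟩ : G.map f))
    have h1 := congrArg (fun u : G.map f => ((u : ℂˣ) : ℂ)) h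
    simpa [f] using h1
  · rw [ncard_roots hk.ne', ← himg, Set.ncard_image_of_injective _ Units.val_injective]
    exact (Nat.card_coe_set_eq _).le

/-- In a coordinate with the fixed point of a generating rotation as origin, the elements of `G`
are given independently by their rotational parts and their translational parts. -/
theorem exists_origin {k : ℕ} (hk : 0 < k) (hU : slope '' (G : Set Aff) = {a : ℂ | a ^ k = 1}) :
    ∃ p : ℂ, ∀ g : Aff, g ∈ G ↔ slope g ^ k = 1 ∧ g p - p ∈ translations G := by
  have hprim := Complex.isPrimitiveRoot_exp k hk.ne'
  obtain ⟨h, hh, hs⟩ : Complex.exp (2 * Real.pi * Complex.I / k) ∈ slope '' (G : Set Aff) := by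
    rw [hU]
    exact hprim.pow_eq_one
  rw [← hs] at hprim
  -- if `k = 1`, the origin may be any point, and `h` may be taken to be the identity
  obtain ⟨h, hh, hprim, p, hp⟩ : ∃ h ∈ G, IsPrimitiveRoot (slope h) k ∧ ∃ p, h p = p := by
    by_cases h1 : slope h = 1
    · refine ⟨1, G.one_mem, ?_, 0, rfl⟩
      rwa [slope_one, ← h1]
    · have hne : 1 - slope h ≠ 0 := sub_ne_zero.2 (Ne.symm h1)
      refine ⟨h, hh, hprim, h 0 / (1 - slope h), ?_⟩
      rw [apply_eq h]; field_simp; ring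
  have hpow : ∀ n : ℕ, (h ^ n) p = p := by
    intro n
    induction n with
    | zero => rfl
    | succ n ih => rw [pow_succ, mul_apply, hp, ih]
  have : NeZero k := ⟨hk.ne'⟩
  refine ⟨p, fun g => ⟨fun hg => ⟨?_, ?_⟩, fun ⟨hgk, hgp⟩ => ?_⟩⟩
  · have : slope g ∈ slope '' (G : Set Aff) := ⟨g, hg, rfl⟩
    rw [hU] at this
    exact this
  · have hgk : slope g ∈ slope '' (G : Set Aff) := ⟨g, hg, rfl⟩
    rw [hU] at hgk
    obtain ⟨i, -, hi⟩ := hprim.eq_pow_of_pow_eq_one hgk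
    have hmem := sub_mem_translations (G.mul_mem hg (G.inv_mem (G.pow_mem hh i))) (by
      rw [slope_mul, slope_inv, slope_pow, hi, mul_inv_cancel₀ (slope_ne_zero g)]) p
    have hinv : (h ^ i)⁻¹ p = p := by
      conv_lhs => rw [← hpow i]
      exact inv_apply_apply _ _
    rwa [mul_apply, hinv] at hmem
  · obtain ⟨i, -, hi⟩ := hprim.eq_pow_of_pow_eq_one hgk
    have : g = mkAff 1 (g p - p) one_ne_zero * h ^ i := by
      refine aff_ext (by rw [slope_mul, slope_mkAff, slope_pow, hi, one_mul]) ?_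
      have h1 := apply_eq g p
      have h2 := apply_eq (h ^ i) p
      rw [slope_pow, hi, hpow] at h2
      rw [mul_apply, mkAff_apply]
      linear_combination -h1 + h2
    rw [this]
    exact G.mul_mem hgp (G.pow_mem hh i)

theorem affConj_of_translations {k : ℕ} (hk : 0 < k) {Λ : AddSubgroup ℂ}
    (hΛ : ∀ a b : ℂ, a ^ k = 1 → b ∈ Λ → a * b ∈ Λ)
    (hU : slope '' (G : Set Aff) = {a : ℂ | a ^ k = 1}) {α : ℂ} (hα : α ≠ 0)
    (h : ∀ b, b ∈ translations G ↔ α * b ∈ Λ) : AffConj G (affineGroup k Λ hk hΛ) := by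
  obtain ⟨p, hp⟩ := exists_origin hk hU
  refine affConj_of_mem_iff (mkAff α (-(α * p)) hα) fun g => ?_
  have hinv : (mkAff α (-(α * p)) hα)⁻¹ 0 = p := by
    rw [AffineEquiv.inv_def, AffineEquiv.symm_apply_eq]
    simp
  rw [mem_affineGroup, slope_conj, hp, h, mul_apply, mul_apply, hinv, mkAff_apply]
  ring_nf

/-! ### The crystallographic restriction -/

/-- Groups of vectors containing `1`, all of whose nonzero vectors have norm at least `1`. -/
structure IsNormalized (Λ : AddSubgroup ℂ) : Prop where
  one_mem : (1 : ℂ) ∈ Λ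
  eq_zero : ∀ b ∈ Λ, ‖b‖ < 1 → b = 0

theorem IsNormalized.order_mem {Λ : AddSubgroup ℂ} (h : IsNormalized Λ) {k : ℕ} (hk : 0 < k)
    (hΛ : ∀ a b : ℂ, a ^ k = 1 → b ∈ Λ → a * b ∈ Λ) :
    k = 1 ∨ k = 2 ∨ k = 3 ∨ k = 4 ∨ k = 6 := by
  have hprim := Complex.isPrimitiveRoot_exp k hk.ne'
  set ζ := Complex.exp (2 * Real.pi * Complex.I / k) with hζ
  have hmem : ∀ n : ℕ, ζ ^ n ∈ Λ := fun n => by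
    have := hΛ (ζ ^ n) 1 (by rw [← pow_mul, mul_comm, pow_mul, hprim.pow_eq_one, one_pow]) h.one_mem
    rwa [mul_one] at this
  have hexp : ∀ n : ℕ, ζ ^ n = Complex.exp ((n * (2 * Real.pi / k) : ℝ) * Complex.I) := by
    intro n
    rw [hζ, ← Complex.exp_nat_mul]
    congr 1
    push_cast
    ring
  have hnorm : ∀ (ε θ : ℝ), ε ^ 2 = 1 → 2 * ε * Real.cos θ < -1 →
      ‖Complex.exp (θ * Complex.I) + ε‖ < 1 := by
    intro ε θ hε hc
    rw [← sq_lt_one_iff₀ (norm_nonneg _), Complex.sq_norm, Complex.normSq_apply]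
    simp only [Complex.add_re, Complex.add_im, Complex.ofReal_re, Complex.ofReal_im,
      Complex.exp_ofReal_mul_I_re, Complex.exp_ofReal_mul_I_im, add_zero]
    nlinarith [Real.sin_sq_add_cos_sq θ]
  have hpi := Real.pi_pos
  by_contra hcon
  push Not at hcon
  have hk5 : k = 5 ∨ 7 ≤ k := by omega
  rcases hk5 with rfl | hk7
  · -- here `ζ ^ 2 + 1` is too short
    have hcos : 2 * (1 : ℝ) * Real.cos ((2 : ℕ) * (2 * Real.pi / (5 : ℕ))) < -1 := by
      have h1 : Real.cos ((2 : ℕ) * (2 * Real.pi / (5 : ℕ))) = -Real.cos (Real.pi / 5) := by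
        rw [← Real.cos_pi_sub]
        congr 1
        push_cast
        ring
      have h2 : Real.cos (Real.pi / 3) < Real.cos (Real.pi / 5) :=
        Real.cos_lt_cos_of_nonneg_of_le_pi (by positivity) (by linarith) (by linarith)
      rw [Real.cos_pi_div_three] at h2
      rw [h1]
      linarith
    have hn := hnorm 1 _ (by norm_num) hcos
    rw [← hexp] at hn
    have h0 := h.eq_zero _ (Λ.add_mem (hmem 2) (by simpa using h.one_mem)) hn
    refine hprim.pow_ne_one_of_pos_of_lt (l := 4) (by norm_num) (by norm_num) ?_
    push_cast at h0
    linear_combination (ζ ^ 2 - 1) * h0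
  · -- here `ζ - 1` is too short
    have hk7' : (7 : ℝ) ≤ k := by exact_mod_cast hk7
    have hcos : 2 * (-1 : ℝ) * Real.cos ((1 : ℕ) * (2 * Real.pi / k)) < -1 := by
      have h2 : Real.cos (Real.pi / 3) < Real.cos ((1 : ℕ) * (2 * Real.pi / k)) := by
        refine Real.cos_lt_cos_of_nonneg_of_le_pi (by positivity) (by linarith) ?_
        rw [Nat.cast_one, one_mul, div_lt_iff₀ (by linarith)]
        nlinarith
      rw [Real.cos_pi_div_three] at h2
      linarith
    have hn := hnorm (-1) _ (by norm_num) hcos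
    rw [← hexp] at hn
    have h0 := h.eq_zero _ (Λ.add_mem (hmem 1) (by simpa using h.one_mem)) hn
    refine hprim.pow_ne_one_of_pos_of_lt (l := 1) (by norm_num) (by omega) ?_
    push_cast at h0
    linear_combination h0

theorem lattice_le {Λ : AddSubgroup ℂ} {c : ℂ} (h1 : (1 : ℂ) ∈ Λ) (hc : c ∈ Λ) : lattice c ≤ Λ := by
  rw [lattice, AddSubgroup.closure_le]
  rintro x (rfl | hx)
  · exact h1
  · rw [Set.mem_singleton_iff.1 hx]
    exact hc

/-- If nearest-point rounding modulo the lattice `(1, c) ⊆ Λ` leaves remainders of norm less than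
one, then all remainders of vectors of `Λ` vanish. -/
theorem IsNormalized.eq_lattice_of_round {Λ : AddSubgroup ℂ} (h : IsNormalized Λ) {c : ℂ}
    (hc : c.im ≠ 0) (hcΛ : c ∈ Λ)
    (hnorm : ∀ x y : ℝ, |x| ≤ 1 / 2 → |y| ≤ 1 / 2 → ‖(x + y * c : ℂ)‖ < 1) : Λ = lattice c := by
  refine le_antisymm (fun b hb => ?_) (lattice_le h.one_mem hcΛ)
  obtain ⟨x, y, rfl⟩ := real_coords_exist hc b
  have hl : (round x + round y * c : ℂ) ∈ lattice c := mem_lattice_iff.2 ⟨_, _, rfl⟩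
  have h0 := h.eq_zero _ (Λ.sub_mem hb (lattice_le h.one_mem hcΛ hl)) (by
    have := hnorm (x - round x) (y - round y) (abs_sub_round x) (abs_sub_round y)
    convert this using 2
    push_cast
    ring)
  rw [sub_eq_zero.1 h0]
  exact hl

theorem IsNormalized.eq_lattice_I {Λ : AddSubgroup ℂ} (h : IsNormalized Λ)
    (hI : Complex.I ∈ Λ) : Λ = lattice Complex.I := by
  refine h.eq_lattice_of_round (by simp) hI fun x y hx hy => ?_
  rw [← sq_lt_one_iff₀ (norm_nonneg _), Complex.sq_norm, Complex.normSq_apply]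
  simp
  rw [abs_le] at hx hy
  nlinarith

theorem IsNormalized.eq_lattice_tau6 {Λ : AddSubgroup ℂ} (h : IsNormalized Λ)
    (hτ : tau6 ∈ Λ) : Λ = lattice tau6 := by
  refine h.eq_lattice_of_round tau6_im_ne_zero hτ fun x y hx hy => ?_
  have hre : tau6.re = 1 / 2 := by
    have h1 := congrArg Complex.im tau6_sq
    simp at h1
    have h2 : tau6.im * (2 * tau6.re - 1) = 0 := by linarith
    rcases mul_eq_zero.1 h2 with h2 | h2
    · exact absurd h2 tau6_im_ne_zero
    · linarith
  have him : tau6.im * tau6.im = 3 / 4 := by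
    have h1 := congrArg Complex.re tau6_sq
    simp [hre] at h1
    linarith
  rw [← sq_lt_one_iff₀ (norm_nonneg _), Complex.sq_norm, Complex.normSq_apply]
  simp [hre]
  rw [abs_le] at hx hy
  have : (x + y * 2⁻¹) * (x + y * 2⁻¹) + y * tau6.im * (y * tau6.im) = x ^ 2 + x * y + y ^ 2 := by
    linear_combination y ^ 2 * him
  rw [this]
  nlinarith

/-- Without symmetry, a normalized group is `ℤ` or a lattice with a second generator `c` at the
least positive distance from the real line. -/
theorem IsNormalized.eq_integers_or_lattice {Λ : AddSubgroup ℂ} (h : IsNormalized Λ)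
    (hfin : ∀ r : ℝ, {b | b ∈ Λ ∧ ‖b‖ ≤ r}.Finite) :
    Λ = integers ∨ ∃ c : ℂ, c.im ≠ 0 ∧ Λ = lattice c := by
  have hint : ∀ m : ℤ, (m : ℂ) ∈ Λ := fun m => by
    have := Λ.zsmul_mem h.one_mem m
    rwa [zsmul_eq_mul, mul_one] at this
  have hreal : ∀ b ∈ Λ, b.im = 0 → b = (⌊b.re⌋ : ℤ) := by
    intro b hb him
    have hb' : b = (b.re : ℂ) := Complex.ext rfl (by simpa using him)
    have h0 := h.eq_zero _ (Λ.sub_mem hb (hint ⌊b.re⌋)) (by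
      have : b - (⌊b.re⌋ : ℤ) = ((Int.fract b.re : ℝ) : ℂ) := by
        conv_lhs => rw [hb']
        rw [Int.fract]
        push_cast
        rfl
      rw [this, Complex.norm_real, Real.norm_eq_abs, abs_of_nonneg (Int.fract_nonneg _)]
      exact Int.fract_lt_one _)
    exact sub_eq_zero.1 h0
  by_cases hall : ∀ b ∈ Λ, b.im = 0
  · refine Or.inl (le_antisymm (fun b hb => ?_) fun b hb => ?_)
    · exact mem_integers_iff.2 ⟨_, hreal b hb (hall b hb)⟩
    · obtain ⟨m, rfl⟩ := mem_integers_iff.1 hb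
      exact hint m
  · push Not at hall
    obtain ⟨b₀, hb₀, him⟩ := hall
    right
    -- translating by integers, the candidates for `c` lie in a bounded region
    have hfin' : {b : ℂ | (b ∈ Λ ∧ b.im ≠ 0) ∧ |b.re| ≤ 1 / 2 ∧ |b.im| ≤ |b₀.im|}.Finite :=
      (hfin (1 / 2 + |b₀.im|)).subset fun b hb =>
        ⟨hb.1.1, (Complex.norm_le_abs_re_add_abs_im b).trans (add_le_add hb.2.1 hb.2.2)⟩
    have hround : ∀ b ∈ Λ, b - (round b.re : ℤ) ∈ Λ ∧ |(b - (round b.re : ℤ) : ℂ).re| ≤ 1 / 2 ∧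
        (b - (round b.re : ℤ) : ℂ).im = b.im := fun b hb =>
      ⟨Λ.sub_mem hb (hint _), by simpa using abs_sub_round b.re, by simp⟩
    obtain ⟨h1, h2, h3⟩ := hround b₀ hb₀
    obtain ⟨c, ⟨⟨hcΛ, hc⟩, -, hcb⟩, hmin⟩ := Set.exists_min_image _ (fun b : ℂ => |b.im|) hfin'
      ⟨_, ⟨h1, by rwa [h3]⟩, h2, by rw [h3]⟩
    refine ⟨c, hc, le_antisymm (fun b hb => ?_) (lattice_le h.one_mem hcΛ)⟩
    obtain ⟨x, y, hxy⟩ := real_coords_exist hc b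
    have hmem : b - (⌊y⌋ : ℤ) * c ∈ Λ := by
      have := Λ.zsmul_mem hcΛ ⌊y⌋
      rw [zsmul_eq_mul] at this
      exact Λ.sub_mem hb this
    have him' : (b - (⌊y⌋ : ℤ) * c : ℂ).im = Int.fract y * c.im := by
      rw [hxy]
      simp [← Int.self_sub_floor]
      ring
    have hlt : |(b - (⌊y⌋ : ℤ) * c : ℂ).im| < |c.im| := by
      rw [him', abs_mul, abs_of_nonneg (Int.fract_nonneg y)]
      exact mul_lt_of_lt_one_left (abs_pos.2 hc) (Int.fract_lt_one y)
    have hzero : (b - (⌊y⌋ : ℤ) * c : ℂ).im = 0 := by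
      by_contra hne
      obtain ⟨h1, h2, h3⟩ := hround _ hmem
      have := hmin _ ⟨⟨h1, by rwa [h3]⟩, h2, by rw [h3]; exact hlt.le.trans hcb⟩
      simp only [h3] at this
      exact absurd hlt this.not_gt
    have hfl := hreal _ hmem hzero
    exact mem_lattice_iff.2 ⟨_, ⌊y⌋, eq_add_of_sub_eq hfl⟩

/-! ### The classification -/

theorem GroupType.isDiscreteGroup : ∀ t : GroupType, IsDiscreteGroup t.group
  | .type1 k hk => isDiscreteGroup_rotations k hk
  | .type2 => isDiscreteGroup_integerTranslations
  | .type3 => isDiscreteGroup_integerDihedral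
  | .type4 _ hc => isDiscreteGroup_lattice (hk := one_pos) (hΛ := stable_one _) hc
  | .type5 _ hc => isDiscreteGroup_lattice (hk := two_pos) (hΛ := stable_two _) hc
  | .type6 => isDiscreteGroup_lattice (hk := four_pos) (hΛ := stable_four) (by simp)
  | .type7 => isDiscreteGroup_lattice (hk := three_pos) (hΛ := stable_three) tau6_im_ne_zero
  | .type8 => isDiscreteGroup_lattice (hk := (by norm_num)) (hΛ := stable_six) tau6_im_ne_zero

theorem IsDiscreteGroup.exists_type (hG : IsDiscreteGroup G) :
    ∃ t : GroupType, AffConj G t.group := by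
  obtain ⟨k, hk, hU⟩ := hG.exists_slopes_eq
  by_cases hne : translations G = ⊥
  · refine ⟨.type1 k hk, affConj_of_translations hk (by simp) hU one_ne_zero fun b => ?_⟩
    rw [hne, one_mul]
  obtain ⟨w, hw, hw0, hmin⟩ := exists_shortest hG.finite_translations hne
  -- the group of translations in the coordinate for which the vector `w` becomes `1`
  let Λ : AddSubgroup ℂ := (translations G).comap (AddMonoidHom.mulLeft w)
  have hΛmem : ∀ b, b ∈ Λ ↔ w * b ∈ translations G := fun b => Iff.rfl
  have hw0' : 0 < ‖w‖ := norm_pos_iff.2 hw0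
  have hΛ : ∀ b, b ∈ translations G ↔ w⁻¹ * b ∈ Λ := fun b => by
    rw [hΛmem, mul_inv_cancel_left₀ hw0]
  have hnorm : IsNormalized Λ := by
    refine ⟨by rwa [hΛmem, mul_one], fun b hb hb1 => ?_⟩
    by_contra hb0
    have := hmin (w * b) hb (mul_ne_zero hw0 hb0)
    rw [norm_mul] at this
    nlinarith
  have hfin : ∀ r : ℝ, {b | b ∈ Λ ∧ ‖b‖ ≤ r}.Finite := fun r => by
    refine ((hG.finite_translations (‖w‖ * r)).preimage
      (mul_right_injective₀ hw0).injOn).subset fun b hb => ⟨hb.1, ?_⟩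
    rw [norm_mul]
    exact mul_le_mul_of_nonneg_left hb.2 hw0'.le
  have hstable : ∀ a b : ℂ, a ^ k = 1 → b ∈ Λ → a * b ∈ Λ := by
    intro a b ha hb
    obtain ⟨g, hg, rfl⟩ : a ∈ slope '' (G : Set Aff) := by rw [hU]; exact ha
    rw [hΛmem, mul_left_comm]
    exact slope_mul_mem_translations hg hb
  have hroot : ∀ a : ℂ, a ^ k = 1 → a ∈ Λ := fun a ha => by
    simpa using hstable a 1 ha hnorm.one_mem
  have hwi := inv_ne_zero hw0
  rcases hnorm.order_mem hk hstable with rfl | rfl | rfl | rfl | rfl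
  · rcases hnorm.eq_integers_or_lattice hfin with h | ⟨c, hc, h⟩ <;> rw [h] at hΛ
    · exact ⟨.type2, affConj_of_translations hk (stable_one _) hU hwi hΛ⟩
    · exact ⟨.type4 c hc, affConj_of_translations hk (stable_one _) hU hwi hΛ⟩
  · rcases hnorm.eq_integers_or_lattice hfin with h | ⟨c, hc, h⟩ <;> rw [h] at hΛ
    · exact ⟨.type3, affConj_of_translations hk (stable_two _) hU hwi hΛ⟩
    · exact ⟨.type5 c hc, affConj_of_translations hk (stable_two _) hU hwi hΛ⟩
  · have hτ : tau6 ∈ Λ := by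
      have := hroot (tau6 - 1) (by linear_combination (tau6 - 2) * tau6_sq)
      simpa using Λ.add_mem this hnorm.one_mem
    rw [hnorm.eq_lattice_tau6 hτ] at hΛ
    exact ⟨.type7, affConj_of_translations hk stable_three hU hwi hΛ⟩
  · rw [hnorm.eq_lattice_I (hroot _ Complex.I_pow_four)] at hΛ
    exact ⟨.type6, affConj_of_translations hk stable_four hU hwi hΛ⟩
  · rw [hnorm.eq_lattice_tau6 (hroot _ tau6_primitive.pow_eq_one)] at hΛ
    exact ⟨.type8, affConj_of_translations hk stable_six hU hwi hΛ⟩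

/-! ### The quotients -/

theorem quotientData : ∀ (t : GroupType) (G : Subgroup Aff),
    AffConj G t.group → t.QuotientData G := by
  have key : ∀ (t : GroupType) (G : Subgroup Aff), AffConj G t.group → ∀ {R : Multiset ℕ∞},
      (∃ π σ, IsQuotientCovering t.group π σ ∧ σ.orders = R) →
      ∃ π σ, IsQuotientCovering G π σ ∧ σ.orders = R := by
    rintro t G h R ⟨π, σ, hσ, hR⟩
    obtain ⟨π', h'⟩ := hσ.of_conj t.isDiscreteGroup h
    exact ⟨π', σ, h', hR⟩
  intro t G h
  have hG := t.isDiscreteGroup.of_affConj h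
  cases t with
  | type1 k hk =>
    obtain ⟨π, σ, hσ, hR⟩ := key _ G h (exists_signature_rotations hk)
    exact hσ.hasOrders hG hR (by split_ifs <;> simp)
  | type2 =>
    obtain ⟨π, σ, hσ, hR⟩ := key _ G h exists_signature_integerTranslations
    exact hσ.hasOrders hG hR (by simp)
  | type3 =>
    obtain ⟨π, σ, hσ, hR⟩ := key _ G h exists_signature_integerDihedral
    exact hσ.hasOrders hG hR (by simp)
  | type4 c hc => exact quotientIsGenusOneCurve hc h
  | type5 c hc =>
    obtain ⟨π, σ, hσ, hR⟩ := key _ G h (exists_signature_latticeTwo hc)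
    exact hσ.hasFourPointSignature hG hR
  | type6 =>
    obtain ⟨π, σ, hσ, hR⟩ := key _ G h exists_signature_latticeFour
    exact hσ.hasOrders hG hR (by simp)
  | type7 =>
    obtain ⟨π, σ, hσ, hR⟩ := key _ G h exists_signature_latticeThree
    exact hσ.hasOrders hG hR (by simp)
  | type8 =>
    obtain ⟨π, σ, hσ, hR⟩ := key _ G h exists_signature_latticeSix
    exact hσ.hasOrders hG hR (by simp)

end AffineDiscrete

theorem theorem8 :
    -- classification up to an affine change of the coordinate
    (∀ G : Subgroup AffineDiscrete.Aff,
      AffineDiscrete.IsDiscreteGroup G ↔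
        ∃ t : AffineDiscrete.GroupType, AffineDiscrete.AffConj G t.group) ∧
    -- the parameter of the lattice is defined up to the action of the modular group
    (∀ c c' : ℂ, c.im ≠ 0 → c'.im ≠ 0 →
      (AffineDiscrete.AffConj (AffineDiscrete.latticeTranslations c)
          (AffineDiscrete.latticeTranslations c') ↔ AffineDiscrete.ModularEquiv c c') ∧
      (AffineDiscrete.AffConj (AffineDiscrete.latticeTwo c)
          (AffineDiscrete.latticeTwo c') ↔ AffineDiscrete.ModularEquiv c c')) ∧
    -- the signature of the quotient covering
    (∀ (t : AffineDiscrete.GroupType) (G : Subgroup AffineDiscrete.Aff),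
      AffineDiscrete.AffConj G t.group → t.QuotientData G) := by
  refine ⟨fun G => ⟨fun hG => hG.exists_type, fun ⟨t, ht⟩ => t.isDiscreteGroup.of_affConj ht⟩,
    fun c c' hc _ => ⟨?_, ?_⟩, AffineDiscrete.quotientData⟩
  · rw [AffineDiscrete.latticeTranslations, AffineDiscrete.latticeTranslations,
      AffineDiscrete.affConj_affineGroup_iff, AffineDiscrete.similar_lattice_iff hc]
  · rw [AffineDiscrete.latticeTwo, AffineDiscrete.latticeTwo,
      AffineDiscrete.affConj_affineGroup_iff, AffineDiscrete.similar_lattice_iff hc]
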